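/- Let $\beta>1$ be real and $\alpha=\frac{\beta+1/\beta}{3}$. There is exactly one meromorphic function $\mathcal R$ on $\mathbb C$ with a double pole at $0$ satisfying $$\mathcal R'^2=4\,\mathcal R\,(\mathcal R+\beta)(\mathcal R+1/\beta).$$ Its group of periods is a rectangular lattice $\Lambda=\mathbb Z\omega_1+\mathbb Z\omega_2$ with $\omega_1>0$ and $\omega_2\in i\,\mathbb R_{>0}$, and $\mathcal R=\wp_\Lambda-\alpha$, where $\wp_\Lambda$ is the Weierstrass function of $\Lambda$. Put $d=\beta-\frac1\beta$, $\delta=\sqrt{\beta/d}$, $\gamma^{\pm}=1\pm\frac1\delta$, $\gamma=1-\frac{i\beta}{\delta}$. For $x>1$ let $$x_0=1-\sqrt{x+1},\quad x_1=1-\sqrt{1+\tfrac1x},\quad x_2=1+\sqrt{1+\tfrac1x},\quad x_3=1+\sqrt{x+1},$$ and let $\beta_k$, $\delta_k$ ($k=0,1,2,3$) be these numbers for $x=\beta$ and $x=\delta$ respectively. Put $$\gamma_{jk}=1+\frac{\delta_j\delta_k}{\delta}\ \ (jk=02,13,01,23),\qquad \beta^{\pm}=1\pm\sqrt{1-\tfrac1\beta},\qquad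 \delta^{\pm}=1\pm\frac{\sqrt{1+\frac1\beta}-\sqrt{1-\frac1\beta}}{\sqrt2},$$ $$\gamma_0=1-i\sqrt{\beta-1},\qquad \gamma_{\pm}=1-\frac{\delta^{\pm}\left(1+i\sqrt{\delta-1}\right)}{\delta}.$$ Let $$b=\frac{1+\sqrt[3]{19-3\sqrt{33}}+\sqrt[3]{19+3\sqrt{33}}}{3}\approx1.8393,$$ which is the unique real root of $x^3-x^2-x-1$, and let $\operatorname{sgn}(x)=1$ for $x>0$, $\operatorname{sgn}(x)=-1$ for $x<0$, $\operatorname{sgn}(0)=0$. Put $$\gamma_{41}=\Bigl(1-\sqrt{\tfrac{\beta+1}{2}}\Bigr)\Bigl(1-\tfrac1\beta-i\sqrt{1-\tfrac1{\beta^2}}+\tfrac{\sqrt{\beta+1}\sqrt{\sqrt{\beta+1}+\sqrt2}}{\beta}\Bigl(\sqrt{\tfrac{\beta}{\sqrt{\beta-1}}-\tfrac1{\sqrt{\beta+1}}+\sqrt2}-i\sqrt{\tfrac{\beta}{\sqrt{\beta-1}}+\tfrac1{\sqrt{\beta+1}}-\sqrt2}\Bigr)\Bigr)-1,$$ $$\gamma_{42}=\Bigl(1-\sqrt{\tfrac{\beta+1}{2}}\Bigr)\Bigl(1-\tfrac1\beta+i\sqrt{1-\tfrac1{\beta^2}}-\tfrac{\sqrt{\beta+1}\sqrt{\sqrt{\beta+1}+\sqrt2}}{\beta}\Bigl(\sqrt{\tfrac{\beta}{\sqrt{\beta-1}}-\tfrac1{\sqrt{\beta+1}}+\sqrt2}+i\sqrt{\tfrac{\beta}{\sqrt{\beta-1}}+\tfrac1{\sqrt{\beta+1}}-\sqrt2}\Bigr)\Bigr)-1,$$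 $$\gamma_{43}=\Bigl(\sqrt{\tfrac{\beta+1}{2}}+1\Bigr)\Bigl(1-\tfrac1\beta-i\sqrt{1-\tfrac1{\beta^2}}-\tfrac{\sqrt{\beta+1}\sqrt{\sqrt{\beta+1}-\sqrt2}}{\beta}\Bigl(\operatorname{sgn}(\beta-b)\sqrt{\tfrac{\beta}{\sqrt{\beta-1}}-\tfrac1{\sqrt{\beta+1}}-\sqrt2}-i\sqrt{\tfrac{\beta}{\sqrt{\beta-1}}+\tfrac1{\sqrt{\beta+1}}+\sqrt2}\Bigr)\Bigr)-1,$$ $$\gamma_{44}=\Bigl(\sqrt{\tfrac{\beta+1}{2}}+1\Bigr)\Bigl(1-\tfrac1\beta+i\sqrt{1-\tfrac1{\beta^2}}+\tfrac{\sqrt{\beta+1}\sqrt{\sqrt{\beta+1}-\sqrt2}}{\beta}\Bigl(\operatorname{sgn}(\beta-b)\sqrt{\tfrac{\beta}{\sqrt{\beta-1}}-\tfrac1{\sqrt{\beta+1}}-\sqrt2}+i\sqrt{\tfrac{\beta}{\sqrt{\beta-1}}+\tfrac1{\sqrt{\beta+1}}+\sqrt2}\Bigr)\Bigr)-1.$$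 Then for $0\le j,k\le8$ the value of $\mathcal R$ at $\frac{j\omega_1+k\omega_2}{8}$, and at every translate of this point by an element of $\Lambda$, is the entry in column $j$ and row $k$ of the following table ($\infty$ marks a double pole); for $k=5,6,7,8$ the entry in row $k$ is the complex conjugate of the entry in row $8-k$ and the same column. $$\begin{array}{c|ccccccccc} k\backslash j&0&1&2&3&4&5&6&7&8\\\hline 4&-\beta&\beta_0\beta_2&-1&\beta_1\beta_3&-\frac1\beta&\beta_1\beta_3&-1&\beta_0\beta_2&-\beta\\ 3&-\beta\gamma_{01}&\overline{\gamma_{41}}&-\beta\overline{\gamma_-}&\overline{\gamma_{42}}&-\beta\gamma_{13}&\gamma_{42}&-\beta\gamma_-&\gamma_{41}&-\beta\gamma_{01}\\ 2&-\beta\gamma^+&-\beta^+\overline{\gamma_0}&-\frac{\overline\gamma}{\beta}&-\beta^-\overline{\gamma_0}&-\beta\gamma^-&-\beta^-\gamma_0&-\frac{\gamma}{\beta}&-\beta^+\gamma_0&-\beta\gamma^+\\ 1&-\beta\gamma_{23}&\overline{\gamma_{44}}&-\beta\overline{\gamma_+}&\overline{\gamma_{43}}&-\beta\gamma_{02}&\gamma_{43}&-\beta\gamma_+&\gamma_{44}&-\beta\gamma_{23}\\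 0&\infty&\beta_2\beta_3&1&\beta_0\beta_1&0&\beta_0\beta_1&1&\beta_2\beta_3&\infty \end{array}$$ In particular this gives the value of $\mathcal R$ at every point of $\Lambda/8$. -/

import Mathlib

namespace EighthLattice

noncomputable section

/-- `R` is the essential elliptic function with parameter `β`: a meromorphic function on the plane
with a double pole at `0` that satisfies `R'² = 4 R (R + β) (R + 1/β)`.
Normal form only means that removable singularities are filled in
(and that the junk value at the poles is `0`). -/
structure IsEssentialElliptic (β : ℂ) (R : ℂ → ℂ) : Prop where
  meromorphic : MeromorphicNFOn R Set.univ
  double_pole : meromorphicOrderAt R 0 = -2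
  ode : ∀ z : ℂ, AnalyticAt ℂ R z →
    deriv R z ^ 2 = 4 * R z * (R z + β) * (R z + 1 / β)

/-- `R` takes the value `v` in the extended plane at `z`; the value `∞` means a double pole. -/
def TakesValue (R : ℂ → ℂ) (z : ℂ) : OnePoint ℂ → Prop
  | none => meromorphicOrderAt R z = -2
  | some w => AnalyticAt ℂ R z ∧ R z = w

/-- The ascending quadruple `x₀ < x₁ < x₂ < x₃` attached to `x > 1`. -/
def quad (x : ℝ) : Fin 4 → ℝ :=
  ![1 - √(x + 1), 1 - √(1 + 1 / x), 1 + √(1 + 1 / x), 1 + √(x + 1)]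

/-- `d = β - 1/β`. -/
def d (β : ℝ) : ℝ := β - 1 / β

/-- `δ = √(β / d)`. -/
def δ (β : ℝ) : ℝ := √(β / d β)

/-- `γ⁻ = 1 - 1/δ`. -/
def γMinus (β : ℝ) : ℝ := 1 - 1 / δ β

/-- `γ⁺ = 1 + 1/δ`. -/
def γPlus (β : ℝ) : ℝ := 1 + 1 / δ β

/-- `γ = 1 - i β / δ`. -/
def γ (β : ℝ) : ℂ := 1 - Complex.I * β / δ β

/-- `β_k`, the quadruple of `β`. -/
def βSeq (β : ℝ) (k : Fin 4) : ℝ := quad β k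

/-- `δ_k`, the quadruple of `δ`. -/
def δSeq (β : ℝ) (k : Fin 4) : ℝ := quad (δ β) k

/-- `γ_{jk} = 1 + δ_j δ_k / δ`. -/
def γPair (β : ℝ) (j k : Fin 4) : ℝ := 1 + δSeq β j * δSeq β k / δ β

/-- `β⁻ = 1 - √(1 - 1/β)`. -/
def βMinus (β : ℝ) : ℝ := 1 - √(1 - 1 / β)

/-- `β⁺ = 1 + √(1 - 1/β)`. -/
def βPlus (β : ℝ) : ℝ := 1 + √(1 - 1 / β)

/-- `δ⁻ = 1 - (√(1 + 1/β) - √(1 - 1/β)) / √2`. -/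
def δMinus (β : ℝ) : ℝ := 1 - (√(1 + 1 / β) - √(1 - 1 / β)) / √2

/-- `δ⁺ = 1 + (√(1 + 1/β) - √(1 - 1/β)) / √2`. -/
def δPlus (β : ℝ) : ℝ := 1 + (√(1 + 1 / β) - √(1 - 1 / β)) / √2

/-- `γ₀ = 1 - i √(β - 1)`. -/
def γZero (β : ℝ) : ℂ := 1 - Complex.I * √(β - 1)

/-- `γ₋` (lower index). -/
def γSubMinus (β : ℝ) : ℂ := 1 - δMinus β * (1 + Complex.I * √(δ β - 1)) / δ β

/-- `γ₊` (lower index). -/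
def γSubPlus (β : ℝ) : ℂ := 1 - δPlus β * (1 + Complex.I * √(δ β - 1)) / δ β

/-- The real root of `x³ - x² - x - 1`, in closed form. -/
def bRoot : ℝ :=
  (1 + (19 - 3 * √33) ^ (1 / 3 : ℝ) + (19 + 3 * √33) ^ (1 / 3 : ℝ)) / 3

def γ41 (β : ℝ) : ℂ :=
  (1 - √((β + 1) / 2)) *
    (1 - 1 / β - Complex.I * √(1 - 1 / β ^ 2)
      + √(β + 1) * √(√(β + 1) + √2) / β *
        (√(β / √(β - 1) - 1 / √(β + 1) + √2)
          - Complex.I * √(β / √(β - 1) + 1 / √(β + 1) - √2))) - 1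

def γ42 (β : ℝ) : ℂ :=
  (1 - √((β + 1) / 2)) *
    (1 - 1 / β + Complex.I * √(1 - 1 / β ^ 2)
      - √(β + 1) * √(√(β + 1) + √2) / β *
        (√(β / √(β - 1) - 1 / √(β + 1) + √2)
          + Complex.I * √(β / √(β - 1) + 1 / √(β + 1) - √2))) - 1

/-- At `β = b` the radical multiplied by the sign vanishes, so the value of the sign at `0`
is immaterial. -/
def γ43 (β : ℝ) : ℂ :=
  (√((β + 1) / 2) + 1) *
    (1 - 1 / β - Complex.I * √(1 - 1 / β ^ 2)
      - √(β + 1) * √(√(β + 1) - √2) / β *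
        (Real.sign (β - bRoot) * √(β / √(β - 1) - 1 / √(β + 1) - √2)
          - Complex.I * √(β / √(β - 1) + 1 / √(β + 1) + √2))) - 1

def γ44 (β : ℝ) : ℂ :=
  (√((β + 1) / 2) + 1) *
    (1 - 1 / β + Complex.I * √(1 - 1 / β ^ 2)
      + √(β + 1) * √(√(β + 1) - √2) / β *
        (Real.sign (β - bRoot) * √(β / √(β - 1) - 1 / √(β + 1) - √2)
          + Complex.I * √(β / √(β - 1) + 1 / √(β + 1) + √2))) - 1

/-- A finite complex value as a point of the extended plane. -/
def fin (z : ℂ) : OnePoint ℂ := (z : OnePoint ℂ)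

/-- Complex conjugate. -/
def cj (z : ℂ) : ℂ := (starRingEnd ℂ) z

open OnePoint in
/-- The table of values: the entry in row `k` and column `j` belongs to the node
`(j ω₁ + k ω₂) / 8`, where `ω₁ > 0` and `ω₂ / i > 0`. -/
def table (β : ℝ) : Matrix (Fin 9) (Fin 9) (OnePoint ℂ) :=
  let b := βSeq β
  let g := γPair β
  !![∞, fin (b 2 * b 3), fin 1, fin (b 0 * b 1), fin 0,
        fin (b 0 * b 1), fin 1, fin (b 2 * b 3), ∞;
     fin (-β * g 2 3), fin (cj (γ44 β)), fin (-β * cj (γSubPlus β)), fin (cj (γ43 β)),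
        fin (-β * g 0 2), fin (γ43 β), fin (-β * γSubPlus β), fin (γ44 β), fin (-β * g 2 3);
     fin (-β * γPlus β), fin (-βPlus β * cj (γZero β)), fin (-cj (γ β) / β),
        fin (-βMinus β * cj (γZero β)), fin (-β * γMinus β), fin (-βMinus β * γZero β),
        fin (-γ β / β), fin (-βPlus β * γZero β), fin (-β * γPlus β);
     fin (-β * g 0 1), fin (cj (γ41 β)), fin (-β * cj (γSubMinus β)), fin (cj (γ42 β)),
        fin (-β * g 1 3), fin (γ42 β), fin (-β * γSubMinus β), fin (γ41 β), fin (-β * g 0 1);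
     fin (-β), fin (b 0 * b 2), fin (-1), fin (b 1 * b 3), fin (-1 / β),
        fin (b 1 * b 3), fin (-1), fin (b 0 * b 2), fin (-β);
     fin (-β * g 0 1), fin (γ41 β), fin (-β * γSubMinus β), fin (γ42 β),
        fin (-β * g 1 3), fin (cj (γ42 β)), fin (-β * cj (γSubMinus β)), fin (cj (γ41 β)),
        fin (-β * g 0 1);
     fin (-β * γPlus β), fin (-βPlus β * γZero β), fin (-γ β / β),
        fin (-βMinus β * γZero β), fin (-β * γMinus β), fin (-βMinus β * cj (γZero β)),
        fin (-cj (γ β) / β), fin (-βPlus β * cj (γZero β)), fin (-β * γPlus β);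
     fin (-β * g 2 3), fin (γ44 β), fin (-β * γSubPlus β), fin (γ43 β),
        fin (-β * g 0 2), fin (cj (γ43 β)), fin (-β * cj (γSubPlus β)), fin (cj (γ44 β)),
        fin (-β * g 2 3);
     ∞, fin (b 2 * b 3), fin 1, fin (b 0 * b 1), fin 0,
        fin (b 0 * b 1), fin 1, fin (b 2 * b 3), ∞]

end

end EighthLattice

open Filter Topology Set

/-! Put κ = β + 1/β, so that the equation reads R'² = 4R(R² + κR + 1). A nonconstant solution also
satisfies R'' = 6R² + 4κR + 2, and a solution of this second-order equation is determined by its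
value and derivative at one point. Since 1/R solves the same first-order equation, a pole is as good
an initial condition as a finite value. This uniqueness (`Sol.eq_of_analyticAt`,
`Sol.eq_of_not_analyticAt`) gives all symmetries: evenness, reality, reflection in the zeros of the
cubic, periodicity under every pole, and R(a + z) = 1/R(z) when R(a) = 0.

A solution vanishing at 0 exists locally, being the square of the inverse of an elliptic integral;
the duplication formula extends it to the plane (`exists_meromorphic_extension`), and its reciprocal
is the required function.

On the positive real axis R falls from ∞ to a first zero a, because R'' ≥ 2 while R > 0; so 2a is a
period. The function -(R(iz/n) + β)/n² with n⁴ = β² - 1 solves an equation of the same shape, and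
its first real zero b gives the imaginary period 2ib/n. Conjugation confines the poles to the
half-lattice, and the three other half-periods carry the finite values 0, -β, -1/β, so poles and
periods are exactly the lattice. Then R - ℘ is entire and doubly periodic, hence constant, and
comparing the two differential equations gives the constant.

On each axis, bisection with the duplication formula gives the values at quarters of the
half-period, and monotonicity selects the root and the sign of the derivative. The addition theorem
(`Sol.addition`) combines a real and an imaginary node; `corner_value` and its companions evaluate
it in the radicals h = √β, t = √(β+1), s = √(β-1), n, e = (t+s)/√2, f = (t-s)/√2. Translation by
half-periods supplies column and row 4, and conjugation, parity and periodicity the other three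
quadrants. Finally the nested radicals of the table are shown to be rational in h, n, t, e, f
(`Radicals.nested_radicals`). -/

namespace EssentialElliptic

/-! ### Uniqueness for the second-order equation and for meromorphic functions -/

/-- Differentiation gives f' · (f'' - 6f² - 4κf - 2) = 0. Since f' is not identically zero, its
zeros are isolated and the other factor vanishes on a punctured neighbourhood, hence at the centre
too. -/
theorem eventually_second_order {κ : ℂ} {f : ℂ → ℂ} {a : ℂ} (hf : AnalyticAt ℂ f a)
    (h : ∀ᶠ z in 𝓝[≠] a, deriv f z ^ 2 = 4 * f z * (f z ^ 2 + κ * f z + 1))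
    (hn : ¬ ∀ᶠ z in 𝓝 a, deriv f z = 0) :
    ∀ᶠ z in 𝓝 a, deriv (deriv f) z = 6 * f z ^ 2 + 4 * κ * f z + 2 := by
  have hf' := hf.deriv
  have hf'' := hf'.deriv
  have h1 : (fun z => deriv f z ^ 2) =ᶠ[𝓝 a] fun z => 4 * f z * (f z ^ 2 + κ * f z + 1) :=
    (AnalyticAt.frequently_eq_iff_eventually_eq (by fun_prop) (by fun_prop)).1 h.frequently
  have h2 : ∀ᶠ z in 𝓝 a, deriv f z * (deriv (deriv f) z - (6 * f z ^ 2 + 4 * κ * f z + 2)) = 0 := by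
    filter_upwards [h1.deriv, hf.eventually_analyticAt] with z hz hfz
    have e0 := hfz.differentiableAt.hasDerivAt
    have e1 := (hfz.deriv.differentiableAt.hasDerivAt.pow 2).deriv
    have e2 := ((e0.const_mul 4).mul (((e0.pow 2).add (e0.const_mul κ)).add_const 1)).deriv
    have hz' : deriv (deriv f ^ 2) z = _ := hz.trans e2
    rw [e1] at hz'
    simp at hz'
    linear_combination hz' / 2
  have h3 := (hf'.eventually_eq_zero_or_eventually_ne_zero).resolve_left hn
  refine (AnalyticAt.frequently_eq_iff_eventually_eq (by fun_prop) (by fun_prop)).1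
    (Eventually.frequently (f := 𝓝[≠] a) ?_)
  filter_upwards [h3, h2.filter_mono nhdsWithin_le_nhds] with z hz hz2
  exact sub_eq_zero.1 ((mul_eq_zero.1 hz2).resolve_left hz)

/-- The difference D satisfies D'' = A·D with A analytic. If D had finite order n at a, the initial
values would force n ≥ 2, so D'' would have order n - 2, while A·D has order at least n. -/
theorem eventuallyEq_of_second_order {κ : ℂ} {f g : ℂ → ℂ} {a : ℂ} (hf : AnalyticAt ℂ f a)
    (hg : AnalyticAt ℂ g a)
    (hf2 : ∀ᶠ z in 𝓝 a, deriv (deriv f) z = 6 * f z ^ 2 + 4 * κ * f z + 2)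
    (hg2 : ∀ᶠ z in 𝓝 a, deriv (deriv g) z = 6 * g z ^ 2 + 4 * κ * g z + 2)
    (h0 : f a = g a) (h1 : deriv f a = deriv g a) : f =ᶠ[𝓝 a] g := by
  set D : ℂ → ℂ := fun z => f z - g z with hD
  have hDa : AnalyticAt ℂ D a := hf.sub hg
  have hD1 : deriv D =ᶠ[𝓝 a] fun z => deriv f z - deriv g z := by
    filter_upwards [hf.eventually_analyticAt, hg.eventually_analyticAt] with z hfz hgz
    exact deriv_fun_sub hfz.differentiableAt hgz.differentiableAt
  have hD2 : deriv (deriv D) =ᶠ[𝓝 a] fun z => (6 * (f z + g z) + 4 * κ) * D z := by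
    filter_upwards [hD1.deriv, hf.eventually_analyticAt, hg.eventually_analyticAt, hf2, hg2]
      with z hz hfz hgz e1 e2
    rw [hz, deriv_fun_sub hfz.deriv.differentiableAt hgz.deriv.differentiableAt, e1, e2]
    simp only [hD]; ring
  have key : analyticOrderAt D a = ⊤ := by
    by_contra hne
    obtain ⟨n, hn⟩ := ENat.ne_top_iff_exists.1 hne
    have hn0 : n ≠ 0 := by
      rintro rfl
      exact (hDa.analyticOrderAt_eq_zero.1 hn.symm) (by simp [hD, h0])
    have o0 : meromorphicOrderAt D a = ((n : ℤ) : WithTop ℤ) := by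
      rw [hDa.meromorphicOrderAt_eq, ← hn]; rfl
    have o1 := meromorphicOrderAt_deriv_eq_sub_one (by exact_mod_cast hn0) o0
    have hn1 : n ≠ 1 := by
      rintro rfl
      have : meromorphicOrderAt (deriv D) a = 0 := by rw [o1]; rfl
      have h3 := hDa.deriv.meromorphicNFAt.meromorphicOrderAt_eq_zero_iff.1 this
      exact h3 (by rw [hD1.eq_of_nhds, h1, sub_self])
    have o2 := meromorphicOrderAt_deriv_eq_sub_one (f := deriv D) (x := a) (n := (n : ℤ) - 1)
      (by intro h; exact hn1 (by exact_mod_cast sub_eq_zero.1 (by simpa using h : (n : ℂ) - 1 = 0))) o1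
    have hA : AnalyticAt ℂ (fun z => 6 * (f z + g z) + 4 * κ) a := by fun_prop
    have o3 : meromorphicOrderAt (deriv (deriv D)) a
        = meromorphicOrderAt (fun z => 6 * (f z + g z) + 4 * κ) a + meromorphicOrderAt D a := by
      rw [meromorphicOrderAt_congr (hD2.filter_mono nhdsWithin_le_nhds)]
      exact meromorphicOrderAt_mul hA.meromorphicAt hDa.meromorphicAt
    have o4 := hA.meromorphicOrderAt_nonneg
    rw [o0] at o3
    rw [o2] at o3
    generalize meromorphicOrderAt (fun z => 6 * (f z + g z) + 4 * κ) a = q at o3 o4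
    cases q with
    | top => simp at o3
    | coe q =>
      have h3 : (n : ℤ) - 1 - 1 = q + n := WithTop.coe_injective o3
      have h4 : (0 : ℤ) ≤ q := by exact_mod_cast o4
      omega
  filter_upwards [analyticOrderAt_eq_top.1 key] with z hz
  exact sub_eq_zero.1 hz

theorem eventuallyEq_of_meromorphic {f g : ℂ → ℂ} (hf : Meromorphic f) (hg : Meromorphic g)
    {a : ℂ} (h : f =ᶠ[𝓝[≠] a] g) (b : ℂ) : f =ᶠ[𝓝[≠] b] g := by
  have hm : Meromorphic (f - g) := hf.sub hg
  have ha : meromorphicOrderAt (f - g) a = ⊤ := by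
    rw [meromorphicOrderAt_eq_top_iff]
    filter_upwards [h] with z hz
    simp [hz]
  have hb : meromorphicOrderAt (f - g) b = ⊤ := by
    by_contra hne
    exact (hm.exists_meromorphicOrderAt_ne_top_iff_forall.1 ⟨b, hne⟩) a ha
  filter_upwards [meromorphicOrderAt_eq_top_iff.1 hb] with z hz
  exact sub_eq_zero.1 hz

theorem eq_of_meromorphicNF {f g : ℂ → ℂ} (hf : ∀ z, MeromorphicNFAt f z)
    (hg : ∀ z, MeromorphicNFAt g z) {a : ℂ} (h : f =ᶠ[𝓝[≠] a] g) : f = g := by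
  ext z
  have := eventuallyEq_of_meromorphic (fun z => (hf z).meromorphicAt)
    (fun z => (hg z).meromorphicAt) h z
  exact (((hf z).eventuallyEq_nhdsNE_iff_eventuallyEq_nhds (hg z)).1 this).eq_of_nhds

/-! ### Solutions and the symmetries forced by uniqueness -/

theorem deriv_comp_affine {f : ℂ → ℂ} {b c z : ℂ} (h : AnalyticAt ℂ f (b + c * z)) :
    deriv (fun z => f (b + c * z)) z = deriv f (b + c * z) * c := by
  have hg : HasDerivAt (fun z => b + c * z) c z := by
    simpa using ((hasDerivAt_id z).const_mul c).const_add b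
  exact (HasDerivAt.comp (h := fun z => b + c * z) z h.differentiableAt.hasDerivAt hg).deriv

theorem analyticAt_comp_affine {f : ℂ → ℂ} {b c z : ℂ} (hc : c ≠ 0) :
    AnalyticAt ℂ (fun z => f (b + c * z)) z ↔ AnalyticAt ℂ f (b + c * z) := by
  have hg : HasDerivAt (fun z => b + c * z) c z := by
    simpa using ((hasDerivAt_id z).const_mul c).const_add b
  exact analyticAt_comp_iff_of_deriv_ne_zero (f := fun z => b + c * z) (g := f) (by fun_prop)
    (by rwa [hg.deriv])

/-- Nonconstant meromorphic solutions, in normal form, of `R'² = 4 R (R² + κ R + 1)`. -/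
structure Sol (κ : ℂ) (R : ℂ → ℂ) : Prop where
  nf : ∀ z, MeromorphicNFAt R z
  ode : ∀ z, AnalyticAt ℂ R z → deriv R z ^ 2 = 4 * R z * (R z ^ 2 + κ * R z + 1)
  nonconst : ∃ z, AnalyticAt ℂ R z ∧ deriv R z ≠ 0

theorem ode_of_eventually {κ : ℂ} {f : ℂ → ℂ} {a : ℂ} (hf : AnalyticAt ℂ f a)
    (h : ∀ᶠ z in 𝓝[≠] a, deriv f z ^ 2 = 4 * f z * (f z ^ 2 + κ * f z + 1)) :
    deriv f a ^ 2 = 4 * f a * (f a ^ 2 + κ * f a + 1) := by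
  have hf' := hf.deriv
  have : (fun z => deriv f z ^ 2) =ᶠ[𝓝 a] fun z => 4 * f z * (f z ^ 2 + κ * f z + 1) :=
    (AnalyticAt.frequently_eq_iff_eventually_eq (by fun_prop) (by fun_prop)).1 h.frequently
  exact this.eq_of_nhds

namespace Sol

variable {κ : ℂ} {R R₁ R₂ : ℂ → ℂ}

theorem meromorphic (h : Sol κ R) : Meromorphic R := fun z => (h.nf z).meromorphicAt

theorem eventually_analyticAt (h : Sol κ R) (a : ℂ) : ∀ᶠ z in 𝓝[≠] a, AnalyticAt ℂ R z :=
  (h.meromorphic a).eventually_analyticAt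

theorem eventually_ode (h : Sol κ R) (a : ℂ) :
    ∀ᶠ z in 𝓝[≠] a, deriv R z ^ 2 = 4 * R z * (R z ^ 2 + κ * R z + 1) := by
  filter_upwards [h.eventually_analyticAt a] with z hz using h.ode z hz

theorem not_eventually_const (h : Sol κ R) (a : ℂ) (c : ℂ) : ¬ ∀ᶠ z in 𝓝[≠] a, R z = c := by
  intro hc
  obtain ⟨z, hz, hz'⟩ := h.nonconst
  have h1 := eventuallyEq_of_meromorphic h.meromorphic (g := fun _ => c)
    (fun _ => analyticAt_const.meromorphicAt) hc z
  have h2 : R =ᶠ[𝓝 z] fun _ => c :=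
    (AnalyticAt.frequently_eq_iff_eventually_eq hz analyticAt_const).1 (Eventually.frequently h1)
  exact hz' (by rw [h2.deriv_eq, deriv_const])

theorem eventually_ne (h : Sol κ R) (a : ℂ) (c : ℂ) : ∀ᶠ z in 𝓝[≠] a, R z ≠ c := by
  have h1 : MeromorphicAt (fun z => R z - c) a := (h.meromorphic a).sub (.const _ _)
  rcases h1.eventually_eq_zero_or_eventually_ne_zero with h2 | h2
  · exact absurd (h2.mono fun z hz => sub_eq_zero.1 hz) (h.not_eventually_const a c)
  · exact h2.mono fun z hz => sub_ne_zero.1 hz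

theorem not_eventually_deriv_eq_zero (h : Sol κ R) {a : ℂ} (ha : AnalyticAt ℂ R a) :
    ¬ ∀ᶠ z in 𝓝 a, deriv R z = 0 := by
  intro h0
  obtain ⟨r, hr, hb⟩ := Metric.eventually_nhds_iff_ball.1 (h0.and ha.eventually_analyticAt)
  refine h.not_eventually_const a (R a) (nhdsWithin_le_nhds ?_)
  filter_upwards [Metric.ball_mem_nhds a hr] with z hz
  exact (convex_ball a r).is_const_of_fderivWithin_eq_zero (𝕜 := ℂ)
    (fun w hw => (hb w hw).2.differentiableAt.differentiableWithinAt)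
    (fun w hw => by
      rw [fderivWithin_of_isOpen Metric.isOpen_ball hw]
      ext
      simpa using (hb w hw).1) hz (Metric.mem_ball_self hr)

theorem second_order (h : Sol κ R) {a : ℂ} (ha : AnalyticAt ℂ R a) :
    ∀ᶠ z in 𝓝 a, deriv (deriv R) z = 6 * R z ^ 2 + 4 * κ * R z + 2 :=
  eventually_second_order ha (h.eventually_ode a) (h.not_eventually_deriv_eq_zero ha)

/-- For S = 1/R one has S'² = R'²/R⁴, and the coefficients 1, κ, 1 of the quadratic factor are
symmetric, so the equation is reproduced. This is the device that turns poles into zeros. -/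
theorem inv (h : Sol κ R) : Sol κ R⁻¹ := by
  have hd : ∀ {z}, AnalyticAt ℂ R z → R z ≠ 0 → deriv R⁻¹ z = -deriv R z / R z ^ 2 := fun hz h0 =>
    (hz.differentiableAt.hasDerivAt.inv h0).deriv
  refine ⟨fun z => (h.nf z).inv, fun z hz => ode_of_eventually hz ?_, ?_⟩
  · filter_upwards [h.eventually_analyticAt z, h.eventually_ne z 0] with w hw h0
    rw [hd hw h0, Pi.inv_apply]
    have := h.ode w hw
    field_simp
    rw [this]; ring
  · obtain ⟨z, hz, hz'⟩ := h.nonconst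
    have h0 : R z ≠ 0 := by
      intro h0
      have := h.ode z hz
      rw [h0] at this
      exact hz' (by simpa using this)
    refine ⟨z, hz.inv h0, ?_⟩
    rw [hd hz h0]
    exact div_ne_zero (neg_ne_zero.2 hz') (pow_ne_zero _ h0)

theorem analyticAt_inv (h : Sol κ R) {z : ℂ} (hz : ¬ AnalyticAt ℂ R z) :
    AnalyticAt ℂ R⁻¹ z ∧ R⁻¹ z = 0 := by
  obtain ⟨-, h1, h2⟩ := (meromorphicNFAt_iff_analyticAt_or.1 (h.nf z)).resolve_left hz
  -- A function in normal form has the value 0 at its poles, and 0⁻¹ = 0, so the pointwise inverse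
  -- already has the right value there.
  refine ⟨((h.inv.nf z).meromorphicOrderAt_nonneg_iff_analyticAt).1 ?_, by simp [h2]⟩
  rw [meromorphicOrderAt_inv]
  generalize meromorphicOrderAt R z = q at h1
  cases q with
  | top => simp at h1
  | coe q =>
    have : q < 0 := by exact_mod_cast h1
    have : (0 : ℤ) ≤ -q := by omega
    exact_mod_cast this

theorem comp_affine (h : Sol κ R) (b ε : ℂ) (hε : ε ^ 2 = 1) : Sol κ (fun z => R (b + ε * z)) := by
  have hε0 : ε ≠ 0 := by rintro rfl; norm_num at hε
  refine ⟨fun z => ?_, fun z hz => ?_, ?_⟩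
  · exact MeromorphicNFAt.comp_analyticAt (g := fun z => b + ε * z) (h.nf (b + ε * z))
      (by fun_prop)
  · have hz' := (analyticAt_comp_affine hε0).1 hz
    rw [deriv_comp_affine hz', mul_pow, hε, mul_one]
    exact h.ode _ hz'
  · obtain ⟨z, hz, hz'⟩ := h.nonconst
    have e : b + ε * (ε⁻¹ * (z - b)) = z := by field_simp; ring
    refine ⟨ε⁻¹ * (z - b), (analyticAt_comp_affine hε0).2 (by rwa [e]), ?_⟩
    rw [deriv_comp_affine (by rwa [e]), e]
    exact mul_ne_zero hz' hε0

theorem eq_of_analyticAt (h₁ : Sol κ R₁) (h₂ : Sol κ R₂) {a : ℂ} (ha₁ : AnalyticAt ℂ R₁ a)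
    (ha₂ : AnalyticAt ℂ R₂ a) (h0 : R₁ a = R₂ a) (hd : deriv R₁ a = deriv R₂ a) : R₁ = R₂ :=
  eq_of_meromorphicNF h₁.nf h₂.nf ((eventuallyEq_of_second_order ha₁ ha₂ (h₁.second_order ha₁)
    (h₂.second_order ha₂) h0 hd).filter_mono nhdsWithin_le_nhds)

theorem deriv_eq_zero (h : Sol κ R) {a : ℂ} (ha : AnalyticAt ℂ R a)
    (h0 : R a * (R a ^ 2 + κ * R a + 1) = 0) : deriv R a = 0 := by
  have := h.ode a ha
  rw [mul_assoc, h0, mul_zero] at this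
  exact pow_eq_zero_iff (two_ne_zero) |>.1 this

/-- The reciprocals both vanish at a, and there the equation forces their derivatives to vanish, so
all initial data agree. -/
theorem eq_of_not_analyticAt (h₁ : Sol κ R₁) (h₂ : Sol κ R₂) {a : ℂ} (ha₁ : ¬ AnalyticAt ℂ R₁ a)
    (ha₂ : ¬ AnalyticAt ℂ R₂ a) : R₁ = R₂ := by
  obtain ⟨b1, c1⟩ := h₁.analyticAt_inv ha₁
  obtain ⟨b2, c2⟩ := h₂.analyticAt_inv ha₂
  refine inv_injective (h₁.inv.eq_of_analyticAt h₂.inv b1 b2 (c1.trans c2.symm) ?_)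
  rw [h₁.inv.deriv_eq_zero b1 (by rw [c1, zero_mul]), h₂.inv.deriv_eq_zero b2 (by rw [c2, zero_mul])]

/-- Reflection in a branch point. -/
theorem reflect (h : Sol κ R) {a : ℂ} (ha : AnalyticAt ℂ R a)
    (h0 : R a * (R a ^ 2 + κ * R a + 1) = 0) (z : ℂ) : R (a + z) = R (a - z) := by
  have h1 := h.comp_affine a 1 (by norm_num)
  have h2 := h.comp_affine a (-1) (by norm_num)
  have hd := h.deriv_eq_zero ha h0
  have e : ∀ ε : ℂ, deriv (fun z => R (a + ε * z)) 0 = 0 := fun ε => by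
    rw [deriv_comp_affine (by simpa using ha)]; simp [hd]
  have := h1.eq_of_analyticAt h2 (a := 0)
    (AnalyticAt.fun_comp (by simpa using ha) (by fun_prop))
    (AnalyticAt.fun_comp (by simpa using ha) (by fun_prop)) (by simp) ((e _).trans (e _).symm)
  simpa [sub_eq_add_neg] using congrFun this z

end Sol

/-! ### Existence of a solution on the plane -/

/-- T is the local inverse of the integral of (1 + κw² + w⁴)^(-1/2). The square root T of the wanted
solution is used because the solution itself has derivative 0 at its zero, where it cannot be
obtained by inverting an integral. -/
theorem exists_local_sqrt (κ : ℂ) : ∃ T : ℂ → ℂ, AnalyticAt ℂ T 0 ∧ T 0 = 0 ∧ deriv T 0 ≠ 0 ∧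
    ∀ᶠ z in 𝓝 0, deriv T z ^ 2 = 1 + κ * T z ^ 2 + T z ^ 4 := by
  set f : ℂ → ℂ := fun w => 1 + κ * w ^ 2 + w ^ 4 with hf
  have hfc : Continuous f := by fun_prop
  have h0 : f 0 ∈ Complex.slitPlane := by simp [hf]
  obtain ⟨r, hr, hb⟩ := Metric.mem_nhds_iff.1
    (hfc.continuousAt.preimage_mem_nhds (Complex.isOpen_slitPlane.mem_nhds h0))
  -- The principal branch is holomorphic here, because f stays in the slit plane on the chosen ball.
  set g : ℂ → ℂ := fun w => f w ^ (-(1 / 2) : ℂ) with hg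
  have hgd : DifferentiableOn ℂ g (Metric.ball 0 r) := fun w hw =>
    (DifferentiableAt.cpow (by fun_prop) (by fun_prop) (hb hw)).differentiableWithinAt
  have hgsq : ∀ w ∈ Metric.ball (0 : ℂ) r, g w ^ 2 * f w = 1 := fun w hw => by
    have hw0 : f w ≠ 0 := Complex.slitPlane_ne_zero (hb hw)
    have : g w ^ 2 = (f w)⁻¹ := by
      simp only [hg]
      rw [← Complex.cpow_nat_mul]
      norm_num [Complex.cpow_neg_one]
    rw [this, inv_mul_cancel₀ hw0]
  obtain ⟨F, hF0, hF⟩ := hgd.isExactOn_ball.with_val_at 0 0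
  have hFa : AnalyticAt ℂ F 0 := DifferentiableOn.analyticAt
    (fun w hw => (hF w hw).differentiableAt.differentiableWithinAt) (Metric.ball_mem_nhds 0 hr)
  have hg0 : g 0 ≠ 0 := by
    intro h
    simpa [h] using hgsq 0 (Metric.mem_ball_self hr)
  have hF' : deriv F 0 ≠ 0 := by rwa [(hF 0 (Metric.mem_ball_self hr)).deriv]
  set T := hFa.hasStrictDerivAt.localInverse _ _ _ hF' with hT
  have hTa : AnalyticAt ℂ T 0 := by simpa [hF0] using hFa.analyticAt_localInverse hF'
  have hT0 : T 0 = 0 := by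
    have : T (F 0) = 0 := HasStrictFDerivAt.localInverse_apply_image ..
    rwa [hF0] at this
  have hFT : ∀ᶠ z in 𝓝 0, F (T z) = z := by
    have := HasStrictDerivAt.eventually_right_inverse hFa.hasStrictDerivAt hF'
    rwa [hF0] at this
  have hball : ∀ᶠ z in 𝓝 0, T z ∈ Metric.ball (0 : ℂ) r :=
    hTa.continuousAt.eventually (by rw [hT0]; exact Metric.ball_mem_nhds 0 hr)
  have key : ∀ᶠ z in 𝓝 0, g (T z) * deriv T z = 1 := by
    filter_upwards [hFT.eventually_nhds, hball, hTa.eventually_analyticAt] with z hz hzb hza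
    have h1 : HasDerivAt (fun z => F (T z)) (g (T z) * deriv T z) z :=
      (hF _ hzb).comp z hza.differentiableAt.hasDerivAt
    have h2 : (fun z => F (T z)) =ᶠ[𝓝 z] id := hz
    rw [← h1.deriv, h2.deriv_eq, deriv_id]
  refine ⟨T, hTa, hT0, right_ne_zero_of_mul_eq_one key.self_of_nhds, ?_⟩
  filter_upwards [key, hball] with z hz hzb
  have h1 := hgsq _ hzb
  have h2 : deriv T z ^ 2 = deriv T z ^ 2 * (g (T z) ^ 2 * f (T z)) := by rw [h1, mul_one]
  have h3 : deriv T z ^ 2 * (g (T z) ^ 2 * f (T z)) = (g (T z) * deriv T z) ^ 2 * f (T z) := by ring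
  rw [h2, h3, hz, one_pow, one_mul]

theorem exists_local (κ : ℂ) : ∃ S : ℂ → ℂ, AnalyticAt ℂ S 0 ∧ S 0 = 0 ∧
    (∀ᶠ z in 𝓝 0, deriv S z ^ 2 = 4 * S z * (S z ^ 2 + κ * S z + 1)) ∧
    ∀ᶠ z in 𝓝[≠] 0, deriv S z ≠ 0 := by
  obtain ⟨T, hT, hT0, hT1, hTe⟩ := exists_local_sqrt κ
  have hd : ∀ᶠ z in 𝓝 0, deriv (fun z => T z ^ 2) z = 2 * T z * deriv T z := by
    filter_upwards [hT.eventually_analyticAt] with z hz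
    simpa using (hz.differentiableAt.hasDerivAt.fun_pow 2).deriv
  refine ⟨fun z => T z ^ 2, hT.pow 2, by simp [hT0], ?_, ?_⟩
  · filter_upwards [hd, hTe] with z h1 h2
    rw [h1]
    linear_combination 4 * T z ^ 2 * h2
  · have h1 : ∀ᶠ z in 𝓝[≠] 0, T z ≠ 0 := by
      simpa [hT0] using hT.differentiableAt.hasDerivAt.eventually_ne (c := 0) hT1
    have h2 : ∀ᶠ z in 𝓝[≠] 0, deriv T z ≠ 0 :=
      (hT.deriv.continuousAt.eventually_ne hT1).filter_mono nhdsWithin_le_nhds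
    filter_upwards [hd.filter_mono nhdsWithin_le_nhds, h1, h2] with z h1 h2 h3
    rw [h1]
    exact mul_ne_zero (mul_ne_zero two_ne_zero h2) h3

/-- The duplication map of the equation. -/
noncomputable def dup (κ w : ℂ) : ℂ := 4 * w * (w ^ 2 + κ * w + 1) / (1 - w ^ 2) ^ 2

theorem hasDerivAt_dup (κ : ℂ) {w : ℂ} (hw : 1 - w ^ 2 ≠ 0) :
    HasDerivAt (dup κ)
      (4 * (1 + 2 * κ * w + 6 * w ^ 2 + 2 * κ * w ^ 3 + w ^ 4) / (1 - w ^ 2) ^ 3) w := by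
  have hi := hasDerivAt_id' w
  have := ((hi.const_mul 4).mul (((hi.pow 2).add (hi.const_mul κ)).add_const 1)).div
    (((hi.pow 2).const_sub 1).pow 2) (pow_ne_zero 2 hw)
  convert! this using 1
  simp
  field_simp
  ring

theorem analyticAt_dup (κ : ℂ) {w : ℂ} (hw : 1 - w ^ 2 ≠ 0) : AnalyticAt ℂ (dup κ) w := by
  unfold dup
  exact AnalyticAt.div (by fun_prop) (by fun_prop) (pow_ne_zero 2 hw)

theorem tendsto_half_nhdsNE (z : ℂ) : Tendsto (fun w : ℂ => w / 2) (𝓝[≠] z) (𝓝[≠] (z / 2)) := by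
  refine tendsto_nhdsWithin_iff.2 ⟨?_, ?_⟩
  · exact (Continuous.tendsto (by fun_prop) z).mono_left nhdsWithin_le_nhds
  · filter_upwards [self_mem_nhdsWithin] with w hw h
    exact hw (by simpa using h)

/-- The function `dup κ (S (z / 2))` satisfies the same differential equation, by a rational
identity for `dup` and its derivative, and both sides have value and derivative 0 at 0. -/
theorem eventually_dup {κ : ℂ} {S : ℂ → ℂ} (hS : AnalyticAt ℂ S 0) (hS0 : S 0 = 0)
    (hode : ∀ᶠ z in 𝓝 0, deriv S z ^ 2 = 4 * S z * (S z ^ 2 + κ * S z + 1))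
    (hn : ∀ᶠ z in 𝓝[≠] 0, deriv S z ≠ 0) : ∀ᶠ z in 𝓝 0, S z = dup κ (S (z / 2)) := by
  have t0 : Tendsto (fun w : ℂ => w / 2) (𝓝 0) (𝓝 0) := by
    simpa using (Continuous.tendsto (f := fun w : ℂ => w / 2) (by fun_prop) 0)
  have t1 : Tendsto (fun w : ℂ => w / 2) (𝓝[≠] 0) (𝓝[≠] 0) := by
    simpa using tendsto_half_nhdsNE 0
  have hh : AnalyticAt ℂ (fun z => S (z / 2)) 0 :=
    AnalyticAt.fun_comp (by simpa using hS) (by fun_prop)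
  have hV : AnalyticAt ℂ (fun z => dup κ (S (z / 2))) 0 :=
    AnalyticAt.fun_comp (g := dup κ) (analyticAt_dup κ (by simp [hS0])) hh
  have hq : ∀ p : ℂ → ℂ, Continuous p → p 0 ≠ 0 → ∀ᶠ z in 𝓝 0, p (S (z / 2)) ≠ 0 := fun p hp h0 =>
    (ContinuousAt.comp (g := p) hp.continuousAt hh.continuousAt).eventually_ne
      (by simpa [hS0] using h0)
  have hne := hq (fun w => 1 - w ^ 2) (by fun_prop) (by simp)
  -- This is the numerator of the derivative of `dup`; it is nonzero near 0, so the composite is not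
  -- constant.
  have hp := hq (fun w => 4 * (1 + 2 * κ * w + 6 * w ^ 2 + 2 * κ * w ^ 3 + w ^ 4)) (by fun_prop)
    (by simp)
  have hd : ∀ᶠ z in 𝓝 0, deriv (fun z => dup κ (S (z / 2))) z =
      4 * (1 + 2 * κ * S (z / 2) + 6 * S (z / 2) ^ 2 + 2 * κ * S (z / 2) ^ 3
        + S (z / 2) ^ 4) / (1 - S (z / 2) ^ 2) ^ 3 * (deriv S (z / 2) * (1 / 2)) := by
    filter_upwards [hne, t0.eventually hS.eventually_analyticAt] with z h1 h2
    have h3 : HasDerivAt (fun z => S (z / 2)) (deriv S (z / 2) * (1 / 2)) z :=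
      HasDerivAt.comp (h := fun z => z / 2) z h2.differentiableAt.hasDerivAt
        ((hasDerivAt_id' z).div_const 2)
    exact (HasDerivAt.comp z (hasDerivAt_dup κ h1) h3).deriv
  have hVode : ∀ᶠ z in 𝓝 0, deriv (fun z => dup κ (S (z / 2))) z ^ 2 =
      4 * dup κ (S (z / 2)) * (dup κ (S (z / 2)) ^ 2 + κ * dup κ (S (z / 2)) + 1) := by
    filter_upwards [hd, hne, t0.eventually hode] with z h1 h2 h3
    rw [h1, mul_pow, mul_pow, h3]
    simp only [dup]
    generalize S (z / 2) = w at h2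
    field_simp
    ring
  have hVn : ∀ᶠ z in 𝓝[≠] 0, deriv (fun z => dup κ (S (z / 2))) z ≠ 0 := by
    filter_upwards [hd.filter_mono nhdsWithin_le_nhds, hne.filter_mono nhdsWithin_le_nhds,
      hp.filter_mono nhdsWithin_le_nhds, t1.eventually hn] with z h1 h2 h3 h4
    rw [h1]
    exact mul_ne_zero (div_ne_zero h3 (pow_ne_zero _ h2)) (mul_ne_zero h4 (by norm_num))
  have hnot : ∀ {f : ℂ → ℂ}, (∀ᶠ z in 𝓝[≠] (0 : ℂ), deriv f z ≠ 0) →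
      ¬ ∀ᶠ z in 𝓝 (0 : ℂ), deriv f z = 0 := fun h1 h2 =>
    (h1.and (h2.filter_mono nhdsWithin_le_nhds)).exists.elim fun _ h => h.1 h.2
  have d1 : deriv S 0 = 0 := by simpa [hS0] using hode.self_of_nhds
  have d2 : deriv (fun z => dup κ (S (z / 2))) 0 = 0 := by
    simpa [hS0, dup] using hVode.self_of_nhds
  exact eventuallyEq_of_second_order hS hV
    (eventually_second_order hS (hode.filter_mono nhdsWithin_le_nhds) (hnot hn))
    (eventually_second_order hV (hVode.filter_mono nhdsWithin_le_nhds) (hnot hVn))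
    (by simp [hS0, dup]) (d1.trans d2.symm)

/-- A meromorphic germ on a disc which satisfies a rational functional equation
`S z = h (S (z / 2))` extends to the plane. -/
theorem exists_meromorphic_extension {S : ℂ → ℂ} {h : ℂ → ℂ} {r : ℝ} (hr : 0 < r)
    (hS : ∀ z ∈ Metric.ball (0 : ℂ) r, MeromorphicAt S z)
    (hh : ∀ {f : ℂ → ℂ} {z : ℂ}, MeromorphicAt f z → MeromorphicAt (fun z => h (f z)) z)
    (heq : ∀ z ∈ Metric.ball (0 : ℂ) r, S z = h (S (z / 2))) :
    ∃ F : ℂ → ℂ, Meromorphic F ∧ F =ᶠ[𝓝[≠] 0] S := by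
  -- `f n` is the n-fold iterate of h applied to S(z/2ⁿ), meromorphic on the disc of radius 2ⁿr;
  -- successive functions agree on the smaller disc.
  let f : ℕ → ℂ → ℂ := fun n => Nat.rec S (fun _ g z => h (g (z / 2))) n
  have f0 : f 0 = S := rfl
  have fs : ∀ n, f (n + 1) = fun z => h (f n (z / 2)) := fun n => rfl
  have hhalf : ∀ {n : ℕ} {z : ℂ}, ‖z‖ < 2 ^ (n + 1) * r → ‖z / 2‖ < 2 ^ n * r := by
    intro n z hz
    rw [norm_div, Complex.norm_ofNat, div_lt_iff₀ two_pos]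
    rw [pow_succ] at hz
    linarith
  have hA : ∀ n z, ‖z‖ < 2 ^ n * r → MeromorphicAt (f n) z := by
    intro n
    induction n with
    | zero => intro z hz; exact hS z (by simpa using hz)
    | succ n ih =>
      intro z hz
      rw [fs]
      exact hh (MeromorphicAt.comp_analyticAt (g := fun z : ℂ => z / 2) (ih _ (hhalf hz))
        (by fun_prop))
  have hB : ∀ n z, ‖z‖ < 2 ^ n * r → f (n + 1) =ᶠ[𝓝[≠] z] f n := by
    intro n
    induction n with
    | zero =>
      intro z hz
      refine nhdsWithin_le_nhds ?_
      filter_upwards [Metric.isOpen_ball.mem_nhds (show z ∈ Metric.ball (0 : ℂ) r by simpa using hz)]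
        with w hw
      exact (heq w hw).symm
    | succ n ih =>
      intro z hz
      filter_upwards [(tendsto_half_nhdsNE z).eventually (ih _ (hhalf hz))] with w hw
      rw [fs (n + 1), fs n]
      exact congrArg h hw
  -- Since N < 2^N, the point z lies in the disc of `f (N z)`. Near z the index takes only the
  -- values N z and N z + 1, so gluing along it preserves meromorphy.
  let N : ℂ → ℕ := fun z => ⌈‖z‖ / r⌉₊
  have hN : ∀ z, ‖z‖ < 2 ^ (N z) * r := fun z => by
    rw [← div_lt_iff₀ hr]
    exact (Nat.le_ceil _).trans_lt (by exact_mod_cast (Nat.lt_two_pow_self (n := N z)))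
  have hc : Continuous fun z : ℂ => ‖z‖ / r := by fun_prop
  have hF : ∀ z, (fun w => f (N w) w) =ᶠ[𝓝[≠] z] f (N z) := by
    intro z
    have h1 : ∀ᶠ w in 𝓝[≠] z, N w ≤ N z + 1 := by
      refine nhdsWithin_le_nhds ?_
      have : ‖z‖ / r < (N z : ℝ) + 1 := (Nat.le_ceil _).trans_lt (lt_add_one _)
      filter_upwards [hc.continuousAt.eventually (gt_mem_nhds this)] with w hw
      exact Nat.ceil_le.2 (by push_cast; exact hw.le)
    have h2 : ∀ᶠ w in 𝓝[≠] z, N z ≤ N w := by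
      refine nhdsWithin_le_nhds ?_
      rcases hn : N z with _ | k
      · simp
      · have : (k : ℝ) < ‖z‖ / r := Nat.lt_ceil.1 (by change k < N z; omega)
        filter_upwards [hc.continuousAt.eventually (lt_mem_nhds this)] with w hw
        exact Nat.lt_ceil.2 hw
    filter_upwards [h1, h2, hB _ z (hN z)] with w a1 a2 a3
    obtain h | h : N w = N z ∨ N w = N z + 1 := by omega
    · rw [h]
    · rw [h, a3]
  refine ⟨fun w => f (N w) w, fun z => (hA _ z (hN z)).congr (hF z).symm, ?_⟩
  have h0 : N 0 = 0 := by simp [N]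
  simpa [h0, f0] using hF 0

/-- The germ is extended by the duplication map and brought to normal form; the differential
equation then spreads from a neighbourhood of 0 by the identity theorem. -/
theorem exists_sol (κ : ℂ) : ∃ S : ℂ → ℂ, Sol κ S ∧ AnalyticAt ℂ S 0 ∧ S 0 = 0 := by
  obtain ⟨S, hS, hS0, hode, hn⟩ := exists_local κ
  obtain ⟨r, hr, hb⟩ := Metric.eventually_nhds_iff_ball.1
    ((eventually_dup hS hS0 hode hn).and hS.eventually_analyticAt)
  obtain ⟨F, hF, hFS⟩ := exists_meromorphic_extension (h := dup κ) hr
    (fun z hz => (hb z hz).2.meromorphicAt)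
    (fun {f z} hf => by unfold dup; fun_prop) (fun z hz => (hb z hz).1)
  have hFn := meromorphicNFOn_toMeromorphicNFOn F univ
  have hFF : ∀ z, toMeromorphicNFOn F univ =ᶠ[𝓝[≠] z] F := fun z =>
    (hF.meromorphicOn).toMeromorphicNFOn_eq_self_on_nhdsNE (mem_univ z)
  set G := toMeromorphicNFOn F univ
  have hGm : Meromorphic G := fun z => (hFn (mem_univ z)).meromorphicAt
  have hGS : G =ᶠ[𝓝 0] S :=
    ((hFn (mem_univ 0)).eventuallyEq_nhdsNE_iff_eventuallyEq_nhds hS.meromorphicNFAt).1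
      ((hFF 0).trans hFS)
  have hGa : AnalyticAt ℂ G 0 := hS.congr hGS.symm
  have hGd := hGS.deriv
  refine ⟨G, ⟨fun z => hFn (mem_univ z), fun z hz => ode_of_eventually hz ?_, ?_⟩, hGa,
    hGS.eq_of_nhds.trans hS0⟩
  · refine eventuallyEq_of_meromorphic (f := fun z => deriv G z ^ 2)
      (g := fun z => 4 * G z * (G z ^ 2 + κ * G z + 1)) (by fun_prop) (by fun_prop) (a := 0) ?_ z
    refine nhdsWithin_le_nhds ?_
    filter_upwards [hGS, hGd, hode] with z h1 h2 h3
    rw [h1, h2, h3]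
  · obtain ⟨z, h1, h2, h3⟩ := ((hGa.eventually_analyticAt.filter_mono nhdsWithin_le_nhds).and
      ((hGd.filter_mono nhdsWithin_le_nhds).and hn)).exists
    exact ⟨z, h1, by rwa [h2]⟩

/-! ### The duplication formula -/

namespace Sol

variable {κ : ℂ} {R S : ℂ → ℂ}

theorem eventually_dup_nhds (h : Sol κ S) (h0 : AnalyticAt ℂ S 0) (h00 : S 0 = 0) (z : ℂ) :
    S =ᶠ[𝓝[≠] z] fun w => dup κ (S (w / 2)) := by
  have hm := h.meromorphic
  refine eventuallyEq_of_meromorphic hm ?_ (a := 0) ?_ z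
  · have : Meromorphic fun w => S (w / 2) := fun w =>
      MeromorphicAt.comp_analyticAt (g := fun z : ℂ => z / 2) (hm (w / 2)) (by fun_prop)
    intro w
    have := this w
    unfold dup
    fun_prop
  · refine (eventually_dup h0 h00 ?_ ?_).filter_mono nhdsWithin_le_nhds
    · filter_upwards [h0.eventually_analyticAt] with w hw using h.ode w hw
    · exact h0.deriv.eventually_eq_zero_or_eventually_ne_zero.resolve_left
        (h.not_eventually_deriv_eq_zero h0)

/-- The duplication formula. -/
theorem duplication (h : Sol κ R) (hp : ¬ AnalyticAt ℂ R 0) {z : ℂ} (hz : AnalyticAt ℂ R z)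
    (hz0 : R z * (R z ^ 2 + κ * R z + 1) ≠ 0) : AnalyticAt ℂ R (2 * z) ∧
      R (2 * z) = (R z ^ 2 - 1) ^ 2 / (4 * (R z * (R z ^ 2 + κ * R z + 1))) := by
  obtain ⟨h0, h00⟩ := h.analyticAt_inv hp
  -- The formula is known for the reciprocal, which vanishes at 0; it is rewritten below in terms of
  -- R.
  have e1 := h.inv.eventually_dup_nhds h0 h00 (2 * z)
  have t : Tendsto (fun w : ℂ => w / 2) (𝓝[≠] (2 * z)) (𝓝[≠] z) := by
    simpa using tendsto_half_nhdsNE (2 * z)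
  set G : ℂ → ℂ := fun w => (R (w / 2) ^ 2 - 1) ^ 2 /
    (4 * (R (w / 2) * (R (w / 2) ^ 2 + κ * R (w / 2) + 1))) with hG
  have hz2 : AnalyticAt ℂ (fun w => R (w / 2)) (2 * z) :=
    AnalyticAt.fun_comp (by simpa using hz) (by fun_prop)
  have hGa : AnalyticAt ℂ G (2 * z) := by
    have c : AnalyticAt ℂ (fun _ : ℂ => (1 : ℂ)) (2 * z) := analyticAt_const
    have c4 : AnalyticAt ℂ (fun _ : ℂ => (4 : ℂ)) (2 * z) := analyticAt_const
    have ck : AnalyticAt ℂ (fun _ : ℂ => κ) (2 * z) := analyticAt_const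
    refine AnalyticAt.div ((hz2.pow 2).sub c |>.pow 2)
      (c4.mul (hz2.mul (((hz2.pow 2).add (ck.mul hz2)).add c))) ?_
    simpa using hz0
  have e2 : R =ᶠ[𝓝[≠] (2 * z)] G := by
    filter_upwards [e1, t.eventually (h.eventually_ne z 0)] with w h1 h2
    rw [← inv_inj, ← Pi.inv_apply, h1, dup, Pi.inv_apply]
    simp only [hG]
    generalize R (w / 2) = x at h2
    have e : x⁻¹ ^ 2 + κ * x⁻¹ + 1 = (x ^ 2 + κ * x + 1) / x ^ 2 := by field_simp; ring
    have e' : 1 - x⁻¹ ^ 2 = (x ^ 2 - 1) / x ^ 2 := by field_simp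
    simp only [e, e', inv_div]
    rw [div_pow, div_div_eq_mul_div]
    congr 1
    field_simp
  have e3 := ((h.nf (2 * z)).eventuallyEq_nhdsNE_iff_eventuallyEq_nhds hGa.meromorphicNFAt).1 e2
  exact ⟨hGa.congr e3.symm, by rw [e3.eq_of_nhds, hG]; simp⟩

end Sol

/-! ### Orders at zeros and poles, conjugation and translations -/

theorem AnalyticAt.conj_conj {f : ℂ → ℂ} {z : ℂ} (hf : AnalyticAt ℂ f z) :
    AnalyticAt ℂ (fun w => (starRingEnd ℂ) (f ((starRingEnd ℂ) w))) ((starRingEnd ℂ) z) := by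
  rw [Complex.analyticAt_iff_eventually_differentiableAt] at hf ⊢
  have ht : Tendsto (starRingEnd ℂ) (𝓝 ((starRingEnd ℂ) z)) (𝓝 z) := by
    simpa using (Complex.continuous_conj.tendsto ((starRingEnd ℂ) z))
  filter_upwards [ht.eventually hf] with w hw
  simpa [Function.comp_def] using hw.conj_conj

namespace Sol

variable {κ : ℂ} {R S : ℂ → ℂ}

/-- In S'² = S · 4(S² + κS + 1) the last factor equals 4 at a zero of S, so an order n satisfies 2(n
- 1) = n. -/
theorem order_eq_two (h : Sol κ S) {a : ℂ} (ha : AnalyticAt ℂ S a) (h0 : S a = 0) :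
    meromorphicOrderAt S a = 2 := by
  have hne : meromorphicOrderAt S a ≠ ⊤ := by
    rw [Ne, meromorphicOrderAt_eq_top_iff]
    exact h.not_eventually_const a 0
  obtain ⟨n, hn⟩ := WithTop.ne_top_iff_exists.1 hne
  have hn0 : n ≠ 0 := by
    rintro rfl
    exact (ha.meromorphicNFAt.meromorphicOrderAt_eq_zero_iff.1 hn.symm) h0
  have o1 := meromorphicOrderAt_deriv_eq_sub_one (by exact_mod_cast hn0) hn.symm
  have hA : AnalyticAt ℂ (fun z => 4 * (S z ^ 2 + κ * S z + 1)) a := by fun_prop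
  have o2 : meromorphicOrderAt (fun z => 4 * (S z ^ 2 + κ * S z + 1)) a = 0 :=
    hA.meromorphicNFAt.meromorphicOrderAt_eq_zero_iff.2 (by simp [h0])
  have o3 : meromorphicOrderAt (deriv S * deriv S) a
      = meromorphicOrderAt (S * fun z => 4 * (S z ^ 2 + κ * S z + 1)) a := by
    apply meromorphicOrderAt_congr
    filter_upwards [h.eventually_ode a] with z hz
    simp only [Pi.mul_apply]
    linear_combination hz
  rw [meromorphicOrderAt_mul ha.deriv.meromorphicAt ha.deriv.meromorphicAt,
    meromorphicOrderAt_mul ha.meromorphicAt hA.meromorphicAt, o2, ← hn, o1, add_zero] at o3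
  have : (n - 1) + (n - 1) = n := WithTop.coe_injective o3
  have : n = 2 := by omega
  rw [← hn, this]; rfl

theorem order_eq_neg_two (h : Sol κ R) {a : ℂ} (ha : ¬ AnalyticAt ℂ R a) :
    meromorphicOrderAt R a = -2 := by
  obtain ⟨h1, h2⟩ := h.analyticAt_inv ha
  have := h.inv.order_eq_two h1 h2
  rw [← inv_inv R, meromorphicOrderAt_inv, this]

theorem conj (h : Sol κ R) (hκ : (starRingEnd ℂ) κ = κ) :
    Sol κ (fun z => (starRingEnd ℂ) (R ((starRingEnd ℂ) z))) := by
  have ha : ∀ {z}, AnalyticAt ℂ (fun z => (starRingEnd ℂ) (R ((starRingEnd ℂ) z))) z →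
      AnalyticAt ℂ R ((starRingEnd ℂ) z) := fun hz => by simpa using AnalyticAt.conj_conj hz
  have hd : ∀ z, deriv (fun z => (starRingEnd ℂ) (R ((starRingEnd ℂ) z))) z =
      (starRingEnd ℂ) (deriv R ((starRingEnd ℂ) z)) := fun z => by
    have := congrFun (deriv_conj_conj (f := R)) z
    simpa [Function.comp_def] using this
  refine ⟨fun z => ?_, fun z hz => ?_, ?_⟩
  · have ht : Tendsto (starRingEnd ℂ) (𝓝 z) (𝓝 ((starRingEnd ℂ) z)) :=
      Complex.continuous_conj.tendsto z
    rcases h.nf ((starRingEnd ℂ) z) with h1 | ⟨n, g, hg, hg0, h1⟩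
    · left
      filter_upwards [ht.eventually h1] with w hw
      simp [hw]
    · right
      refine ⟨n, fun w => (starRingEnd ℂ) (g ((starRingEnd ℂ) w)),
        by simpa using AnalyticAt.conj_conj hg, by simpa using hg0, ?_⟩
      filter_upwards [ht.eventually h1] with w hw
      rw [hw]
      simp
  · have := congrArg (starRingEnd ℂ) (h.ode _ (ha hz))
    rw [hd]
    simpa only [map_pow, map_mul, map_add, map_one, map_ofNat, hκ] using this
  · obtain ⟨z, hz, hz'⟩ := h.nonconst
    exact ⟨(starRingEnd ℂ) z, AnalyticAt.conj_conj hz, by rw [hd]; simpa using hz'⟩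

theorem apply_conj (h : Sol κ R) (hp : ¬ AnalyticAt ℂ R 0) (hκ : (starRingEnd ℂ) κ = κ) (z : ℂ) :
    R ((starRingEnd ℂ) z) = (starRingEnd ℂ) (R z) := by
  have := h.eq_of_not_analyticAt (h.conj hκ) hp fun h0 => hp (by simpa using AnalyticAt.conj_conj h0)
  simpa using congrFun this ((starRingEnd ℂ) z)

/-- Translation by p gives another solution with a pole at 0, and there is only one. -/
theorem periodic_of_pole (h : Sol κ R) (hp : ¬ AnalyticAt ℂ R 0) {p : ℂ} (hpp : ¬ AnalyticAt ℂ R p) :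
    Function.Periodic R p := by
  intro z
  have := (h.comp_affine p 1 (by norm_num)).eq_of_not_analyticAt h (a := 0)
    (by rwa [analyticAt_comp_affine one_ne_zero, mul_zero, add_zero]) hp
  rw [add_comm]
  simpa using congrFun this z

theorem even (h : Sol κ R) (hp : ¬ AnalyticAt ℂ R 0) (z : ℂ) : R (-z) = R z := by
  have := (h.comp_affine 0 (-1) (by norm_num)).eq_of_not_analyticAt h (a := 0)
    (by rwa [analyticAt_comp_affine (by norm_num), mul_zero, add_zero]) hp
  simpa using congrFun this z

theorem analyticAt_add_iff {w : ℂ} (h : Function.Periodic R w) (z : ℂ) :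
    AnalyticAt ℂ R (z + w) ↔ AnalyticAt ℂ R z := by
  have e : (fun z => R (w + 1 * z)) = R := by
    ext z
    rw [one_mul, add_comm, h z]
  have := analyticAt_comp_affine (f := R) (b := w) (z := z) one_ne_zero
  rw [e] at this
  rw [this, one_mul, add_comm]

/-- Translation by the half period at which `R` vanishes. -/
theorem apply_zero_add (h : Sol κ R) (hp : ¬ AnalyticAt ℂ R 0) {a : ℂ} (ha : AnalyticAt ℂ R a)
    (h0 : R a = 0) (z : ℂ) : R (a + z) = (R z)⁻¹ := by
  obtain ⟨b1, b2⟩ := h.analyticAt_inv hp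
  have h1 := h.comp_affine a 1 (by norm_num)
  have a1 : AnalyticAt ℂ (fun z => R (a + 1 * z)) 0 :=
    (analyticAt_comp_affine one_ne_zero).2 (by simpa using ha)
  have := h1.eq_of_analyticAt h.inv (a := 0) a1 b1 (by simpa [h0] using b2.symm) (by
    rw [h1.deriv_eq_zero a1 (by simp [h0]), h.inv.deriv_eq_zero b1 (by rw [b2, zero_mul])])
  simpa using congrFun this z

theorem im_eq_zero (h : Sol κ R) (hp : ¬ AnalyticAt ℂ R 0) (hκ : (starRingEnd ℂ) κ = κ) (x : ℝ) :
    (R x).im = 0 := by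
  have := h.apply_conj hp hκ x
  rw [Complex.conj_ofReal] at this
  exact Complex.conj_eq_iff_im.1 this.symm

theorem deriv_im_eq_zero (h : Sol κ R) (hp : ¬ AnalyticAt ℂ R 0) (hκ : (starRingEnd ℂ) κ = κ)
    (x : ℝ) : (deriv R x).im = 0 := by
  have e : (starRingEnd ℂ) ∘ R ∘ (starRingEnd ℂ) = R := by
    ext z
    simp [h.apply_conj hp hκ]
  have := congrFun (deriv_conj_conj (f := R)) x
  rw [e] at this
  simp only [Function.comp_apply, Complex.conj_ofReal] at this
  exact Complex.conj_eq_iff_im.1 this.symm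

end Sol

/-! ### The real half-period -/

theorem eventually_pos_of_hasDerivAt {f : ℝ → ℝ} {f' : ℝ} (h : HasDerivAt f f' 0) (h0 : f 0 = 0)
    (hf : 0 < f') : ∀ᶠ x in 𝓝[>] (0 : ℝ), 0 < f x := by
  have h1 := (hasDerivWithinAt_iff_tendsto_slope' (s := Ioi (0 : ℝ)) (by simp)).1
    (h.hasDerivWithinAt (s := Ioi 0))
  filter_upwards [h1.eventually (lt_mem_nhds hf), self_mem_nhdsWithin] with x hx hx0
  have hx0 : 0 < x := hx0
  rw [slope_def_field, h0, sub_zero, sub_zero] at hx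
  exact (div_pos_iff_of_pos_right hx0).1 hx

namespace Sol

variable {R : ℂ → ℂ} {κ : ℝ}

/-- For S = 1/R one has S(0) = S'(0) = 0 and S''(0) = 2, so S' > 0 just to the right of 0. Then
4S(S² + κS + 1) = S'² > 0, and the quadratic factor is close to 1, so S > 0 as well. -/
theorem eventually_pos_near_pole (h : Sol κ R) (hp : ¬ AnalyticAt ℂ R 0) :
    ∀ᶠ x : ℝ in 𝓝[>] 0, AnalyticAt ℂ R x ∧ 0 < (R x).re ∧ (deriv R x).re < 0 := by
  obtain ⟨b1, b2⟩ := h.analyticAt_inv hp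
  have hκ : (starRingEnd ℂ) (κ : ℂ) = κ := Complex.conj_ofReal κ
  have hd0 := h.inv.deriv_eq_zero b1 (by rw [b2, zero_mul])
  have hd2 : deriv (deriv R⁻¹) 0 = 2 := by
    have := (h.inv.second_order b1).self_of_nhds
    rw [b2] at this
    simpa using this
  have hpos := eventually_pos_of_hasDerivAt (f := fun x : ℝ => (deriv R⁻¹ x).re) (f' := 2)
    (by
      have := b1.deriv.differentiableAt.hasDerivAt
      rw [hd2] at this
      exact HasDerivAt.real_of_complex (e := deriv R⁻¹) (z := 0) (by simpa using this))
    (by simp [hd0]) two_pos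
  have t : Tendsto (fun x : ℝ => (x : ℂ)) (𝓝[>] 0) (𝓝[≠] 0) := by
    refine tendsto_nhdsWithin_iff.2 ⟨?_, ?_⟩
    · exact (by simpa using Complex.continuous_ofReal.tendsto 0 :
        Tendsto (fun x : ℝ => (x : ℂ)) (𝓝 0) (𝓝 0)).mono_left nhdsWithin_le_nhds
    · filter_upwards [self_mem_nhdsWithin] with x hx
      have : x ≠ 0 := ne_of_gt hx
      simpa using this
  have t' := t.mono_right nhdsWithin_le_nhds
  have hsmall : ∀ᶠ z in 𝓝 (0 : ℂ), 0 < (R⁻¹ z ^ 2 + κ * R⁻¹ z + 1).re := by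
    have hc := b1.continuousAt
    have : ContinuousAt (fun z => (R⁻¹ z ^ 2 + κ * R⁻¹ z + 1).re) 0 :=
      Complex.continuous_re.continuousAt.comp (by fun_prop)
    refine this.eventually (lt_mem_nhds ?_)
    change 0 < (R⁻¹ 0 ^ 2 + κ * R⁻¹ 0 + 1).re
    rw [b2]
    simp
  filter_upwards [hpos, t.eventually (h.eventually_analyticAt 0), t.eventually (h.eventually_ne 0 0),
    t'.eventually hsmall, t'.eventually b1.eventually_analyticAt] with x h1 h2 h3 h4 h5
  have r1 := h.im_eq_zero hp hκ x
  have r2 := h.deriv_im_eq_zero hp hκ x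
  have e1 : deriv R⁻¹ x = -deriv R x / R x ^ 2 := (h2.differentiableAt.hasDerivAt.inv h3).deriv
  have e2 := h.inv.ode x h5
  obtain ⟨u, hu⟩ : ∃ u : ℝ, R x = u := ⟨(R x).re, Complex.ext rfl (by simpa using r1)⟩
  obtain ⟨v, hv⟩ : ∃ v : ℝ, deriv R x = v := ⟨(deriv R x).re, Complex.ext rfl (by simpa using r2)⟩
  rw [e1, Pi.inv_apply, hu, hv] at e2
  rw [e1, hu, hv] at h1
  rw [Pi.inv_apply, hu] at h4
  rw [hu] at h3
  have h3' : u ≠ 0 := by exact_mod_cast h3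
  have e2' : (-v / u ^ 2) ^ 2 = 4 * u⁻¹ * (u⁻¹ ^ 2 + κ * u⁻¹ + 1) := by exact_mod_cast e2
  have h1' : 0 < -v / u ^ 2 := by
    have : ((-(v : ℂ)) / (u : ℂ) ^ 2).re = -v / u ^ 2 := by
      rw [← Complex.ofReal_re (-v / u ^ 2)]; push_cast; rfl
    rwa [this] at h1
  have h4' : 0 < u⁻¹ ^ 2 + κ * u⁻¹ + 1 := by
    have : ((u : ℂ)⁻¹ ^ 2 + κ * (u : ℂ)⁻¹ + 1).re = u⁻¹ ^ 2 + κ * u⁻¹ + 1 := by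
      rw [← Complex.ofReal_re (u⁻¹ ^ 2 + κ * u⁻¹ + 1)]; push_cast; rfl
    rwa [this] at h4
  refine ⟨h2, ?_, ?_⟩
  · rw [hu, Complex.ofReal_re]
    have : 0 < 4 * u⁻¹ * (u⁻¹ ^ 2 + κ * u⁻¹ + 1) := by rw [← e2']; positivity
    have := (pos_iff_pos_of_mul_pos this).2 h4'
    exact inv_pos.1 (by linarith)
  · rw [hv, Complex.ofReal_re]
    have := (div_pos_iff_of_pos_right (by positivity : 0 < u ^ 2)).1 h1'
    linarith

end Sol

/-- `R` decreases from `∞` to `0` on the real interval from `0` to `a`. -/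
structure IsRealHalfPeriod (R : ℂ → ℂ) (a : ℝ) : Prop where
  pos : 0 < a
  analyticAt : AnalyticAt ℂ R a
  apply_eq : R a = 0
  interior : ∀ x : ℝ, 0 < x → x < a → AnalyticAt ℂ R x ∧ 0 < (R x).re ∧ (deriv R x).re < 0

namespace Sol

variable {R : ℂ → ℂ} {κ : ℝ}

theorem hasDerivAt_re {x : ℝ} (hx : AnalyticAt ℂ R x) :
    HasDerivAt (fun x : ℝ => (R x).re) (deriv R x).re x :=
  HasDerivAt.real_of_complex (e := R) hx.differentiableAt.hasDerivAt

/-- As long as R > 0, the second-order equation gives R'' ≥ 2, so R' cannot stay negative on the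
whole half-line. -/
theorem exists_bad (h : Sol κ R) (hp : ¬ AnalyticAt ℂ R 0) (hκ : 0 ≤ κ) :
    ∃ x : ℝ, 0 < x ∧ ¬ (AnalyticAt ℂ R x ∧ 0 < (R x).re ∧ (deriv R x).re < 0) := by
  by_contra hall
  have good : ∀ x : ℝ, 0 < x → AnalyticAt ℂ R x ∧ 0 < (R x).re ∧ (deriv R x).re < 0 := by
    intro x hx
    by_contra hh
    exact hall ⟨x, hx, hh⟩
  have hd : ∀ x : ℝ, 0 < x →
      HasDerivAt (fun x : ℝ => (deriv R x).re) (deriv (deriv R) x).re x := fun x hx =>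
    hasDerivAt_re (good x hx).1.deriv
  have h2 : ∀ x : ℝ, 0 < x → 2 ≤ (deriv (deriv R) x).re := fun x hx => by
    obtain ⟨g1, g2, -⟩ := good x hx
    rw [(h.second_order g1).self_of_nhds]
    have r1 := h.im_eq_zero hp (Complex.conj_ofReal κ) x
    obtain ⟨u, hu⟩ : ∃ u : ℝ, R x = u := ⟨(R x).re, Complex.ext rfl (by simpa using r1)⟩
    rw [hu, Complex.ofReal_re] at g2
    rw [hu]
    have : (6 * (u : ℂ) ^ 2 + 4 * κ * u + 2).re = 6 * u ^ 2 + 4 * κ * u + 2 := by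
      rw [← Complex.ofReal_re (6 * u ^ 2 + 4 * κ * u + 2)]; push_cast; rfl
    rw [this]
    have := mul_nonneg hκ g2.le
    nlinarith [sq_nonneg u]
  -- With R'(1) = -t and slope at least 2, R'(1 + t) would be at least t > 0.
  set t := -(deriv R (1 : ℝ)).re with ht
  have ht0 : 0 < t := by have := (good 1 one_pos).2.2; linarith
  obtain ⟨c, hc, hc'⟩ := exists_hasDerivAt_eq_slope (fun x : ℝ => (deriv R x).re)
    (fun x : ℝ => (deriv (deriv R) x).re) (a := 1) (b := 1 + t) (by linarith)
    (fun x hx => (hd x (by linarith [hx.1])).continuousAt.continuousWithinAt)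
    (fun x hx => hd x (by linarith [hx.1]))
  have h3 := h2 c (by linarith [hc.1])
  have h4 := (good (1 + t) (by linarith)).2.2
  rw [hc', le_div_iff₀ (by linarith)] at h3
  linarith

/-- The half-period a is the infimum of the points where R fails to be analytic, positive and
decreasing. There is no pole at a, because R decreases towards a. If R(a) > 0, the equation gives
R'(a) ≠ 0, so R'(a) < 0 by passage to the limit and the good behaviour would continue past a. Hence
R(a) = 0. -/
theorem exists_realHalfPeriod (h : Sol κ R) (hp : ¬ AnalyticAt ℂ R 0) (hκ : 0 ≤ κ) :
    ∃ a : ℝ, IsRealHalfPeriod R a := by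
  set good : ℝ → Prop := fun x => AnalyticAt ℂ R x ∧ 0 < (R x).re ∧ (deriv R x).re < 0 with hgood
  set B : Set ℝ := {x | 0 < x ∧ ¬ good x} with hB
  have hBne : B.Nonempty := h.exists_bad hp hκ
  have hBb : BddBelow B := ⟨0, fun x hx => hx.1.le⟩
  set a := sInf B with ha
  have hlow : ∀ x, 0 < x → x < a → good x := fun x hx hxa => by
    by_contra hg
    exact absurd (csInf_le hBb ⟨hx, hg⟩) (not_le.2 hxa)
  have hapos : 0 < a := by
    obtain ⟨ε, hε, hε'⟩ := (mem_nhdsGT_iff_exists_Ioo_subset).1 (h.eventually_pos_near_pole hp)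
    refine lt_of_lt_of_le hε (le_csInf hBne fun x hx => ?_)
    by_contra hlt
    exact hx.2 (hε' ⟨hx.1, not_le.1 hlt⟩)
  have hreal : ∀ x : ℝ, R x = ((R x).re : ℂ) := fun x =>
    Complex.ext rfl (by simpa using h.im_eq_zero hp (Complex.conj_ofReal κ) x)
  have hreal' : ∀ x : ℝ, deriv R x = ((deriv R x).re : ℂ) := fun x =>
    Complex.ext rfl (by simpa using h.deriv_im_eq_zero hp (Complex.conj_ofReal κ) x)
  have hanti : StrictAntiOn (fun x : ℝ => (R x).re) (Ioo 0 a) :=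
    strictAntiOn_of_deriv_neg (convex_Ioo 0 a)
      (fun x hx => (hasDerivAt_re (hlow x hx.1 hx.2).1).continuousAt.continuousWithinAt)
      (fun x hx => by
        rw [interior_Ioo] at hx
        rw [(hasDerivAt_re (hlow x hx.1 hx.2).1).deriv]
        exact (hlow x hx.1 hx.2).2.2)
  have hleft : (𝓝[<] a).NeBot := inferInstance
  have hIoo : ∀ᶠ x in 𝓝[<] a, x ∈ Ioo (a / 2) a := Ioo_mem_nhdsLT (by linarith)
  have tl : Tendsto (fun x : ℝ => (x : ℂ)) (𝓝[<] a) (𝓝 (a : ℂ)) :=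
    (Complex.continuous_ofReal.tendsto a).mono_left nhdsWithin_le_nhds
  have haa : AnalyticAt ℂ R a := by
    by_contra hna
    obtain ⟨b1, b2⟩ := h.analyticAt_inv hna
    have hM : 0 < (R (a / 2 : ℝ)).re := (hlow (a / 2) (by linarith) (by linarith)).2.1
    have h1 : ∀ᶠ x : ℝ in 𝓝[<] a, ‖R⁻¹ x‖ < 1 / (R (a / 2 : ℝ)).re := by
      have := (b1.continuousAt.tendsto.comp tl).norm
      rw [b2, norm_zero] at this
      exact this.eventually (gt_mem_nhds (by positivity))
    obtain ⟨x, hx1, hx2⟩ := (h1.and hIoo).exists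
    have hx0 : 0 < x := by linarith [hx2.1]
    have g := hlow x hx0 hx2.2
    have hlt := hanti ⟨by linarith, by linarith⟩ ⟨hx0, hx2.2⟩ hx2.1
    rw [Pi.inv_apply, hreal x, norm_inv, Complex.norm_real, Real.norm_of_nonneg g.2.1.le,
      ← one_div, one_div_lt_one_div g.2.1 hM] at hx1
    exact lt_asymm hlt hx1
  have hge : 0 ≤ (R a).re :=
    ge_of_tendsto ((Complex.continuous_re.tendsto _).comp (haa.continuousAt.tendsto.comp tl))
      (hIoo.mono fun x hx => (hlow x (by linarith [hx.1]) hx.2).2.1.le)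
  have hle : (deriv R a).re ≤ 0 :=
    le_of_tendsto ((Complex.continuous_re.tendsto _).comp
      (haa.deriv.continuousAt.tendsto.comp tl))
      (hIoo.mono fun x hx => (hlow x (by linarith [hx.1]) hx.2).2.2.le)
  refine ⟨a, hapos, haa, ?_, hlow⟩
  by_contra hne
  have hpos : 0 < (R a).re := lt_of_le_of_ne hge fun h0 => hne (by rw [hreal a, ← h0]; simp)
  have hneg : (deriv R a).re < 0 := by
    refine lt_of_le_of_ne hle fun h0 => ?_
    have e := h.ode a haa
    rw [hreal' a, hreal a, h0] at e
    have e' : (0 : ℝ) ^ 2 = 4 * (R a).re * ((R a).re ^ 2 + κ * (R a).re + 1) := by exact_mod_cast e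
    have : 0 < 4 * (R a).re * ((R a).re ^ 2 + κ * (R a).re + 1) := by positivity
    linarith
  have hnear : ∀ᶠ x : ℝ in 𝓝 a, good x := by
    have tt : Tendsto (fun x : ℝ => (x : ℂ)) (𝓝 a) (𝓝 (a : ℂ)) := Complex.continuous_ofReal.tendsto a
    filter_upwards [tt.eventually haa.eventually_analyticAt,
      ((Complex.continuous_re.tendsto _).comp (haa.continuousAt.tendsto.comp tt)).eventually
        (lt_mem_nhds hpos),
      ((Complex.continuous_re.tendsto _).comp (haa.deriv.continuousAt.tendsto.comp tt)).eventually
        (gt_mem_nhds hneg)] with x h1 h2 h3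
    exact ⟨h1, h2, h3⟩
  obtain ⟨x, hx1, hx2⟩ := mem_closure_iff_nhds.1 (csInf_mem_closure hBne hBb) _ hnear
  exact hx2.2 hx1

end Sol

theorem ofReal_of_im_eq_zero {z : ℂ} (h : z.im = 0) : z = (z.re : ℂ) := Complex.ext rfl (by simpa using h)

namespace IsRealHalfPeriod

variable {R : ℂ → ℂ} {κ a : ℝ}

theorem reflect (hr : IsRealHalfPeriod R a) (h : Sol κ R) (z : ℂ) : R (a + z) = R (a - z) :=
  h.reflect hr.analyticAt (by rw [hr.apply_eq, zero_mul]) z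

/-- Reflection in a composed with reflection in 0 is translation by 2a. -/
theorem periodic (hr : IsRealHalfPeriod R a) (h : Sol κ R) (hp : ¬ AnalyticAt ℂ R 0) :
    Function.Periodic R (2 * a) := fun z => by
  have := hr.reflect h (a + z)
  rw [show (a : ℂ) - (a + z) = -z by ring, h.even hp, show (a : ℂ) + (a + z) = z + 2 * a by ring] at this
  exact this

theorem apply_sub (hr : IsRealHalfPeriod R a) (h : Sol κ R) (hp : ¬ AnalyticAt ℂ R 0) (z : ℂ) :
    R (a - z) = (R z)⁻¹ := by
  rw [← hr.reflect h, h.apply_zero_add hp hr.analyticAt hr.apply_eq]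

theorem analyticAt_of_mem (hr : IsRealHalfPeriod R a) (h : Sol κ R)
    {x : ℝ} (hx0 : 0 < x) (hx : x < 2 * a) : AnalyticAt ℂ R x := by
  rcases lt_trichotomy x a with h1 | rfl | h1
  · exact (hr.interior x hx0 h1).1
  · exact hr.analyticAt
  · have e : (fun z => R (2 * a + (-1) * z)) = R := by
      ext z
      have := hr.reflect h (a - z)
      rw [show (a : ℂ) - (a - z) = z by ring] at this
      rw [← this]
      congr 1; ring
    rw [← e, analyticAt_comp_affine (by norm_num)]
    have := (hr.interior (2 * a - x) (by linarith) (by linarith)).1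
    convert! this using 1
    push_cast
    ring

/-- The real poles are the integer multiples of the real period. -/
theorem exists_int_of_pole (hr : IsRealHalfPeriod R a) (h : Sol κ R) (hp : ¬ AnalyticAt ℂ R 0)
    {x : ℝ} (hx : ¬ AnalyticAt ℂ R x) : ∃ n : ℤ, x = n * (2 * a) := by
  have ha : 0 < 2 * a := by linarith [hr.pos]
  refine ⟨⌊x / (2 * a)⌋, ?_⟩
  have h1 := Int.floor_le (x / (2 * a))
  have h2 := Int.lt_floor_add_one (x / (2 * a))
  generalize ⌊x / (2 * a)⌋ = n at h1 h2 ⊢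
  rw [le_div_iff₀ ha] at h1
  rw [div_lt_iff₀ ha] at h2
  rcases h1.eq_or_lt with h3 | h3
  · exact h3.symm
  · exfalso
    have h4 := hr.analyticAt_of_mem h (x := x - n * (2 * a)) (by linarith) (by linarith)
    refine hx ?_
    have := (Sol.analyticAt_add_iff ((hr.periodic h hp).int_mul n)
      ((x - n * (2 * a) : ℝ) : ℂ)).2 h4
    convert! this using 1
    push_cast
    ring

theorem exists_real_values (hr : IsRealHalfPeriod R a) (h : Sol κ R) (hp : ¬ AnalyticAt ℂ R 0)
    {x : ℝ} (hx0 : 0 < x) (hx : x < a) :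
    ∃ u v : ℝ, R x = u ∧ deriv R x = v ∧ 0 < u ∧ v < 0 ∧ v ^ 2 = 4 * u * (u ^ 2 + κ * u + 1) := by
  obtain ⟨h1, h2, h3⟩ := hr.interior x hx0 hx
  have e1 := ofReal_of_im_eq_zero (h.im_eq_zero hp (Complex.conj_ofReal κ) x)
  have e2 := ofReal_of_im_eq_zero (h.deriv_im_eq_zero hp (Complex.conj_ofReal κ) x)
  refine ⟨_, _, e1, e2, h2, h3, ?_⟩
  have := h.ode x h1
  rw [e1, e2] at this
  exact_mod_cast this

theorem strictAntiOn (hr : IsRealHalfPeriod R a) : StrictAntiOn (fun x : ℝ => (R x).re) (Ioo 0 a) :=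
  strictAntiOn_of_deriv_neg (convex_Ioo 0 a)
    (fun x hx => (Sol.hasDerivAt_re (hr.interior x hx.1 hx.2).1).continuousAt.continuousWithinAt)
    (fun x hx => by
      rw [interior_Ioo] at hx
      rw [(Sol.hasDerivAt_re (hr.interior x hx.1 hx.2).1).deriv]
      exact (hr.interior x hx.1 hx.2).2.2)

/-- The point a/2 is fixed by z ↦ a - z, which inverts R; so R is its own inverse there, and it is
positive. -/
theorem apply_half (hr : IsRealHalfPeriod R a) (h : Sol κ R) (hp : ¬ AnalyticAt ℂ R 0) : R (a / 2 : ℝ) = 1 := by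
  have ha := hr.pos
  obtain ⟨u, v, h1, -, h3, -⟩ := hr.exists_real_values h hp (x := a / 2) (by linarith) (by linarith)
  have := hr.apply_sub h hp (a / 2 : ℝ)
  rw [show (a : ℂ) - (a / 2 : ℝ) = (a / 2 : ℝ) by push_cast; ring, h1] at this
  have e : u = u⁻¹ := by exact_mod_cast this
  have : u * u = 1 := by nth_rw 2 [e]; exact mul_inv_cancel₀ h3.ne'
  rw [h1]
  have : u = 1 := by nlinarith
  exact_mod_cast this

theorem deriv_half (hr : IsRealHalfPeriod R a) (h : Sol κ R) (hp : ¬ AnalyticAt ℂ R 0)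
    {q : ℝ} (hq : 0 < q) (hq2 : q ^ 2 = 2 + κ) :
    deriv R (a / 2 : ℝ) = (-2 * q : ℝ) := by
  have ha := hr.pos
  obtain ⟨u, v, h1, h2, h3, h4, h5⟩ :=
    hr.exists_real_values h hp (x := a / 2) (by linarith) (by linarith)
  rw [hr.apply_half h hp] at h1
  have hu : u = 1 := by exact_mod_cast h1.symm
  subst hu
  rw [h2]
  have : (v - 2 * q) * (v + 2 * q) = 0 := by linear_combination h5 - 4 * hq2
  rcases mul_eq_zero.1 this with h6 | h6
  · linarith
  · congr 1; linarith

/-- Duplication from a/4 to a/2 gives a quartic for u = R(a/4). It is quadratic in u + 1/u, namely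
(u + 1/u - 2)² = 4(2 + κ), and u > 1 leaves a single root. The quartic also says R'² = (1 - u²)²,
and R' < 0 fixes the sign. -/
theorem values_quarter (hr : IsRealHalfPeriod R a) (h : Sol κ R) (hp : ¬ AnalyticAt ℂ R 0)
    (hκ : 0 ≤ κ) {q : ℝ} (hq : 1 < q)
    (hq2 : (q ^ 2 - 1) ^ 2 = 4 * q * (q ^ 2 + κ * q + 1)) :
    R (a / 4 : ℝ) = q ∧ deriv R (a / 4 : ℝ) = (1 - q ^ 2 : ℝ) := by
  have ha := hr.pos
  obtain ⟨u, v, h1, h2, h3, h4, h5⟩ :=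
    hr.exists_real_values h hp (x := a / 4) (by linarith) (by linarith)
  have hu1 : 1 < u := by
    have := hr.strictAntiOn (show a / 4 ∈ Ioo 0 a from ⟨by linarith, by linarith⟩)
      (show a / 2 ∈ Ioo 0 a from ⟨by linarith, by linarith⟩) (by linarith)
    simp only [h1, hr.apply_half h hp] at this
    simpa using this
  have hpos : 0 < u * (u ^ 2 + κ * u + 1) := by positivity
  have hdup := (h.duplication hp (z := (a / 4 : ℝ)) (hr.interior _ (by linarith) (by linarith)).1
    (by rw [h1]; exact_mod_cast hpos.ne')).2
  rw [show (2 : ℂ) * (a / 4 : ℝ) = (a / 2 : ℝ) by push_cast; ring, hr.apply_half h hp, h1] at hdup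
  have hdup' : 1 = (u ^ 2 - 1) ^ 2 / (4 * (u * (u ^ 2 + κ * u + 1))) := by exact_mod_cast hdup
  rw [eq_div_iff (by positivity)] at hdup'
  have key : ∀ {q : ℝ}, 1 < q → (q ^ 2 - 1) ^ 2 = 4 * q * (q ^ 2 + κ * q + 1) →
      2 < q + q⁻¹ ∧ (q + q⁻¹ - 2) ^ 2 = 4 * (2 + κ) := by
    intro q hq hq2
    constructor
    · have : q + q⁻¹ - 2 = (q - 1) ^ 2 / q := by field_simp; ring
      have : 0 < (q - 1) ^ 2 / q := div_pos (pow_pos (by linarith) 2) (by linarith)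
      linarith
    · field_simp
      linear_combination hq2
  obtain ⟨k1, k2⟩ := key hq hq2
  obtain ⟨l1, l2⟩ := key hu1 (by linarith)
  have huq : u = q := by
    have e : u + u⁻¹ = q + q⁻¹ := by
      have : (u + u⁻¹ - (q + q⁻¹)) * (u + u⁻¹ + (q + q⁻¹) - 4) = 0 := by linear_combination l2 - k2
      rcases mul_eq_zero.1 this with h6 | h6 <;> linarith
    have hq0 : q ≠ 0 := by linarith
    field_simp at e
    have : (u - q) * (u * q - 1) = 0 := by linear_combination e
    rcases mul_eq_zero.1 this with h6 | h6
    · linarith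
    · nlinarith
  subst huq
  refine ⟨h1, ?_⟩
  rw [h2]
  have : (v - (1 - u ^ 2)) * (v + (1 - u ^ 2)) = 0 := by linear_combination h5 - hq2
  rcases mul_eq_zero.1 this with h6 | h6
  · congr 1; linarith
  · nlinarith

theorem values_three_quarter (hr : IsRealHalfPeriod R a) (h : Sol κ R) (hp : ¬ AnalyticAt ℂ R 0)
    (hκ : 0 ≤ κ) {q : ℝ} (hq0 : 0 < q) (hq : q < 1)
    (hq2 : (q ^ 2 - 1) ^ 2 = 4 * q * (q ^ 2 + κ * q + 1)) :
    R (3 * a / 4 : ℝ) = q ∧ deriv R (3 * a / 4 : ℝ) = (q ^ 2 - 1 : ℝ) := by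
  have ha := hr.pos
  have h0 := (hr.values_quarter h hp hκ (q := q⁻¹) ((one_lt_inv₀ hq0).2 hq) (by
    field_simp; linear_combination hq2)).1
  obtain ⟨u, v, h1, h2, h3, h4, h5⟩ :=
    hr.exists_real_values h hp (x := 3 * a / 4) (by linarith) (by linarith)
  have e := hr.apply_sub h hp (a / 4 : ℝ)
  rw [show (a : ℂ) - (a / 4 : ℝ) = (3 * a / 4 : ℝ) by push_cast; ring, h0, h1] at e
  have huq : u = q := by
    have : u = (q⁻¹)⁻¹ := by exact_mod_cast e
    rwa [inv_inv] at this
  subst huq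
  refine ⟨h1, ?_⟩
  rw [h2]
  have : (v - (1 - u ^ 2)) * (v + (1 - u ^ 2)) = 0 := by linear_combination h5 - hq2
  rcases mul_eq_zero.1 this with h6 | h6
  · nlinarith
  · congr 1; linarith

end IsRealHalfPeriod

/-! ### Comparison with the Weierstrass function -/

namespace Sol

variable {κ : ℂ} {R S : ℂ → ℂ}

/-- The Taylor coefficients of S up to order 3 are those of z²: S''(0) = 2 by the second-order
equation, and S'''(0) = 0 because S'(0) = 0. -/
theorem four_le_order_sub_sq (h : Sol κ S) (ha : AnalyticAt ℂ S 0) (h0 : S 0 = 0) :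
    4 ≤ meromorphicOrderAt (fun z => z ^ 2 - S z) 0 := by
  have hd : deriv S 0 = 0 := h.deriv_eq_zero ha (by rw [h0, zero_mul])
  have hW : AnalyticAt ℂ (fun z => z ^ 2 - S z) 0 := by fun_prop
  have e1 : deriv (fun z => z ^ 2 - S z) =ᶠ[𝓝 0] fun z => 2 * z - deriv S z := by
    filter_upwards [ha.eventually_analyticAt] with z hz
    simpa using ((hasDerivAt_pow 2 z).fun_sub hz.differentiableAt.hasDerivAt).deriv
  have e2 : deriv (deriv fun z => z ^ 2 - S z) =ᶠ[𝓝 0] fun z => -(6 * S z ^ 2 + 4 * κ * S z) := by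
    filter_upwards [e1.deriv, ha.eventually_analyticAt, h.second_order ha] with z h1 hz h2
    have := (((hasDerivAt_id' z).const_mul 2).fun_sub hz.deriv.differentiableAt.hasDerivAt).deriv
    rw [h1, this, h2]
    ring
  have e3 : deriv (deriv (deriv fun z => z ^ 2 - S z)) 0 = 0 := by
    have hS := ha.differentiableAt.hasDerivAt
    have := (((hS.fun_pow 2).const_mul 6).fun_add (hS.const_mul (4 * κ))).fun_neg.deriv
    rw [e2.deriv_eq, this, hd]
    simp
  rw [hW.meromorphicOrderAt_eq]
  have : (4 : ℕ) ≤ analyticOrderAt (fun z => z ^ 2 - S z) 0 := by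
    rw [natCast_le_analyticOrderAt_iff_iteratedDeriv_eq_zero hW]
    intro i hi
    rw [iteratedDeriv_eq_iterate]
    interval_cases i
    · simp [h0]
    · simpa [hd] using e1.eq_of_nhds
    · simpa [h0] using e2.eq_of_nhds
    · exact e3
  exact ENat.monotone_map_iff.mpr Nat.mono_cast this

/-- Factor R - 1/z² = (z² - 1/R) · R · z⁻²; the orders are at least 4, then -2 and -2. Thus R and ℘
have the same principal part. -/
theorem nonneg_order_sub_inv_sq (h : Sol κ R) (hp : ¬ AnalyticAt ℂ R 0) :
    0 ≤ meromorphicOrderAt (fun z => R z - 1 / z ^ 2) 0 := by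
  obtain ⟨b1, b2⟩ := h.analyticAt_inv hp
  have o1 := h.inv.four_le_order_sub_sq b1 b2
  have o2 := h.order_eq_neg_two hp
  have o3 : meromorphicOrderAt (fun z : ℂ => z ^ (-2 : ℤ)) 0 = ((-2 : ℤ) : WithTop ℤ) := by
    simpa using fun_meromorphicOrderAt_zpow_id_sub_const (𝕜 := ℂ) (x := 0) (n := -2)
  have mi : MeromorphicAt (fun z : ℂ => z ^ (-2 : ℤ)) 0 := by fun_prop
  have m1 : MeromorphicAt (fun z => z ^ 2 - R⁻¹ z) 0 := by
    have := b1.meromorphicAt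
    fun_prop
  have e : (fun z => R z - 1 / z ^ 2) =ᶠ[𝓝[≠] 0]
      (fun z => z ^ 2 - R⁻¹ z) * (R * fun z : ℂ => z ^ (-2 : ℤ)) := by
    filter_upwards [self_mem_nhdsWithin, h.eventually_ne 0 0] with z hz hR
    have hz : z ≠ 0 := hz
    simp only [Pi.mul_apply, Pi.inv_apply, zpow_neg]
    field_simp
  rw [meromorphicOrderAt_congr e, meromorphicOrderAt_mul m1 ((h.meromorphic 0).mul mi),
    meromorphicOrderAt_mul (h.meromorphic 0) mi, o2, o3]
  generalize meromorphicOrderAt (fun z => z ^ 2 - R⁻¹ z) 0 = q at o1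
  cases q with
  | top => exact le_top
  | coe q =>
    have : (4 : ℤ) ≤ q := WithTop.coe_le_coe.1 o1
    have : (0 : ℤ) ≤ q + (-2 + -2) := by omega
    exact WithTop.coe_le_coe.2 this

/-- In normal form R - ℘ is entire: at 0 the principal parts cancel and periodicity carries this to
the lattice. It is bounded by periodicity, so Liouville's theorem applies. -/
theorem exists_eq_weierstrassP_add (h : Sol κ R) (hp : ¬ AnalyticAt ℂ R 0) (L : PeriodPair)
    (hL : ∀ w ∈ L.lattice, Function.Periodic R w) (hL' : ∀ z ∉ L.lattice, AnalyticAt ℂ R z) :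
    ∃ C : ℂ, ∀ z ∉ L.lattice, R z = L.weierstrassP z + C := by
  have hm : Meromorphic (R - L.weierstrassP) := h.meromorphic.sub L.meromorphic_weierstrassP
  have hFn := meromorphicNFOn_toMeromorphicNFOn (R - L.weierstrassP) univ
  have hFF : ∀ z, toMeromorphicNFOn (R - L.weierstrassP) univ =ᶠ[𝓝[≠] z] R - L.weierstrassP :=
    fun z => hm.meromorphicOn.toMeromorphicNFOn_eq_self_on_nhdsNE (mem_univ z)
  set F := toMeromorphicNFOn (R - L.weierstrassP) univ
  have hper : ∀ w ∈ L.lattice, ∀ z, F (z + w) = F z := by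
    intro w hw
    have hR := hL w hw
    have hP := L.periodic_weierstrassP ⟨w, hw⟩
    have t : Tendsto (fun z => z + w) (𝓝[≠] 0) (𝓝[≠] w) := by
      refine tendsto_nhdsWithin_iff.2 ⟨?_, ?_⟩
      · exact (by simpa using (Continuous.tendsto (f := fun z : ℂ => z + w) (by fun_prop) 0) :
          Tendsto (fun z => z + w) (𝓝 0) (𝓝 w)).mono_left nhdsWithin_le_nhds
      · filter_upwards [self_mem_nhdsWithin] with z hz h
        exact hz (by simpa using h)
    have := eq_of_meromorphicNF (f := fun z => F (z + w)) (g := F) (a := 0)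
      (fun z => MeromorphicNFAt.comp_analyticAt (g := fun z => z + w) (hFn (mem_univ _))
        (by fun_prop)) (fun z => hFn (mem_univ z)) (by
        filter_upwards [t.eventually (hFF w), hFF 0] with z h1 h2
        rw [h1, h2, Pi.sub_apply, Pi.sub_apply, hR z, hP z])
    exact congrFun this
  have hF0 : AnalyticAt ℂ F 0 := by
    refine (hFn (mem_univ 0)).meromorphicOrderAt_nonneg_iff_analyticAt.1 ?_
    have hE : AnalyticAt ℂ (L.weierstrassPExcept 0) 0 := L.analyticAt_weierstrassPExcept 0
    have e : F =ᶠ[𝓝[≠] 0] (fun z => R z - 1 / z ^ 2) + -L.weierstrassPExcept 0 := by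
      filter_upwards [hFF 0] with z hz
      have := L.weierstrassPExcept_add 0 z
      simp only [ZeroMemClass.coe_zero, sub_zero] at this
      rw [hz, Pi.sub_apply, ← this]
      simp
      ring
    have mR : MeromorphicAt (fun z => R z - 1 / z ^ 2) 0 := by
      have := h.meromorphic 0
      fun_prop
    rw [meromorphicOrderAt_congr e]
    exact (le_min (h.nonneg_order_sub_inv_sq hp) hE.neg.meromorphicOrderAt_nonneg).trans
      (meromorphicOrderAt_add mR hE.neg.meromorphicAt)
  have hoff : ∀ z ∉ L.lattice, F =ᶠ[𝓝 z] R - L.weierstrassP := fun z hz =>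
    ((hFn (mem_univ z)).eventuallyEq_nhdsNE_iff_eventuallyEq_nhds
      ((hL' z hz).sub (L.analyticOnNhd_weierstrassP z hz)).meromorphicNFAt).1 (hFF z)
  have hFa : ∀ z, AnalyticAt ℂ F z := by
    intro z
    by_cases hz : z ∈ L.lattice
    · have := (Sol.analyticAt_add_iff (hper z hz) 0).2 hF0
      rwa [zero_add] at this
    · exact ((hL' z hz).sub (L.analyticOnNhd_weierstrassP z hz)).congr (hoff z hz).symm
  have hFd : Differentiable ℂ F := fun z => (hFa z).differentiableAt
  refine ⟨F 0, fun z hz => ?_⟩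
  have h1 : F z = F 0 := hFd.apply_eq_apply_of_bounded
    (IsZLattice.isCompact_range_of_periodic L.lattice F hFd.continuous
      fun z w hw => hper w hw z).isBounded z 0
  rw [← h1, (hoff z hz).eq_of_nhds, Pi.sub_apply]
  ring

theorem eq_weierstrassP (h : Sol κ R) (hp : ¬ AnalyticAt ℂ R 0) (L : PeriodPair)
    (hL : ∀ w ∈ L.lattice, Function.Periodic R w) (hL' : ∀ z ∉ L.lattice, AnalyticAt ℂ R z)
    {z : ℂ} (hz : z ∉ L.lattice) : R z = L.weierstrassP z - κ / 3 := by
  obtain ⟨C, hC⟩ := h.exists_eq_weierstrassP_add hp L hL hL'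
  obtain ⟨b1, b2⟩ := h.analyticAt_inv hp
  -- Inserting ℘ = R - C into both differential equations cancels the cubic terms. Dividing the
  -- remaining quadratic relation by R² and evaluating at the pole leaves κ + 3C = 0.
  have hquad : ∀ z ∉ L.lattice, (κ + 3 * C) * R z ^ 2 +
      (1 - 3 * C ^ 2 + L.g₂ / 4) * R z + (C ^ 3 - L.g₂ * C / 4 + L.g₃ / 4) = 0 := by
    intro z hz
    have e : R =ᶠ[𝓝 z] fun w => L.weierstrassP w + C := by
      filter_upwards [L.isClosed_lattice.isOpen_compl.mem_nhds hz] with w hw using hC w hw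
    have hd : deriv R z = L.derivWeierstrassP z := by
      rw [e.deriv_eq, deriv_add_const, L.deriv_weierstrassP]
    have h1 := h.ode z (hL' z hz)
    have h2 := L.derivWeierstrassP_sq z hz
    have h3 : L.weierstrassP z = R z - C := by rw [hC z hz]; ring
    rw [hd, h2, h3] at h1
    linear_combination -h1 / 4
  have hpunct : ∀ᶠ z in 𝓝[≠] (0 : ℂ), z ∉ L.lattice := by
    filter_upwards [self_mem_nhdsWithin, nhdsWithin_le_nhds
      (L.compl_lattice_sdiff_singleton_mem_nhds 0)] with z h1 h2 h3
    exact h2 ⟨h3, h1⟩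
  have hS : AnalyticAt ℂ (fun z => (κ + 3 * C) + (1 - 3 * C ^ 2 + L.g₂ / 4) * R⁻¹ z +
      (C ^ 3 - L.g₂ * C / 4 + L.g₃ / 4) * R⁻¹ z ^ 2) 0 := by fun_prop
  have h0 := (AnalyticAt.frequently_zero_iff_eventually_zero hS).1 (Eventually.frequently (by
    filter_upwards [hpunct, h.eventually_ne 0 0] with z h1 h2
    have := hquad z h1
    rw [Pi.inv_apply]
    field_simp
    linear_combination 4 * this)) |>.self_of_nhds
  rw [b2] at h0
  rw [hC z hz]
  linear_combination h0 / 3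

end Sol

/-! ### The imaginary transformation -/

/-- The imaginary transformation of `R`, which exchanges the two axes. -/
noncomputable def imagTransform (β n : ℝ) (R : ℂ → ℂ) : ℂ → ℂ :=
  toMeromorphicNFOn (fun z => -(R (0 + Complex.I / n * z) + β) / n ^ 2) univ

section ImagTransform

variable {β n : ℝ} {κ : ℂ} {R : ℂ → ℂ}

theorem imagTransform_nf (z : ℂ) : MeromorphicNFAt (imagTransform β n R) z :=
  meromorphicNFOn_toMeromorphicNFOn _ univ (mem_univ z)

theorem imagTransform_eventuallyEq (h : Sol κ R) (z : ℂ) :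
    imagTransform β n R =ᶠ[𝓝[≠] z] fun z => -(R (0 + Complex.I / n * z) + β) / n ^ 2 := by
  refine MeromorphicOn.toMeromorphicNFOn_eq_self_on_nhdsNE (U := univ) (fun z _ => ?_) (mem_univ z)
  have : MeromorphicAt (fun z => R (0 + Complex.I / n * z)) z :=
    MeromorphicAt.comp_analyticAt (g := fun z => 0 + Complex.I / n * z) (h.meromorphic _)
      (by fun_prop)
  exact ((this.add (.const _ _)).neg).div (.const _ _)

theorem imagTransform_eq (h : Sol κ R) (hn : n ≠ 0) {z : ℂ}
    (hz : AnalyticAt ℂ R (Complex.I / n * z)) :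
    imagTransform β n R =ᶠ[𝓝 z] fun z => -(R (0 + Complex.I / n * z) + β) / n ^ 2 := by
  have hn' : (n : ℂ) ≠ 0 := by exact_mod_cast hn
  have hc : Complex.I / n ≠ 0 := div_ne_zero Complex.I_ne_zero hn'
  have : AnalyticAt ℂ (fun z => R (0 + Complex.I / n * z)) z :=
    (analyticAt_comp_affine hc).2 (by simpa using hz)
  refine ((imagTransform_nf z).eventuallyEq_nhdsNE_iff_eventuallyEq_nhds
    (AnalyticAt.meromorphicNFAt ?_)).1 (imagTransform_eventuallyEq h z)
  exact ((this.add analyticAt_const).neg).div analyticAt_const (pow_ne_zero 2 hn')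

theorem imagTransform_analyticAt_iff (h : Sol κ R) (hn : n ≠ 0) (z : ℂ) :
    AnalyticAt ℂ (imagTransform β n R) z ↔ AnalyticAt ℂ R (Complex.I / n * z) := by
  have hn' : (n : ℂ) ≠ 0 := by exact_mod_cast hn
  have hc : Complex.I / n ≠ 0 := div_ne_zero Complex.I_ne_zero hn'
  have key : AnalyticAt ℂ (fun z => R (0 + Complex.I / n * z)) z ↔
      AnalyticAt ℂ R (Complex.I / n * z) := by
    rw [analyticAt_comp_affine hc, zero_add]
  refine ⟨fun ha => ?_, fun hz => ?_⟩
  · rw [← key]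
    have hA : AnalyticAt ℂ (fun z => -(n : ℂ) ^ 2 * imagTransform β n R z - β) z := by fun_prop
    refine hA.congr ?_
    refine (hA.meromorphicNFAt.eventuallyEq_nhdsNE_iff_eventuallyEq_nhds
      (MeromorphicNFAt.comp_analyticAt (g := fun z => 0 + Complex.I / n * z) (h.nf _)
        (by fun_prop))).1 ?_
    filter_upwards [imagTransform_eventuallyEq h z] with w hw
    rw [hw]
    simp only [Function.comp_apply]
    field_simp
    ring
  · have := key.2 hz
    refine AnalyticAt.congr ?_ (imagTransform_eq h hn hz).symm
    exact ((this.add analyticAt_const).neg).div analyticAt_const (pow_ne_zero 2 hn')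

theorem apply_eq_imagTransform (h : Sol κ R) (hn : n ≠ 0) {z : ℂ}
    (hz : AnalyticAt ℂ R (Complex.I / n * z)) :
    R (Complex.I / n * z) = -β - n ^ 2 * imagTransform β n R z := by
  have hn' : (n : ℂ) ≠ 0 := by exact_mod_cast hn
  rw [(imagTransform_eq h hn hz).eq_of_nhds, zero_add]
  field_simp
  ring

theorem deriv_eq_imagTransform (h : Sol κ R) (hn : n ≠ 0) {z : ℂ}
    (hz : AnalyticAt ℂ R (Complex.I / n * z)) :
    deriv R (Complex.I / n * z) = Complex.I * n ^ 3 * deriv (imagTransform β n R) z := by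
  have hn' : (n : ℂ) ≠ 0 := by exact_mod_cast hn
  have e : deriv (imagTransform β n R) z =
      deriv (fun z => -(R (0 + Complex.I / n * z) + β) / n ^ 2) z := (imagTransform_eq h hn hz).deriv_eq
  have hz' : AnalyticAt ℂ R (0 + Complex.I / n * z) := by simpa using hz
  rw [e, deriv_div_const, deriv.fun_neg, deriv_add_const, deriv_comp_affine hz', zero_add]
  field_simp
  linear_combination deriv R (Complex.I * z / n) * Complex.I_sq

/-- The zeros 0, -β, -1/β of the cubic are sent to -β/n², 0, -n²/β, where the last uses n⁴ = β² - 1.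
The nonzero ones again have product 1, so the shape w(w² + κw + 1) survives with a new κ. -/
theorem imagTransform_sol (h : Sol (β + 1 / β : ℝ) R) (hβ : β ≠ 0) (hn : n ≠ 0)
    (hnβ : n ^ 4 = β ^ 2 - 1) : Sol (β / n ^ 2 + n ^ 2 / β : ℝ) (imagTransform β n R) := by
  have hn' : (n : ℂ) ≠ 0 := by exact_mod_cast hn
  have hβ' : (β : ℂ) ≠ 0 := by exact_mod_cast hβ
  have hnβ' : (n : ℂ) ^ 4 = β ^ 2 - 1 := by exact_mod_cast hnβ
  refine ⟨imagTransform_nf, fun z hz => ?_, ?_⟩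
  · have hz' := (imagTransform_analyticAt_iff h hn z).1 hz
    have h1 := h.ode _ hz'
    rw [apply_eq_imagTransform h hn hz', deriv_eq_imagTransform (β := β) h hn hz'] at h1
    generalize imagTransform β n R z = Z at h1 ⊢
    generalize deriv (imagTransform β n R) z = Y at h1 ⊢
    push_cast at h1 ⊢
    have hn6 : (n : ℂ) ^ 6 ≠ 0 := pow_ne_zero 6 hn'
    have f : (-(β : ℂ) - n ^ 2 * Z) ^ 2 + (β + 1 / β) * (-β - n ^ 2 * Z) + 1 =
        n ^ 2 * Z * (n ^ 2 * Z + n ^ 4 / β) := by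
      rw [hnβ']
      field_simp
      ring
    rw [f] at h1
    have h2 : (n : ℂ) ^ 6 * Y ^ 2 = 4 * (β + n ^ 2 * Z) * (n ^ 2 * Z * (n ^ 2 * Z + n ^ 4 / β)) := by
      linear_combination -h1 + n ^ 6 * Y ^ 2 * Complex.I_sq
    refine mul_left_cancel₀ hn6 (h2.trans ?_)
    field_simp
    ring
  · obtain ⟨z, hz, hz'⟩ := h.nonconst
    have e : Complex.I / n * (n / Complex.I * z) = z := by
      have := Complex.I_ne_zero
      field_simp
    refine ⟨n / Complex.I * z, (imagTransform_analyticAt_iff h hn _).2 (by rwa [e]), fun h0 => hz' ?_⟩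
    have := deriv_eq_imagTransform (β := β) h hn (z := n / Complex.I * z) (by rwa [e])
    rw [← e, this, h0, mul_zero]

end ImagTransform

/-! ### Existence and uniqueness of the essential elliptic function -/

section Essential

variable {β : ℝ} {R : ℂ → ℂ}

theorem sq_add_factor (hβ : β ≠ 0) (w : ℂ) :
    4 * w * (w + β) * (w + 1 / β) = 4 * w * (w ^ 2 + (β + 1 / β : ℝ) * w + 1) := by
  have hβ' : (β : ℂ) ≠ 0 := by exact_mod_cast hβ
  push_cast
  field_simp
  ring

theorem sol_of_isEssentialElliptic (hβ : β ≠ 0) (h : EighthLattice.IsEssentialElliptic β R) :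
    Sol (β + 1 / β : ℝ) R ∧ ¬ AnalyticAt ℂ R 0 := by
  have hp : ¬ AnalyticAt ℂ R 0 := fun h0 => by
    have := h0.meromorphicOrderAt_nonneg
    rw [h.double_pole] at this
    exact absurd this (by decide)
  refine ⟨⟨fun z => h.meromorphic (mem_univ z), fun z hz => ?_, ?_⟩, hp⟩
  · rw [h.ode z hz, sq_add_factor hβ]
  · have hm : MeromorphicAt R 0 := (h.meromorphic (mem_univ 0)).meromorphicAt
    have o := meromorphicOrderAt_deriv_eq_sub_one (n := -2) (by norm_num) h.double_pole
    have hne := (meromorphicOrderAt_ne_top_iff_eventually_ne_zero hm.deriv).1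
      (by rw [o]; exact WithTop.coe_ne_top)
    exact (hm.eventually_analyticAt.and hne).exists

theorem isEssentialElliptic_of_sol (hβ : β ≠ 0) (h : Sol (β + 1 / β : ℝ) R)
    (hp : ¬ AnalyticAt ℂ R 0) : EighthLattice.IsEssentialElliptic β R :=
  ⟨fun z _ => h.nf z, h.order_eq_neg_two hp, fun z hz => by rw [h.ode z hz, sq_add_factor hβ]⟩

theorem existsUnique_isEssentialElliptic (hβ : β ≠ 0) :
    ∃! R : ℂ → ℂ, EighthLattice.IsEssentialElliptic β R := by
  obtain ⟨S, hS, ha, h0⟩ := exists_sol (β + 1 / β : ℝ)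
  have hp : ¬ AnalyticAt ℂ S⁻¹ 0 := fun h1 => by
    have o := hS.order_eq_two ha h0
    have := h1.meromorphicOrderAt_nonneg
    rw [meromorphicOrderAt_inv, o] at this
    exact absurd this (by decide)
  refine ⟨S⁻¹, isEssentialElliptic_of_sol hβ hS.inv hp, fun R hR => ?_⟩
  obtain ⟨h1, h2⟩ := sol_of_isEssentialElliptic hβ hR
  exact h1.eq_of_not_analyticAt hS.inv h2 hp

end Essential

/-! ### The lattice of periods and poles -/

/-- The common data of the period computation: `n` is the fourth root of `β² - 1`, and
`a`, `b` are the half periods of `R` and of its imaginary transformation. -/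
structure PeriodData (β n a b : ℝ) (R : ℂ → ℂ) : Prop where
  one_lt : 1 < β
  n_pos : 0 < n
  n_pow : n ^ 4 = β ^ 2 - 1
  sol : Sol (β + 1 / β : ℝ) R
  pole : ¬ AnalyticAt ℂ R 0
  real : IsRealHalfPeriod R a
  imag : IsRealHalfPeriod (imagTransform β n R) b

theorem exists_periodData {β : ℝ} (hβ : 1 < β) {R : ℂ → ℂ}
    (hR : EighthLattice.IsEssentialElliptic β R) : ∃ n a b, PeriodData β n a b R := by
  have hβ0 : β ≠ 0 := by linarith
  obtain ⟨h, hp⟩ := sol_of_isEssentialElliptic hβ0 hR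
  have hpos : 0 < β ^ 2 - 1 := by nlinarith
  set n := √(√(β ^ 2 - 1)) with hn
  have hn0 : 0 < n := Real.sqrt_pos.2 (Real.sqrt_pos.2 hpos)
  have hn4 : n ^ 4 = β ^ 2 - 1 := by
    rw [show n ^ 4 = (n ^ 2) ^ 2 by ring, hn, Real.sq_sqrt (Real.sqrt_nonneg _), Real.sq_sqrt hpos.le]
  have hT := imagTransform_sol h hβ0 hn0.ne' hn4
  have hTp : ¬ AnalyticAt ℂ (imagTransform β n R) 0 := by
    rwa [imagTransform_analyticAt_iff h hn0.ne', mul_zero]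
  obtain ⟨a, ha⟩ := h.exists_realHalfPeriod hp (by positivity)
  obtain ⟨b, hb⟩ := hT.exists_realHalfPeriod hTp (by positivity)
  exact ⟨n, a, b, hβ, hn0, hn4, h, hp, ha, hb⟩

namespace PeriodData

variable {β n a b : ℝ} {R : ℂ → ℂ}

theorem sol_imag (D : PeriodData β n a b R) :
    Sol (β / n ^ 2 + n ^ 2 / β : ℝ) (imagTransform β n R) :=
  imagTransform_sol D.sol (by linarith [D.one_lt]) D.n_pos.ne' D.n_pow

theorem pole_imag (D : PeriodData β n a b R) : ¬ AnalyticAt ℂ (imagTransform β n R) 0 := by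
  rw [imagTransform_analyticAt_iff D.sol D.n_pos.ne', mul_zero]
  exact D.pole

theorem n_ne_zero (D : PeriodData β n a b R) : (n : ℂ) ≠ 0 := by exact_mod_cast D.n_pos.ne'

theorem analyticAt_imag (D : PeriodData β n a b R) :
    AnalyticAt ℂ R (Complex.I / n * b) :=
  (imagTransform_analyticAt_iff D.sol D.n_pos.ne' _).1 D.imag.analyticAt

theorem apply_imag (D : PeriodData β n a b R) : R (Complex.I / n * b) = -β := by
  rw [apply_eq_imagTransform D.sol D.n_pos.ne' D.analyticAt_imag, D.imag.apply_eq]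
  simp

theorem periodic_real (D : PeriodData β n a b R) : Function.Periodic R (2 * a) :=
  D.real.periodic D.sol D.pole

theorem periodic_imag (D : PeriodData β n a b R) :
    Function.Periodic R (2 * (Complex.I / n * b)) := fun z => by
  have hβ : (β : ℂ) ≠ 0 := by have := D.one_lt; exact_mod_cast (by linarith : β ≠ 0)
  set c := Complex.I / n * (b : ℂ) with hc
  have := D.sol.reflect D.analyticAt_imag (by
    rw [D.apply_imag]
    push_cast
    field_simp
    ring) (c + z)
  rw [← hc, show c - (c + z) = -z by ring, D.sol.even D.pole, show c + (c + z) = z + 2 * c by ring] at this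
  exact this

theorem analyticAt_real_add_iff (D : PeriodData β n a b R) (z : ℂ) :
    AnalyticAt ℂ R (a + z) ↔ AnalyticAt ℂ R⁻¹ z := by
  have := analyticAt_comp_affine (f := R) (b := a) (z := z) one_ne_zero
  rw [one_mul] at this
  rw [← this]
  have e : (fun z => R (a + 1 * z)) = R⁻¹ := by
    ext z
    rw [one_mul, D.sol.apply_zero_add D.pole D.real.analyticAt D.real.apply_eq, Pi.inv_apply]
  rw [e]

theorem exists_int_of_pole (D : PeriodData β n a b R) {p : ℂ} (hp : ¬ AnalyticAt ℂ R p) :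
    ∃ k l : ℤ, p = k * (2 * a) + l * (2 * (Complex.I / n * b)) := by
  have hn := D.n_ne_zero
  have hI := Complex.I_ne_zero
  -- With p also its conjugate is a pole, hence a period. So p plus and minus its conjugate are
  -- poles, one real and one imaginary, and the results on the two axes place p in the half-lattice.
  have hconj : ¬ AnalyticAt ℂ R ((starRingEnd ℂ) p) := fun h => hp (by
    have := AnalyticAt.conj_conj h
    simpa [D.sol.apply_conj D.pole (Complex.conj_ofReal _)] using this)
  have hper := D.sol.periodic_of_pole D.pole hconj
  have h1 : ¬ AnalyticAt ℂ R ((2 * p.re : ℝ) : ℂ) := by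
    have e : ((2 * p.re : ℝ) : ℂ) = p + (starRingEnd ℂ) p := by rw [Complex.add_conj]
    rwa [e, Sol.analyticAt_add_iff hper]
  have h2 : ¬ AnalyticAt ℂ (imagTransform β n R) ((2 * p.im * n : ℝ) : ℂ) := by
    rw [imagTransform_analyticAt_iff D.sol D.n_pos.ne']
    have e : Complex.I / n * ((2 * p.im * n : ℝ) : ℂ) = p - (starRingEnd ℂ) p := by
      rw [Complex.sub_conj]
      push_cast
      field_simp
    rwa [e, ← Sol.analyticAt_add_iff hper, sub_add_cancel]
  obtain ⟨k, hk⟩ := D.real.exists_int_of_pole D.sol D.pole h1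
  obtain ⟨l, hl⟩ := D.imag.exists_int_of_pole D.sol_imag D.pole_imag h2
  have hp' : p = k * a + l * (Complex.I / n * b) := by
    have hre : p.re = k * a := by linarith
    have him : p.im * n = l * b := by linarith
    have him' : (p.im : ℂ) * n = l * b := by exact_mod_cast him
    rw [← Complex.re_add_im p, hre]
    push_cast
    field_simp
    linear_combination Complex.I * him'
  rw [hp'] at hp
  set c := Complex.I / n * (b : ℂ) with hc
  have P := D.periodic_real
  have Q := D.periodic_imag
  rw [← hc] at Q
  have red : ∀ (i j : ℤ) (z : ℂ), AnalyticAt ℂ R (z + (i * (2 * a) + j * (2 * c))) ↔ AnalyticAt ℂ R z :=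
    fun i j z => Sol.analyticAt_add_iff ((P.int_mul i).add_period (Q.int_mul j)) z
  rcases Int.even_or_odd' k with ⟨k', rfl | rfl⟩ <;> rcases Int.even_or_odd' l with ⟨l', rfl | rfl⟩
  · exact ⟨k', l', by rw [hp']; push_cast; ring⟩
  · exfalso
    refine hp ?_
    have := (red k' l' c).2 D.analyticAt_imag
    convert! this using 1
    push_cast; ring
  · exfalso
    refine hp ?_
    have := (red k' l' a).2 D.real.analyticAt
    convert! this using 1
    push_cast; ring
  · exfalso
    refine hp ?_
    -- At the third half-period R is the reciprocal of R(c) = -β, hence finite.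
    have h3 : AnalyticAt ℂ R (a + c) := by
      rw [D.analyticAt_real_add_iff]
      refine D.analyticAt_imag.inv ?_
      rw [D.apply_imag]
      have := D.one_lt
      exact neg_ne_zero.2 (by exact_mod_cast (by linarith : β ≠ 0))
    have := (red k' l' (a + c)).2 h3
    convert! this using 1
    push_cast; ring

/-- The period pair of `R`. -/
noncomputable def periodPair (D : PeriodData β n a b R) : PeriodPair where
  ω₁ := 2 * a
  ω₂ := 2 * (Complex.I / n * b)
  indep := by
    have ha := D.real.pos
    have hb := D.imag.pos
    have hn := D.n_pos
    rw [LinearIndependent.pair_iff]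
    intro s t hst
    have h1 := congrArg Complex.re hst
    have h2 := congrArg Complex.im hst
    simp [Complex.div_re, Complex.div_im] at h1 h2
    refine ⟨h1.resolve_right ha.ne', ?_⟩
    exact h2.resolve_right (by simp [hn.ne', hb.ne'])

theorem mem_lattice (D : PeriodData β n a b R) {w : ℂ} : w ∈ D.periodPair.lattice ↔
    ∃ k l : ℤ, w = k * (2 * a) + l * (2 * (Complex.I / n * b)) := by
  rw [PeriodPair.mem_lattice]
  simp only [periodPair, eq_comm]

theorem periodic_of_mem (D : PeriodData β n a b R) {w : ℂ} (hw : w ∈ D.periodPair.lattice) :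
    Function.Periodic R w := by
  obtain ⟨k, l, rfl⟩ := D.mem_lattice.1 hw
  exact (D.periodic_real.int_mul k).add_period (D.periodic_imag.int_mul l)

theorem periodic_iff_mem (D : PeriodData β n a b R) (w : ℂ) :
    Function.Periodic R w ↔ w ∈ D.periodPair.lattice := by
  refine ⟨fun h => D.mem_lattice.2 (D.exists_int_of_pole ?_), D.periodic_of_mem⟩
  have := Sol.analyticAt_add_iff h 0
  rw [zero_add] at this
  rw [this]
  exact D.pole

theorem analyticAt_of_notMem (D : PeriodData β n a b R) {z : ℂ} (hz : z ∉ D.periodPair.lattice) :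
    AnalyticAt ℂ R z := by
  by_contra h
  exact hz (D.mem_lattice.2 (D.exists_int_of_pole h))

theorem eq_weierstrassP (D : PeriodData β n a b R) {z : ℂ} (hz : z ∉ D.periodPair.lattice) :
    R z = D.periodPair.weierstrassP z - ((β : ℂ) + 1 / β) / 3 := by
  have := D.sol.eq_weierstrassP D.pole D.periodPair (fun w hw => D.periodic_of_mem hw)
    (fun z hz => D.analyticAt_of_notMem hz) hz
  rw [this]
  push_cast
  rfl

end PeriodData

/-! ### The addition theorem -/

namespace Sol

variable {κ : ℂ} {R : ℂ → ℂ}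

/-- For fixed v both sides are solutions in u. They are compared at u = a, where R vanishes and R(u
+ v) = 1/R(v); the choice u = 0 would meet the pole. The condition R'(v) ≠ 0 makes the right-hand
side nonconstant there, so that it obeys the second-order equation. -/
theorem addition (h : Sol κ R) (hp : ¬ AnalyticAt ℂ R 0) {a v u : ℂ} (ha : AnalyticAt ℂ R a)
    (ha0 : R a = 0) (hv : AnalyticAt ℂ R v) (hv0 : R v ≠ 0) (hv1 : deriv R v ≠ 0)
    (hu : AnalyticAt ℂ R u) (huv : R u ≠ R v) : AnalyticAt ℂ R (u + v) ∧
      R (u + v) = ((deriv R u - deriv R v) / (R u - R v)) ^ 2 / 4 - κ - R u - R v := by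
  set b := R v with hb
  set b' := deriv R v with hb'
  have hode_v := h.ode v hv
  rw [← hb, ← hb'] at hode_v
  set W : ℂ → ℂ := fun u => ((deriv R u - b') / (R u - b)) ^ 2 / 4 - κ - R u - b with hW
  have hF := h.inv.comp_affine (v - a) 1 (by norm_num)
  set F : ℂ → ℂ := fun u => R⁻¹ (v - a + 1 * u) with hFdef
  have hFR : ∀ u, F u = R (u + v) := fun u => by
    rw [hFdef]
    simp only [Pi.inv_apply]
    rw [← h.apply_zero_add hp ha ha0]
    congr 1; ring
  have hWa : ∀ {u}, AnalyticAt ℂ R u → R u ≠ b → AnalyticAt ℂ W u := by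
    intro u hu hub
    have hd := hu.deriv
    have c1 : ∀ c : ℂ, AnalyticAt ℂ (fun _ : ℂ => c) u := fun c => analyticAt_const
    exact (((((hd.sub (c1 b')).div (hu.sub (c1 b)) (sub_ne_zero.2 hub)).pow 2).div (c1 4)
      (by norm_num)).sub (c1 κ)).sub hu |>.sub (c1 b)
  have hWd : ∀ u, AnalyticAt ℂ R u → R u ≠ b →
      deriv W u = -((deriv R u - b') / (R u - b) * (W u - R u) + deriv R u) ∧
      deriv W u ^ 2 = 4 * W u * (W u ^ 2 + κ * W u + 1) := by
    intro u hu hub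
    have hub' := sub_ne_zero.2 hub
    have d1 := hu.differentiableAt.hasDerivAt
    have d2 := hu.deriv.differentiableAt.hasDerivAt
    have d3 := (((((d2.sub_const b').fun_div (d1.sub_const b) hub').fun_pow 2).div_const 4).sub_const
      κ).fun_sub d1 |>.sub_const b
    have e1 := d3.deriv
    rw [(h.second_order hu).self_of_nhds] at e1
    have e2 := h.ode u hu
    have e3 : W u = ((deriv R u - b') / (R u - b)) ^ 2 / 4 - κ - R u - b := rfl
    have e4 : deriv W u = _ := e1
    rw [e4]
    generalize W u = w at e3 ⊢
    generalize R u = x at *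
    generalize deriv R u = A at *
    -- m is the slope of the chord through (R u, R' u) and (R v, R' v) on the curve y² = 4x(x² + κx
    -- + 1).
    obtain ⟨m, hm⟩ : ∃ m, m = (A - b') / (x - b) := ⟨_, rfl⟩
    rw [← hm] at e3
    have hb'm : b' = A - m * (x - b) := by rw [hm]; field_simp; ring
    have key0 : m * (2 * A - m * (x - b)) = 4 * (x ^ 2 + x * b + b ^ 2 + κ * (x + b) + 1) := by
      rw [hb'm] at hode_v
      refine mul_left_cancel₀ hub' ?_
      linear_combination e2 - hode_v
    have key1 : 6 * x ^ 2 + 4 * κ * x + 2 - m * A = 2 * (x - b) * (x - w) := by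
      rw [e3]; linear_combination -key0 / 2
    have key2 : ((6 * x ^ 2 + 4 * κ * x + 2) * (x - b) - (A - b') * A) / (x - b) ^ 2 =
        2 * (x - w) := by
      rw [div_eq_iff (pow_ne_zero 2 hub'), hb'm]
      linear_combination (x - b) * key1
    rw [key2, ← hm]
    -- The chord meets the curve at a third point with abscissa w, whose ordinate is m(w - x) + A;
    -- the derivative of W is minus this ordinate.
    have key3 : 4 * w * (w ^ 2 + κ * w + 1) = (m * (w - x) + A) ^ 2 := by
      have e3' : 4 * w = m ^ 2 - 4 * (κ + x + b) := by rw [e3]; ring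
      linear_combination -e2 - (w - x) * key0 + (w - x) * (w - b) * e3'
    constructor
    · norm_num
      ring
    · rw [key3]
      norm_num
      ring
  have hane : R a ≠ b := by rw [ha0]; exact hv0.symm
  have hFa : AnalyticAt ℂ F a :=
    (analyticAt_comp_affine one_ne_zero).2 (by simpa using hv.inv hv0)
  have hF0 : F a = b⁻¹ := by simp [hFdef, hb]
  have hF1 : deriv F a = -b' / b ^ 2 := by
    have e : v - a + 1 * a = v := by ring
    rw [hFdef, deriv_comp_affine (by rw [e]; exact hv.inv hv0), e, mul_one]
    exact (hv.differentiableAt.hasDerivAt.inv hv0).deriv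
  have hda := h.deriv_eq_zero ha (by rw [ha0, zero_mul])
  have hW0 : W a = b⁻¹ := by
    simp only [hW, ha0, hda]
    rw [zero_sub, zero_sub, neg_div_neg_eq, div_pow, hode_v]
    field_simp
    ring
  have hW1 : deriv W a = -b' / b ^ 2 := by
    rw [(hWd a ha hane).1, hW0, ha0, hda]
    field_simp
    ring
  have hWaa := hWa ha hane
  have hne : ∀ᶠ u in 𝓝 a, R u ≠ b := ha.continuousAt.eventually_ne hane
  have hW2 := eventually_second_order hWaa (κ := κ) (by
    refine nhdsWithin_le_nhds ?_
    filter_upwards [ha.eventually_analyticAt, hne] with u h1 h2 using (hWd u h1 h2).2) (fun h0 => by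
      have := h0.self_of_nhds
      rw [hW1] at this
      exact div_ne_zero (neg_ne_zero.2 hv1) (pow_ne_zero 2 hv0) this)
  have hFW := eventuallyEq_of_second_order hFa hWaa (hF.second_order hFa) hW2 (hF0.trans hW0.symm)
    (hF1.trans hW1.symm)
  have hWm : Meromorphic W := by
    have := h.meromorphic
    have := this.deriv
    simp only [hW]
    fun_prop
  have h3 := eventuallyEq_of_meromorphic hF.meromorphic hWm (hFW.filter_mono nhdsWithin_le_nhds) u
  have h4 := ((hF.nf u).eventuallyEq_nhdsNE_iff_eventuallyEq_nhds (hWa hu huv).meromorphicNFAt).1 h3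
  have h5 : AnalyticAt ℂ F u := (hWa hu huv).congr h4.symm
  refine ⟨?_, by rw [← hFR, h4.eq_of_nhds]⟩
  have e : F = fun u => R (v + 1 * u) := funext fun u => by rw [hFR, one_mul, add_comm]
  rw [e, analyticAt_comp_affine one_ne_zero, one_mul, add_comm] at h5
  exact h5

end Sol

/-! ### Algebraic evaluation of the addition formula -/

section Algebra

/-- The addition formula in terms of logarithmic derivatives. -/
theorem addition_value {K : Type*} [Field K] [CharZero K] {κ x y x' y' p q l m T : K}
    (hx : x' ^ 2 = 4 * x * (x ^ 2 + κ * x + 1))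
    (hy : y' ^ 2 = 4 * y * (y ^ 2 + κ * y + 1)) (hxy : x ≠ y) (hp : x * p = 1) (hq : y * q = 1)
    (hl : x' = l * x) (hm : y' = m * y)
    (hT : T * (x * q + y * p - 2) = -(l * m) / 2 + x + p + y + q + 2 * κ) :
    ((x' - y') / (x - y)) ^ 2 / 4 - κ - x - y = T := by
  have h0 : x - y ≠ 0 := sub_ne_zero.2 hxy
  -- Since p and q are the reciprocals of x and y, multiplying x·q + y·p - 2 by x·y gives (x - y)².
  have key : T * (x - y) ^ 2 = -(x' * y') / 2 + (x + y) * (x * y + 1) + 2 * κ * (x * y) := by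
    rw [hl, hm]
    linear_combination (x * y) * hT + (-T * x ^ 2 + x) * hq + (-T * y ^ 2 + y) * hp
  have : (x' - y') ^ 2 = (4 * (T + κ + x + y)) * (x - y) ^ 2 := by
    linear_combination hx + hy - 4 * key
  rw [div_pow, this, mul_div_cancel_right₀ _ (pow_ne_zero 2 h0)]
  ring

variable {h n t e f s σ τ : ℂ}

/-- Write P = e(h²+h+1)(eh+n²) + h² and Q = e(1+h)(e+h). In `corner_value` the claimed value is
multiplied by a denominator proportional to P - Q·t·n. Separating the product into the terms with
and without I, and each into parts even and odd in t, yields four identities. -/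
theorem corner_identities (ef : e * f = 1) (h2 : h ^ 2 = (e ^ 2 + f ^ 2) / 2)
    (n2 : n ^ 2 = (e ^ 2 - f ^ 2) / 2) (t2 : t ^ 2 = h ^ 2 + 1) :
    n ^ 2 * (e * (h ^ 2 + h + 1) * (e * h + n ^ 2) + h ^ 2) =
        e * (1 + h) * (e + h) * t ^ 2 * (h ^ 2 - f) ∧
      (e + 1) ^ 2 * f / 2 * ((h ^ 2 - f) * (e * (h ^ 2 + h + 1) * (e * h + n ^ 2) + h ^ 2) -
        e * (1 + h) * (e + h) * (n ^ 2) ^ 2) = n ^ 2 * h ^ 2 * (h + 1) * (h + e) ∧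
      (e * (h ^ 2 + h + 1) * (e * h + n ^ 2) + h ^ 2) * ((e + 1) ^ 2 * f / 2 * (h ^ 2 - e)) =
        e * (1 + h) * (e + h) * n ^ 2 * ((e + 1) ^ 2 * f / 2 * ((e - f) ^ 2 / 2) - h ^ 2) ∧
      (e * (h ^ 2 + h + 1) * (e * h + n ^ 2) + h ^ 2) *
          ((e + 1) ^ 2 * f / 2 * ((e - f) ^ 2 / 2) - h ^ 2) -
        e * (1 + h) * (e + h) * t ^ 2 * ((e + 1) ^ 2 * f / 2 * (h ^ 2 - e)) =
        h ^ 2 * (-h * (h ^ 2 + h + 1) + h * e * (e * h + n ^ 2) - h ^ 4 - 1) := by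
  rw [t2, n2]
  -- After f = 1/e, the quantity h² is a Laurent polynomial in e. Reducing all higher powers of h
  -- leaves expressions linear in h that `ring` can compare.
  have e0 : e ≠ 0 := left_ne_zero_of_mul_eq_one ef
  obtain rfl : f = e⁻¹ := eq_inv_of_mul_eq_one_right ef
  have h3 : h ^ 3 = h * ((e ^ 2 + e⁻¹ ^ 2) / 2) := by rw [← h2]; ring
  have h4 : h ^ 4 = ((e ^ 2 + e⁻¹ ^ 2) / 2) ^ 2 := by rw [← h2]; ring
  have h5 : h ^ 5 = h * ((e ^ 2 + e⁻¹ ^ 2) / 2) ^ 2 := by rw [← h2]; ring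
  have h6 : h ^ 6 = ((e ^ 2 + e⁻¹ ^ 2) / 2) ^ 3 := by rw [← h2]; ring
  refine ⟨?_, ?_, ?_, ?_⟩ <;>
  · rw [← sub_eq_zero]
    ring_nf
    simp only [h2, h3, h4, h5, h6]
    field_simp
    ring

/-- The two real nodes at odd eighths of a period, as roots of the bisection equation. -/
theorem real_node {K : Type*} [Field K] [CharZero K] {h t σ : K} (h0 : h ≠ 0) (t2 : t ^ 2 = h ^ 2 + 1) :
    ((1 + t) * (h + t) / h) * ((1 - t) * (h - t) / h) = 1 ∧
      σ * (1 - ((1 + t) * (h + t) / h) ^ 2) =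
        -(2 * σ * t * (h + 1) / h) * ((1 + t) * (h + t) / h) ∧
      ((1 + t) * (h + t) / h) + ((1 - t) * (h - t) / h) = 2 * (h ^ 2 + h + 1) / h ∧
      (σ ^ 2 = 1 → (σ * (1 - ((1 + t) * (h + t) / h) ^ 2)) ^ 2 = 4 * ((1 + t) * (h + t) / h) *
        (((1 + t) * (h + t) / h) ^ 2 + (h ^ 2 + 1 / h ^ 2) * ((1 + t) * (h + t) / h) + 1)) := by
  set x := (1 + t) * (h + t) / h with hx
  set p := (1 - t) * (h - t) / h with hp
  have h1 : x * p = 1 := by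
    rw [hx, hp]; field_simp
    linear_combination t ^ 2 * t2
  have h2 : x + p = 2 * (h ^ 2 + h + 1) / h := by
    rw [hx, hp]; field_simp; linear_combination 2 * t2
  have h3 : x - p = 2 * t * (h + 1) / h := by
    rw [hx, hp]; field_simp; ring
  have h4 : σ * (1 - x ^ 2) = -(2 * σ * t * (h + 1) / h) * x := by
    linear_combination -σ * h1 - σ * x * h3
  refine ⟨h1, h4, h2, fun hs => ?_⟩
  have h5 : x ^ 2 + 1 = 2 * (h ^ 2 + h + 1) / h * x := by linear_combination x * h2 - h1
  have h6 : x ^ 2 + (h ^ 2 + 1 / h ^ 2) * x + 1 =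
      (2 * (h ^ 2 + h + 1) / h + (h ^ 2 + 1 / h ^ 2)) * x := by linear_combination h5
  rw [h4, h6]
  field_simp
  rw [hs, t2]
  ring

/-- The two imaginary nodes at odd eighths of a period. -/
theorem imag_node {I y q : ℂ} (I2 : I ^ 2 = -1) (h0 : h ≠ 0) (n0 : n ≠ 0) (ef : e * f = 1)
    (h2 : h ^ 2 = (e ^ 2 + f ^ 2) / 2) (n2 : n ^ 2 = (e ^ 2 - f ^ 2) / 2)
    (hy : y = -h ^ 2 - n ^ 2 * ((n + e) * (h + e) / (n * h)))
    (hq : q = -(e * (e - n) * (h - n) / h)) :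
    y = -(e * (e + n) * (h + n) / h) ∧ y * q = 1 ∧
      I * n ^ 3 * (τ * (1 - ((n + e) * (h + e) / (n * h)) ^ 2)) =
        2 * I * τ * n * (h + e) / h * y ∧
      y + q = -(2 * e * (e * h + n ^ 2) / h) ∧
      (τ ^ 2 = 1 → (I * n ^ 3 * (τ * (1 - ((n + e) * (h + e) / (n * h)) ^ 2))) ^ 2 =
        4 * y * (y ^ 2 + (h ^ 2 + 1 / h ^ 2) * y + 1)) := by
  have e2 : e ^ 2 = h ^ 2 + n ^ 2 := by rw [h2, n2]; ring
  have h1 : y = -(e * (e + n) * (h + n) / h) := by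
    rw [hy]; field_simp; linear_combination h * e2
  have hd : (e ^ 2 - n ^ 2) * (h ^ 2 - n ^ 2) * e ^ 2 = h ^ 2 := by
    rw [show h ^ 2 - n ^ 2 = f ^ 2 by rw [h2, n2]; ring, e2]
    have : e ^ 2 * f ^ 2 = 1 := by rw [← mul_pow, ef, one_pow]
    rw [← e2]
    linear_combination (e ^ 2 - n ^ 2) * this + e2
  have h3 : y * q = 1 := by
    rw [h1, hq]; field_simp; linear_combination hd
  have h4 : y + q = -(2 * e * (e * h + n ^ 2) / h) := by
    rw [h1, hq]; field_simp; ring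
  have h5 : I * n ^ 3 * (τ * (1 - ((n + e) * (h + e) / (n * h)) ^ 2)) =
        2 * I * τ * n * (h + e) / h * y := by
    rw [h1]
    field_simp
    linear_combination -I * τ * e ^ 2 * e2
  refine ⟨h1, h3, h5, h4, fun ht => ?_⟩
  have h6 : y ^ 2 + 1 = -(2 * e * (e * h + n ^ 2) / h) * y := by linear_combination y * h4 - h3
  have h7 : y ^ 2 + (h ^ 2 + 1 / h ^ 2) * y + 1 =
      (-(2 * e * (e * h + n ^ 2) / h) + (h ^ 2 + 1 / h ^ 2)) * y := by linear_combination h6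
  have h8 : e ^ 4 = 2 * e ^ 2 * h ^ 2 - 1 := by
    have : e ^ 2 * f ^ 2 = 1 := by rw [← mul_pow, ef, one_pow]
    linear_combination -this - 2 * e ^ 2 * h2
  have h9 : n ^ 2 = e ^ 2 - h ^ 2 := by rw [e2]; ring
  rw [h5, h7]
  field_simp
  rw [I2, ht, h9]
  linear_combination -4 * y ^ 2 * h8

/-- The signs of t, of the pair (e, f), of σ and of τ remain free, so the four off-middle nodes of a
quadrant are covered at once. -/
theorem corner_value {I x y : ℂ} (I2 : I ^ 2 = -1) (h0 : h ≠ 0) (n0 : n ≠ 0) (ef : e * f = 1)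
    (h2 : h ^ 2 = (e ^ 2 + f ^ 2) / 2) (n2 : n ^ 2 = (e ^ 2 - f ^ 2) / 2)
    (t2 : t ^ 2 = h ^ 2 + 1) (hσ : σ ^ 2 = 1) (hτ : τ ^ 2 = 1) (hx : x = (1 + t) * (h + t) / h)
    (hy : y = -h ^ 2 - n ^ 2 * ((n + e) * (h + e) / (n * h))) (hxy : x ≠ y) :
    ((σ * (1 - x ^ 2) - I * n ^ 3 * (τ * (1 - ((n + e) * (h + e) / (n * h)) ^ 2))) / (x - y)) ^ 2 / 4
      - (h ^ 2 + 1 / h ^ 2) - x - y =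
    (e + 1) ^ 2 * f / 2 / h ^ 2 * ((e - f) ^ 2 / 2 - I * (σ * τ) * n ^ 2
      + t / n * ((h ^ 2 - e) - I * (σ * τ) * (h ^ 2 - f))) - 1 := by
  obtain ⟨x1, x2, x3, x4⟩ := real_node (σ := σ) h0 t2
  obtain ⟨y1, y2, y3, y4, y5⟩ := imag_node (τ := τ) I2 h0 n0 ef h2 n2 hy rfl
  rw [← hx] at x1 x2 x3 x4
  refine addition_value (x4 hσ) (y5 hτ) hxy x1 y2 x2 y3 ?_
  have hM : x * -(e * (e - n) * (h - n) / h) + y * ((1 - t) * (h - t) / h) - 2 =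
      -2 * (e * (h ^ 2 + h + 1) * (e * h + n ^ 2) - e * (1 + h) * (e + h) * t * n + h ^ 2) / h ^ 2 := by
    rw [hx, y1]
    field_simp
    linear_combination -2 * e * (e * h + n ^ 2) * t2
  obtain ⟨c1, c2, c3, c4⟩ := corner_identities ef h2 n2 t2
  rw [hM]
  have key : (e + 1) ^ 2 * f / 2 / h ^ 2 * ((e - f) ^ 2 / 2 - I * (σ * τ) * n ^ 2
      + t / n * ((h ^ 2 - e) - I * (σ * τ) * (h ^ 2 - f))) - 1 =
      (((e + 1) ^ 2 * f / 2 * ((e - f) ^ 2 / 2) - h ^ 2) * n + (e + 1) ^ 2 * f / 2 * (h ^ 2 - e) * t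
        - I * (σ * τ) * ((e + 1) ^ 2 * f / 2 * (n ^ 3 + t * (h ^ 2 - f)))) / (h ^ 2 * n) := by
    field_simp
    ring
  rw [key]
  have key2 : -(-(2 * σ * t * (h + 1) / h) * (2 * I * τ * n * (h + e) / h)) / 2 +
      2 * (h ^ 2 + h + 1) / h - 2 * e * (e * h + n ^ 2) / h + 2 * (h ^ 2 + 1 / h ^ 2) =
      (-2 * n * (h ^ 2 * (-h * (h ^ 2 + h + 1) + h * e * (e * h + n ^ 2) - h ^ 4 - 1)) +
        2 * I * (σ * τ) * t * (n ^ 2 * h ^ 2 * (h + 1) * (h + e))) / (h ^ 4 * n) := by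
    field_simp
    ring
  have key3 : ∀ u v w : ℂ, u * (-2 * v) = w → u / (h ^ 2 * n) * (-2 * v / h ^ 2) =
      w / (h ^ 4 * n) := by
    intro u v w huv
    rw [← huv]
    field_simp
  refine (key3 _ _ _ ?_).trans (key2.symm.trans ?_)
  · linear_combination -2 * n * c4 - 2 * t * c3 + 2 * I * (σ * τ) *
      (n * ((e + 1) ^ 2 * f / 2) * c1 + t * c2)
  · linear_combination -x3 - y4

/-- These are the parts without and with I of the identity needed in `real_middle_value`. -/
theorem middle_identities (h0 : h ≠ 0) (ef : e * f = 1) (h2 : h ^ 2 = (e ^ 2 + f ^ 2) / 2)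
    (n2 : n ^ 2 = (e ^ 2 - f ^ 2) / 2) :
    (-h ^ 2 + (1 + f / h) * n ^ 2) * (-(2 * e * (e * h + n ^ 2) / h) - 2) =
        2 - 2 * e * (e * h + n ^ 2) / h + 2 * (h ^ 2 + 1 / h ^ 2) ∧
      -((1 + f / h) * f) * (-(2 * e * (e * h + n ^ 2) / h) - 2) = 2 * (h + 1 / h) * (h + e) / h := by
  rw [n2]
  have e0 : e ≠ 0 := left_ne_zero_of_mul_eq_one ef
  obtain rfl : f = e⁻¹ := eq_inv_of_mul_eq_one_right ef
  have h3 : h ^ 3 = h * ((e ^ 2 + e⁻¹ ^ 2) / 2) := by rw [← h2]; ring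
  have h4 : h ^ 4 = ((e ^ 2 + e⁻¹ ^ 2) / 2) ^ 2 := by rw [← h2]; ring
  constructor <;>
  · rw [← sub_eq_zero, ← mul_left_inj' (pow_ne_zero 2 h0), zero_mul]
    field_simp
    ring_nf
    simp only [h2, h3, h4]
    field_simp
    ring

theorem real_middle_value {I y : ℂ} (I2 : I ^ 2 = -1) (h0 : h ≠ 0) (n0 : n ≠ 0) (ef : e * f = 1)
    (h2 : h ^ 2 = (e ^ 2 + f ^ 2) / 2) (n2 : n ^ 2 = (e ^ 2 - f ^ 2) / 2) (hτ : τ ^ 2 = 1)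
    (hy : y = -h ^ 2 - n ^ 2 * ((n + e) * (h + e) / (n * h))) (hxy : 1 ≠ y) :
    ((-(2 * (h + 1 / h)) - I * n ^ 3 * (τ * (1 - ((n + e) * (h + e) / (n * h)) ^ 2))) / (1 - y)) ^ 2
      / 4 - (h ^ 2 + 1 / h ^ 2) - 1 - y = -h ^ 2 + (1 + f / h) * (n ^ 2 - I * τ * n * f) := by
  obtain ⟨y1, y2, y3, y4, y5⟩ := imag_node (τ := τ) I2 h0 n0 ef h2 n2 hy rfl
  refine addition_value (by field_simp; ring) (y5 hτ) hxy (one_mul 1) y2 (mul_one _).symm y3 ?_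
  obtain ⟨c1, c2⟩ := middle_identities h0 ef h2 n2
  linear_combination (-h ^ 2 + (1 + f / h) * (n ^ 2 - I * τ * n * f) - 1) * y4 + c1 + I * τ * n * c2

theorem imag_half_node {I : ℂ} (I2 : I ^ 2 = -1) (h0 : h ≠ 0) (ef : e * f = 1)
    (h2 : h ^ 2 = (e ^ 2 + f ^ 2) / 2) (n2 : n ^ 2 = (e ^ 2 - f ^ 2) / 2) :
    (-(2 * I * n ^ 2 * e ^ 2 / h)) ^ 2 =
      4 * -e ^ 2 * ((-e ^ 2) ^ 2 + (h ^ 2 + 1 / h ^ 2) * -e ^ 2 + 1) := by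
  have h8 : e ^ 4 = 2 * e ^ 2 * h ^ 2 - 1 := by
    linear_combination -(e * f + 1) * ef - 2 * e ^ 2 * h2
  have h9 : n ^ 4 = h ^ 4 - 1 := by
    rw [show n ^ 4 = (n ^ 2) ^ 2 by ring, show h ^ 4 = (h ^ 2) ^ 2 by ring, n2, h2]
    linear_combination -(e * f + 1) * ef
  field_simp
  rw [I2]
  linear_combination 4 * e ^ 2 * h ^ 2 * h8 - 4 * e ^ 4 * h9

theorem imag_middle_value {I x : ℂ} (I2 : I ^ 2 = -1) (h0 : h ≠ 0) (ef : e * f = 1)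
    (h2 : h ^ 2 = (e ^ 2 + f ^ 2) / 2) (n2 : n ^ 2 = (e ^ 2 - f ^ 2) / 2)
    (t2 : t ^ 2 = h ^ 2 + 1) (s2 : s ^ 2 = h ^ 2 - 1) (ts : t * s = n ^ 2) (hσ : σ ^ 2 = 1)
    (hx : x = (1 + t) * (h + t) / h) (hxy : x ≠ -e ^ 2) :
    ((σ * (1 - x ^ 2) - -(2 * I * n ^ 2 * e ^ 2 / h)) / (x - -e ^ 2)) ^ 2 / 4
      - (h ^ 2 + 1 / h ^ 2) - x - -e ^ 2 = -((1 + s / h) * (1 + I * (σ * s))) := by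
  obtain ⟨x1, x2, x3, x4⟩ := real_node (σ := σ) h0 t2
  rw [← hx] at x1 x2 x3 x4
  refine addition_value (m := 2 * I * n ^ 2 / h) (q := -f ^ 2) (x4 hσ)
    (imag_half_node I2 h0 ef h2 n2) hxy x1 ?_ x2 ?_ ?_
  · linear_combination (e * f + 1) * ef
  · field_simp
  have tn : t * n ^ 2 = (h ^ 2 + 1) * s := by rw [← ts, ← t2]; ring
  have k1 : x * -f ^ 2 + -e ^ 2 * ((1 - t) * (h - t) / h) - 2 =
      -2 * (h * (h ^ 2 + h + 1) - (h ^ 2 + 1) * s * (1 + h) / h + 1) := by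
    rw [← tn, hx, show e ^ 2 = h ^ 2 + n ^ 2 by rw [h2, n2]; ring,
      show f ^ 2 = h ^ 2 - n ^ 2 by rw [h2, n2]; ring]
    field_simp
    linear_combination -2 * h ^ 2 * t2
  have k2 : -(-(2 * σ * t * (h + 1) / h) * (2 * I * n ^ 2 / h)) / 2 =
      2 * I * σ * (h + 1) * ((h ^ 2 + 1) * s) / h ^ 2 := by rw [← tn]; field_simp
  have k3 : -((1 + s / h) * (1 + I * (σ * s))) *
      (-2 * (h * (h ^ 2 + h + 1) - (h ^ 2 + 1) * s * (1 + h) / h + 1)) =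
      2 * I * σ * (h + 1) * ((h ^ 2 + 1) * s) / h ^ 2 + 2 * (h ^ 2 + h + 1) / h + 2 / h ^ 2 := by
    field_simp
    linear_combination -(h + 1) * (h ^ 2 + 1) * (1 + I * σ * s) * s2
  rw [k1, k2]
  linear_combination k3 - x3 - 2 * h2

theorem middle_value {I : ℂ} (I2 : I ^ 2 = -1) (h0 : h ≠ 0) (ef : e * f = 1)
    (h2 : h ^ 2 = (e ^ 2 + f ^ 2) / 2) (n2 : n ^ 2 = (e ^ 2 - f ^ 2) / 2) (hxy : 1 ≠ -e ^ 2) :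
    ((-(2 * (h + 1 / h)) - -(2 * I * n ^ 2 * e ^ 2 / h)) / (1 - -e ^ 2)) ^ 2 / 4
      - (h ^ 2 + 1 / h ^ 2) - 1 - -e ^ 2 = -((1 + I * n ^ 2) / h ^ 2) := by
  refine addition_value (m := 2 * I * n ^ 2 / h) (q := -f ^ 2) ?_
    (imag_half_node I2 h0 ef h2 n2) hxy (one_mul 1) ?_ (mul_one _).symm ?_ ?_
  · field_simp; ring
  · linear_combination (e * f + 1) * ef
  · field_simp
  rw [show f ^ 2 = 2 * h ^ 2 - e ^ 2 by rw [h2]; ring]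
  field_simp
  ring

end Algebra

/-! ### Values and derivatives at nodes on the two axes -/

/-- The rational function of `h` and `t = ±√(h² + 1)` that takes the values of an essential elliptic
function with parameter `h²` at the quarters of its real half period. -/
noncomputable def quarterValue {K : Type*} [Field K] (h t : K) : K := (1 + t) * (h + t) / h

theorem ofReal_quarterValue (h t : ℝ) :
    ((quarterValue h t : ℝ) : ℂ) = quarterValue (h : ℂ) t := by
  simp [quarterValue]

theorem one_lt_quarterValue {h t : ℝ} (h0 : 0 < h) (t0 : 0 < t) : 1 < quarterValue h t := by
  rw [quarterValue, one_lt_div h0]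
  nlinarith [mul_pos t0 t0, mul_pos h0 t0]

theorem quarterValue_mul_neg {h t : ℝ} (h0 : 0 < h) (t2 : t ^ 2 = h ^ 2 + 1) :
    quarterValue h t * quarterValue h (-t) = 1 := by
  have := (real_node (σ := 1) h0.ne' t2).1
  simpa only [quarterValue, sub_eq_add_neg] using this

theorem quarterValue_neg_mem {h t : ℝ} (h0 : 0 < h) (t0 : 0 < t) (t2 : t ^ 2 = h ^ 2 + 1) :
    0 < quarterValue h (-t) ∧ quarterValue h (-t) < 1 := by
  rw [eq_inv_of_mul_eq_one_right (quarterValue_mul_neg h0 t2)]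
  have := one_lt_quarterValue h0 t0
  exact ⟨inv_pos.2 (by linarith), inv_lt_one_of_one_lt₀ this⟩

theorem quarterValue_eq {h t : ℝ} (h0 : 0 < h) (t2 : t ^ 2 = h ^ 2 + 1) :
    (quarterValue h t ^ 2 - 1) ^ 2 =
      4 * quarterValue h t * (quarterValue h t ^ 2 + (h ^ 2 + 1 / h ^ 2) * quarterValue h t + 1) := by
  have := (real_node (σ := 1) h0.ne' t2).2.2.2 (by norm_num)
  rw [quarterValue, ← this]
  ring

/-- Value and derivative of `R` at a point of analyticity. -/
structure HasJet (R : ℂ → ℂ) (z x x' : ℂ) : Prop where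
  analyticAt : AnalyticAt ℂ R z
  value : R z = x
  deriv : deriv R z = x'

namespace IsRealHalfPeriod

variable {R : ℂ → ℂ} {a h t : ℝ}

theorem jet_quarter (hr : IsRealHalfPeriod R a) (hR : Sol (h ^ 2 + 1 / h ^ 2 : ℝ) R)
    (hp : ¬ AnalyticAt ℂ R 0) (h0 : 0 < h) (t0 : 0 < t) (t2 : t ^ 2 = h ^ 2 + 1) :
    HasJet R (a / 4 : ℝ) (quarterValue h t : ℝ) (1 * (1 - quarterValue h t ^ 2) : ℝ) := by
  have ha := hr.pos
  obtain ⟨h1, h2⟩ := hr.values_quarter hR hp (by positivity) (one_lt_quarterValue h0 t0)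
    (quarterValue_eq h0 t2)
  exact ⟨(hr.interior _ (by linarith) (by linarith)).1, h1, by rw [h2, one_mul]⟩

theorem jet_three_quarter (hr : IsRealHalfPeriod R a) (hR : Sol (h ^ 2 + 1 / h ^ 2 : ℝ) R)
    (hp : ¬ AnalyticAt ℂ R 0) (h0 : 0 < h) (t0 : 0 < t) (t2 : t ^ 2 = h ^ 2 + 1) :
    HasJet R (3 * a / 4 : ℝ) (quarterValue h (-t) : ℝ) (-1 * (1 - quarterValue h (-t) ^ 2) : ℝ) := by
  have ha := hr.pos
  obtain ⟨h3, h4⟩ := quarterValue_neg_mem h0 t0 t2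
  obtain ⟨h1, h2⟩ := hr.values_three_quarter hR hp (by positivity) h3 h4
    (quarterValue_eq h0 (by rw [neg_sq, t2]))
  exact ⟨(hr.interior _ (by linarith) (by linarith)).1, h1, by rw [h2]; congr 1; ring⟩

theorem jet_half (hr : IsRealHalfPeriod R a) (hR : Sol (h ^ 2 + 1 / h ^ 2 : ℝ) R)
    (hp : ¬ AnalyticAt ℂ R 0) (h0 : 0 < h) :
    HasJet R (a / 2 : ℝ) 1 (-(2 * (h + 1 / h)) : ℝ) := by
  have ha := hr.pos
  refine ⟨(hr.interior _ (by linarith) (by linarith)).1, hr.apply_half hR hp, ?_⟩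
  rw [hr.deriv_half hR hp (q := h + 1 / h) (by positivity) (by field_simp; ring)]
  congr 1; ring

end IsRealHalfPeriod

/-- The radicals in which the values at the eighth lattice are expressed. -/
structure Radicals (β n h t s e f : ℝ) : Prop where
  h_pos : 0 < h
  n_pos : 0 < n
  t_pos : 0 < t
  s_pos : 0 < s
  f_pos : 0 < f
  h_sq : h ^ 2 = β
  t_sq : t ^ 2 = h ^ 2 + 1
  s_sq : s ^ 2 = h ^ 2 - 1
  mul_ts : t * s = n ^ 2
  mul_ef : e * f = 1
  h_sq' : h ^ 2 = (e ^ 2 + f ^ 2) / 2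
  n_sq : n ^ 2 = (e ^ 2 - f ^ 2) / 2
  sqrt_two_mul_t : √2 * t = e + f
  sqrt_two_mul_s : √2 * s = e - f

/-- The witnesses (t ± s)/√2 are the denested forms of √(h² + n²) and √(h² - n²); their product is 1
because t² - s² = 2. -/
theorem exists_radicals {β n : ℝ} (hβ : 1 < β) (hn : 0 < n) (hn4 : n ^ 4 = β ^ 2 - 1) :
    ∃ e f, Radicals β n √β √(β + 1) √(β - 1) e f := by
  have h2 : √β ^ 2 = β := Real.sq_sqrt (by linarith)
  have t2 : √(β + 1) ^ 2 = β + 1 := Real.sq_sqrt (by linarith)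
  have s2 : √(β - 1) ^ 2 = β - 1 := Real.sq_sqrt (by linarith)
  have c2 : √2 ^ 2 = 2 := Real.sq_sqrt (by norm_num)
  have t0 : 0 < √(β + 1) := Real.sqrt_pos.2 (by linarith)
  have s0 : 0 < √(β - 1) := Real.sqrt_pos.2 (by linarith)
  have c0 : 0 < √2 := Real.sqrt_pos.2 (by norm_num)
  have hst : √(β - 1) < √(β + 1) := Real.sqrt_lt_sqrt (by linarith) (by linarith)
  have hts : √(β + 1) * √(β - 1) = n ^ 2 := by
    rw [← Real.sqrt_mul (by linarith), show (β + 1) * (β - 1) = (n ^ 2) ^ 2 by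
      linear_combination -hn4, Real.sqrt_sq (by positivity)]
  generalize √(β + 1) = t at *
  generalize √(β - 1) = s at *
  generalize hc : √2 = c at *
  refine ⟨(t + s) / c, (t - s) / c, ⟨Real.sqrt_pos.2 (by linarith), hn, t0, s0,
    div_pos (by linarith) c0, h2, by rw [h2, t2], by rw [h2, s2], hts, ?_, ?_, ?_, ?_, ?_⟩⟩
  · field_simp; linear_combination t2 - s2 - c2
  · rw [h2]; field_simp; linear_combination 2 * β * c2 - 2 * t2 - 2 * s2
  · rw [← hts]; field_simp; linear_combination 2 * t * s * c2
  · rw [hc]; field_simp; linear_combination t * c2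
  · rw [hc]; field_simp; linear_combination s * c2

namespace PeriodData

variable {β n a b : ℝ} {R : ℂ → ℂ}

theorem jet_imag (D : PeriodData β n a b R) {v z z' : ℝ} (hv : HasJet (imagTransform β n R) v z z') :
    HasJet R (Complex.I / n * v) (-β - n ^ 2 * z : ℝ) (Complex.I * n ^ 3 * z') := by
  have ha := (imagTransform_analyticAt_iff D.sol D.n_pos.ne' _).1 hv.analyticAt
  refine ⟨ha, ?_, ?_⟩
  · rw [apply_eq_imagTransform D.sol D.n_pos.ne' ha, hv.value]; push_cast; rfl
  · rw [deriv_eq_imagTransform D.sol D.n_pos.ne' ha, hv.deriv]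

theorem value_real_add (D : PeriodData β n a b R) {z w : ℂ} (hz : AnalyticAt ℂ R z ∧ R z = w)
    (hw : w ≠ 0) : AnalyticAt ℂ R (a + z) ∧ R (a + z) = w⁻¹ := by
  rw [D.analyticAt_real_add_iff, D.sol.apply_zero_add D.pole D.real.analyticAt D.real.apply_eq, hz.2]
  exact ⟨hz.1.inv (by rwa [hz.2]), rfl⟩

/-- Translation by the imaginary half-period inverts `imagTransform`; in terms of R this is the
Möbius involution w ↦ -β + n⁴/(w + β). -/
theorem value_imag_add (D : PeriodData β n a b R) {z w : ℂ} (hz : AnalyticAt ℂ R z ∧ R z = w)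
    (hw : w + β ≠ 0) : AnalyticAt ℂ R (z + Complex.I / n * b) ∧
      R (z + Complex.I / n * b) = -β + n ^ 4 / (w + β) := by
  have hn := D.n_ne_zero
  set u : ℂ := -(Complex.I * n * z) with hu
  have e1 : Complex.I / n * u = z := by
    rw [hu]; field_simp; rw [Complex.I_sq]; ring
  have ha : AnalyticAt ℂ R (Complex.I / n * u) := by rw [e1]; exact hz.1
  have hT := (imagTransform_analyticAt_iff (β := β) D.sol D.n_pos.ne' u).2 ha
  have h1 := apply_eq_imagTransform (β := β) D.sol D.n_pos.ne' ha
  rw [e1, hz.2] at h1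
  have h2 : imagTransform β n R u = -(w + β) / n ^ 2 := by
    rw [h1]; field_simp; ring
  have hT0 : imagTransform β n R u ≠ 0 := by
    rw [h2]; exact div_ne_zero (neg_ne_zero.2 hw) (pow_ne_zero 2 hn)
  have h3 : AnalyticAt ℂ (imagTransform β n R) (b + u) := by
    have := analyticAt_comp_affine (f := imagTransform β n R) (b := b) (z := u) one_ne_zero
    rw [one_mul] at this
    rw [← this]
    refine (hT.inv hT0).congr (Eventually.of_forall fun z => ?_)
    simp only [one_mul]
    rw [D.sol_imag.apply_zero_add D.pole_imag D.imag.analyticAt D.imag.apply_eq, Pi.inv_apply]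
  have e2 : Complex.I / n * (b + u) = z + Complex.I / n * b := by rw [mul_add, e1, add_comm]
  have h4 := (imagTransform_analyticAt_iff D.sol D.n_pos.ne' _).1 h3
  have h5 := apply_eq_imagTransform (β := β) D.sol D.n_pos.ne' h4
  rw [e2] at h4 h5
  refine ⟨h4, ?_⟩
  rw [h5, D.sol_imag.apply_zero_add D.pole_imag D.imag.analyticAt D.imag.apply_eq, h2]
  field_simp
  ring

variable {h t s e f : ℝ}

theorem sol_real' (D : PeriodData β n a b R) (r : Radicals β n h t s e f) :
    Sol (h ^ 2 + 1 / h ^ 2 : ℝ) R := by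
  rw [r.h_sq]; exact D.sol

theorem sol_imag' (D : PeriodData β n a b R) (r : Radicals β n h t s e f) :
    Sol ((h / n) ^ 2 + 1 / (h / n) ^ 2 : ℝ) (imagTransform β n R) := by
  have := D.sol_imag
  rwa [show β / n ^ 2 + n ^ 2 / β = h ^ 2 / n ^ 2 + n ^ 2 / h ^ 2 by rw [r.h_sq],
    show h ^ 2 / n ^ 2 + n ^ 2 / h ^ 2 = (h / n) ^ 2 + 1 / (h / n) ^ 2 by
    rw [div_pow, one_div_div]] at this

/-- The addition formula for a point of the real and a point of the imaginary axis. -/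
theorem value_add (D : PeriodData β n a b R) (r : Radicals β n h t s e f) {u v x' y' : ℂ} {x y : ℝ}
    (hu : HasJet R u x x') (hv : HasJet R v y y') (hx : 0 < x) (hy : y < 0) (hy' : y' ≠ 0) :
    (x : ℂ) ≠ y ∧ AnalyticAt ℂ R (u + v) ∧
    R (u + v) = ((x' - y') / (x - y)) ^ 2 / 4 - ((h : ℂ) ^ 2 + 1 / (h : ℂ) ^ 2) - x - y := by
  have hxy : (x : ℂ) ≠ y := by exact_mod_cast (by linarith : x ≠ y)
  have := (D.sol_real' r).addition D.pole D.real.analyticAt D.real.apply_eq hv.analyticAt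
    (by rw [hv.value]; exact_mod_cast hy.ne) (by rwa [hv.deriv]) hu.analyticAt
    (by rwa [hu.value, hv.value])
  rw [hu.value, hv.value, hu.deriv, hv.deriv] at this
  refine ⟨hxy, this.1, this.2.trans ?_⟩
  push_cast
  rfl

end PeriodData

theorem quarterValue_div {n : ℝ} (n0 : n ≠ 0) (h e : ℝ) :
    (quarterValue (h / n) (e / n) : ℝ) = (n + e) * (h + e) / (n * h) := by
  rw [quarterValue]
  field_simp

namespace Radicals

variable {β n h t s e f : ℝ}

theorem e_pos (r : Radicals β n h t s e f) : 0 < e :=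
  (pos_iff_pos_of_mul_pos (r.mul_ef ▸ one_pos)).2 r.f_pos

theorem e_sq (r : Radicals β n h t s e f) : e ^ 2 = h ^ 2 + n ^ 2 := by
  rw [r.h_sq', r.n_sq]; ring

end Radicals

/-- The value at an interior node off the middle lines, in terms of signed radicals. -/
noncomputable def cornerValue (h n t e f ε : ℂ) : ℂ :=
  (e + 1) ^ 2 * f / 2 / h ^ 2 * ((e - f) ^ 2 / 2 - Complex.I * ε * n ^ 2
      + t / n * ((h ^ 2 - e) - Complex.I * ε * (h ^ 2 - f))) - 1

/-! ### Sums of a real and an imaginary node -/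

namespace PeriodData

variable {β n a b : ℝ} {R : ℂ → ℂ} {h t s e f : ℝ}

theorem jet_node (D : PeriodData β n a b R) (r : Radicals β n h t s e f) {v z z' : ℝ}
    (hv : HasJet (imagTransform β n R) v z z') :
    HasJet R (Complex.I / n * v) (-h ^ 2 - n ^ 2 * z : ℝ) (Complex.I * n ^ 3 * z') := by
  rw [r.h_sq]; exact D.jet_imag hv

/-- The signs t' = ±t and (e', f') = ±(e, f) distinguish the first quarter of each half-period from
the third, and σ, τ record the signs of the derivatives. The imaginary node has a negative value and
the real one a positive value, so the addition formula has a nonzero denominator. -/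
theorem quarter_add_quarter (D : PeriodData β n a b R) (r : Radicals β n h t s e f)
    {u v t' e' f' σ τ : ℝ} (t2 : t' ^ 2 = t ^ 2) (ef : e' * f' = 1) (e2 : e' ^ 2 = e ^ 2)
    (f2 : f' ^ 2 = f ^ 2) (hσ : σ ^ 2 = 1) (hτ : τ ^ 2 = 1)
    (hu : HasJet R u (quarterValue h t' : ℝ) (σ * (1 - quarterValue h t' ^ 2) : ℝ))
    (hv : HasJet (imagTransform β n R) v (quarterValue (h / n) (e' / n) : ℝ)
      (τ * (1 - quarterValue (h / n) (e' / n) ^ 2) : ℝ))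
    (hx : 0 < quarterValue h t') (hy : 0 < quarterValue (h / n) (e' / n))
    (hy1 : quarterValue (h / n) (e' / n) ≠ 1) :
    AnalyticAt ℂ R (u + Complex.I / n * v) ∧
      R (u + Complex.I / n * v) = cornerValue h n t' e' f' (σ * τ) := by
  have h0 : (h : ℂ) ≠ 0 := by exact_mod_cast r.h_pos.ne'
  have hτ0 : τ ≠ 0 := by rintro rfl; norm_num at hτ
  obtain ⟨h1, h2, h3⟩ := D.value_add r hu (D.jet_node r hv) hx
    (by have := r.h_pos; have := r.n_pos; nlinarith [mul_pos (pow_pos r.n_pos 2) hy, pow_pos r.h_pos 2])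
    (by
      refine mul_ne_zero (mul_ne_zero Complex.I_ne_zero (pow_ne_zero 3 D.n_ne_zero)) ?_
      rw [Complex.ofReal_ne_zero]
      refine mul_ne_zero hτ0 (sub_ne_zero.2 fun h => hy1 ?_)
      exact (pow_eq_one_iff_of_nonneg hy.le two_ne_zero).1 h.symm)
  rw [quarterValue_div r.n_pos.ne'] at h1 h3
  refine ⟨h2, ?_⟩
  have := corner_value (x := quarterValue h t') (y := (-h ^ 2 - n ^ 2 * ((n + e') * (h + e') / (n * h)) : ℝ))
    (e := e') (f := f') (t := t') (σ := σ) (τ := τ) (h := h) (n := n)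
    Complex.I_sq h0 D.n_ne_zero (by exact_mod_cast ef)
    (by have := r.h_sq'; rw [← e2, ← f2] at this; exact_mod_cast this)
    (by have := r.n_sq; rw [← e2, ← f2] at this; exact_mod_cast this)
    (by have := r.t_sq; rw [← t2] at this; exact_mod_cast this)
    (by exact_mod_cast hσ) (by exact_mod_cast hτ) rfl
    (by push_cast; rfl) (by rw [← ofReal_quarterValue]; exact h1)
  rw [h3, cornerValue, ← this, ofReal_quarterValue]
  push_cast [ofReal_quarterValue]
  rfl

theorem half_add_quarter (D : PeriodData β n a b R) (r : Radicals β n h t s e f)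
    {v e' f' τ : ℝ} (ef : e' * f' = 1) (e2 : e' ^ 2 = e ^ 2) (f2 : f' ^ 2 = f ^ 2) (hτ : τ ^ 2 = 1)
    (hv : HasJet (imagTransform β n R) v (quarterValue (h / n) (e' / n) : ℝ)
      (τ * (1 - quarterValue (h / n) (e' / n) ^ 2) : ℝ))
    (hy : 0 < quarterValue (h / n) (e' / n)) (hy1 : quarterValue (h / n) (e' / n) ≠ 1) :
    AnalyticAt ℂ R ((a / 2 : ℝ) + Complex.I / n * v) ∧
      R ((a / 2 : ℝ) + Complex.I / n * v) =
        -(h : ℂ) ^ 2 + (1 + f' / h) * (n ^ 2 - Complex.I * τ * n * f') := by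
  have h0 : (h : ℂ) ≠ 0 := by exact_mod_cast r.h_pos.ne'
  have hτ0 : τ ≠ 0 := by rintro rfl; norm_num at hτ
  have hj := D.real.jet_half (D.sol_real' r) D.pole r.h_pos
  rw [← Complex.ofReal_one] at hj
  obtain ⟨h1, h2, h3⟩ := D.value_add r hj (D.jet_node r hv) one_pos
    (by have := r.h_pos; have := r.n_pos; nlinarith [mul_pos (pow_pos r.n_pos 2) hy, pow_pos r.h_pos 2])
    (by
      refine mul_ne_zero (mul_ne_zero Complex.I_ne_zero (pow_ne_zero 3 D.n_ne_zero)) ?_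
      rw [Complex.ofReal_ne_zero]
      refine mul_ne_zero hτ0 (sub_ne_zero.2 fun h => hy1 ?_)
      exact (pow_eq_one_iff_of_nonneg hy.le two_ne_zero).1 h.symm)
  rw [quarterValue_div r.n_pos.ne'] at h1 h3
  refine ⟨h2, ?_⟩
  have := real_middle_value (y := (-h ^ 2 - n ^ 2 * ((n + e') * (h + e') / (n * h)) : ℝ))
    (e := e') (f := f') (τ := τ) (h := h) (n := n)
    Complex.I_sq h0 D.n_ne_zero (by exact_mod_cast ef)
    (by have := r.h_sq'; rw [← e2, ← f2] at this; exact_mod_cast this)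
    (by have := r.n_sq; rw [← e2, ← f2] at this; exact_mod_cast this)
    (by exact_mod_cast hτ) (by push_cast; rfl) (by exact_mod_cast h1)
  rw [h3, ← this]
  push_cast
  rfl

/-- The transform equals 1 at b/2, so R takes the value -h² - n² = -e² there. -/
theorem jet_imag_half (D : PeriodData β n a b R) (r : Radicals β n h t s e f) :
    HasJet R (Complex.I / n * (b / 2 : ℝ)) (-e ^ 2 : ℝ) (-(2 * Complex.I * n ^ 2 * e ^ 2 / h)) := by
  have hj := D.imag.jet_half (D.sol_imag' r) D.pole_imag (div_pos r.h_pos r.n_pos)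
  rw [← Complex.ofReal_one] at hj
  have := D.jet_node r hj
  have h0 : (h : ℂ) ≠ 0 := by exact_mod_cast r.h_pos.ne'
  have n0 := D.n_ne_zero
  have e2 : (e : ℂ) ^ 2 = h ^ 2 + n ^ 2 := by exact_mod_cast r.e_sq
  convert! this using 1
  · rw [r.e_sq]; congr 1; ring
  · rw [e2]; push_cast; field_simp

theorem quarter_add_half (D : PeriodData β n a b R) (r : Radicals β n h t s e f)
    {u t' s' σ : ℝ} (t2 : t' ^ 2 = t ^ 2) (s2 : s' ^ 2 = s ^ 2) (ts : t' * s' = n ^ 2)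
    (hσ : σ ^ 2 = 1)
    (hu : HasJet R u (quarterValue h t' : ℝ) (σ * (1 - quarterValue h t' ^ 2) : ℝ))
    (hx : 0 < quarterValue h t') :
    AnalyticAt ℂ R (u + Complex.I / n * (b / 2 : ℝ)) ∧
      R (u + Complex.I / n * (b / 2 : ℝ)) = -((1 + s' / h) * (1 + Complex.I * (σ * s'))) := by
  have h0 : (h : ℂ) ≠ 0 := by exact_mod_cast r.h_pos.ne'
  have e0 : (e : ℂ) ≠ 0 := by exact_mod_cast r.e_pos.ne'
  have n0 := D.n_ne_zero
  have I0 := Complex.I_ne_zero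
  obtain ⟨h1, h2, h3⟩ := D.value_add r hu (D.jet_imag_half r) hx
    (by have := pow_pos r.e_pos 2; linarith) (by simp [h0, e0, n0])
  refine ⟨h2, ?_⟩
  have := imag_middle_value (x := quarterValue h t') (e := e) (f := f) (t := t') (s := s')
    (σ := σ) (h := h) (n := n) Complex.I_sq h0 (by exact_mod_cast r.mul_ef)
    (by exact_mod_cast r.h_sq') (by exact_mod_cast r.n_sq)
    (by have := r.t_sq; rw [← t2] at this; exact_mod_cast this)
    (by have := r.s_sq; rw [← s2] at this; exact_mod_cast this) (by exact_mod_cast ts)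
    (by exact_mod_cast hσ) rfl (by rw [← ofReal_quarterValue]; exact_mod_cast h1)
  rw [h3, ← this, ofReal_quarterValue]
  push_cast [ofReal_quarterValue]
  rfl

theorem half_add_half (D : PeriodData β n a b R) (r : Radicals β n h t s e f) :
    AnalyticAt ℂ R ((a / 2 : ℝ) + Complex.I / n * (b / 2 : ℝ)) ∧
      R ((a / 2 : ℝ) + Complex.I / n * (b / 2 : ℝ)) = -((1 + Complex.I * n ^ 2) / h ^ 2) := by
  have h0 : (h : ℂ) ≠ 0 := by exact_mod_cast r.h_pos.ne'
  have e0 : (e : ℂ) ≠ 0 := by exact_mod_cast r.e_pos.ne'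
  have n0 := D.n_ne_zero
  have I0 := Complex.I_ne_zero
  have hj := D.real.jet_half (D.sol_real' r) D.pole r.h_pos
  rw [← Complex.ofReal_one] at hj
  obtain ⟨h1, h2, h3⟩ := D.value_add r hj (D.jet_imag_half r) one_pos
    (by have := pow_pos r.e_pos 2; linarith) (by simp [h0, e0, n0])
  refine ⟨h2, ?_⟩
  have := middle_value (e := e) (f := f) (h := h) (n := n) Complex.I_sq h0
    (by exact_mod_cast r.mul_ef)
    (by exact_mod_cast r.h_sq') (by exact_mod_cast r.n_sq) (by exact_mod_cast h1)
  rw [h3, ← this]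
  push_cast
  rfl

end PeriodData

/-! ### The cubic and its real root -/

open EighthLattice
-- Cardano's formula: the two cube roots u, v satisfy u³ + v³ = 38 and u·v = 4. Since v > 2, they
-- differ, so u + v > 4; this gives the bound 5/3.
theorem bRoot_spec : bRoot ^ 3 - bRoot ^ 2 - bRoot - 1 = 0 ∧ 5 / 3 < bRoot := by
  have s2 : √33 ^ 2 = 33 := Real.sq_sqrt (by norm_num)
  have s0 : 0 ≤ √33 := Real.sqrt_nonneg _
  have s1 : √33 < 6 := by nlinarith
  have cube : ∀ {x : ℝ}, 0 ≤ x → (x ^ (1 / 3 : ℝ)) ^ 3 = x := fun hx => by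
    rw [← Real.rpow_natCast, ← Real.rpow_mul hx]; norm_num
  have u3 := cube (show 0 ≤ 19 - 3 * √33 by linarith)
  have v3 := cube (show 0 ≤ 19 + 3 * √33 by linarith)
  have u0 : 0 < (19 - 3 * √33) ^ (1 / 3 : ℝ) := Real.rpow_pos_of_pos (by linarith) _
  have v0 : 0 < (19 + 3 * √33) ^ (1 / 3 : ℝ) := Real.rpow_pos_of_pos (by linarith) _
  rw [bRoot]
  generalize (19 - 3 * √33) ^ (1 / 3 : ℝ) = u at *
  generalize (19 + 3 * √33) ^ (1 / 3 : ℝ) = v at *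
  have huv : u * v = 4 := by
    have : (u * v) ^ 3 = 4 ^ 3 := by rw [mul_pow, u3, v3]; linear_combination -9 * s2
    exact (pow_left_inj₀ (by positivity) (by norm_num) (by norm_num)).1 this
  have v2 : 2 < v := by
    by_contra! h
    have := pow_le_pow_left₀ v0.le h 3
    linarith
  constructor
  · linear_combination u3 / 27 + v3 / 27 + (u + v) / 9 * huv
  · have : 0 < (u + v - 4) * v := by nlinarith [pow_pos (sub_pos.2 v2) 2]
    have := (pos_iff_pos_of_mul_pos this).2 v0
    linarith

theorem cubic_factor (x : ℝ) : x ^ 3 - x ^ 2 - x - 1 =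
    (x - bRoot) * (x ^ 2 + (bRoot - 1) * x + bRoot ^ 2 - bRoot - 1) := by
  linear_combination bRoot_spec.1

/-- The discriminant of the cofactor is (5 - 3b)(1 + b) with b the root, which is negative because b
> 5/3. -/
theorem cubic_factor_pos (x : ℝ) : 0 < x ^ 2 + (bRoot - 1) * x + bRoot ^ 2 - bRoot - 1 := by
  have := bRoot_spec.2
  nlinarith [sq_nonneg (2 * x + (bRoot - 1)), mul_pos (sub_pos.2 this) (show 0 < 1 + bRoot by linarith)]

theorem cubic_eq_zero_iff (x : ℝ) : x ^ 3 - x ^ 2 - x - 1 = 0 ↔ x = bRoot := by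
  rw [cubic_factor, mul_eq_zero, or_iff_left (cubic_factor_pos x).ne', sub_eq_zero]

/-! ### Denesting the radicals of the table -/

namespace Radicals

variable {β n h t s e f : ℝ}

theorem n_pow_four (r : Radicals β n h t s e f) : n ^ 4 = h ^ 4 - 1 := by
  rw [show n ^ 4 = (n ^ 2) ^ 2 by ring, ← r.mul_ts]
  linear_combination t ^ 2 * r.s_sq + (h ^ 2 - 1) * r.t_sq

theorem f_sq (r : Radicals β n h t s e f) : f ^ 2 = h ^ 2 - n ^ 2 := by
  rw [r.h_sq', r.n_sq]; ring

theorem sign_mul_abs (r : Radicals β n h t s e f) :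
    Real.sign (β - bRoot) * |β - e| = β - e := by
  have hβ : 1 < β := by have := pow_pos r.s_pos 2; rw [r.s_sq, r.h_sq] at this; linarith
  -- With e² = β + n² the left side is (β² - β)² - n⁴, that is (β - 1)(β³ - β² - β - 1). This is why
  -- the sign of β - e changes exactly at the real root of the cubic.
  have key : (β - e) * ((β + e) * (β ^ 2 - β + n ^ 2)) =
      (β - bRoot) * ((β - 1) * (β ^ 2 + (bRoot - 1) * β + bRoot ^ 2 - bRoot - 1)) := by
    have h1 := r.e_sq
    have h2 := r.n_pow_four
    have h3 := cubic_factor β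
    rw [r.h_sq] at h1
    rw [show h ^ 4 = (h ^ 2) ^ 2 by ring, r.h_sq] at h2
    linear_combination (β - 1) * h3 - (β ^ 2 - β + n ^ 2) * h1 - h2
  have hp : 0 < (β + e) * (β ^ 2 - β + n ^ 2) := by
    have := r.e_pos; have := pow_pos r.n_pos 2
    exact mul_pos (by linarith) (by nlinarith)
  have hq := mul_pos (sub_pos.2 hβ) (cubic_factor_pos β)
  rcases lt_trichotomy β bRoot with hb | hb | hb
  · have h1 : β - e < 0 := by
      by_contra! h
      have := mul_nonneg h hp.le
      rw [key] at this
      exact absurd this (not_le.2 (mul_neg_of_neg_of_pos (sub_neg.2 hb) hq))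
    rw [Real.sign_of_neg (sub_neg.2 hb), abs_of_neg h1]; ring
  · have h1 : β - e = 0 := by
      rw [sub_eq_zero.2 hb, zero_mul] at key
      exact (mul_eq_zero.1 key).resolve_right hp.ne'
    rw [h1]; simp
  · have h1 : 0 < β - e := by
      have := mul_pos (sub_pos.2 hb) hq
      rw [← key] at this
      exact (pos_iff_pos_of_mul_pos this).2 hp
    rw [Real.sign_of_pos (sub_pos.2 hb), abs_of_pos h1, one_mul]

/-- Products of nested radicals, for both choices of the sign of `c = ±√2`. -/
theorem mul_nested (r : Radicals β n h t s e f) {c e' f' : ℝ} (c2 : c ^ 2 = 2)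
    (ct : c * t = e' + f') (cs : c * s = e' - f') (ef : e' * f' = 1) (hs : h ^ 2 = (e' ^ 2 + f' ^ 2) / 2) :
    (t - c) * (β / s - 1 / t - c) = ((β - e') / n) ^ 2 ∧
      (t - c) * (β / s + 1 / t + c) = ((β - f') / n) ^ 2 := by
  have t0 := r.t_pos.ne'
  have s0 := r.s_pos.ne'
  -- Multiplication by c² = 2 allows c to be absorbed into c·t and c·s, which are expressed by e'
  -- and f'.
  have key : ∀ x y : ℝ, (e' + f' - 2) * x = 2 * y →
      x = h ^ 2 * (e' + f') - (e' - f') - (e' + f') * (e' - f') → y = (h ^ 2 - e') ^ 2 →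
      (t - c) * (h ^ 2 * t - s - c * (t * s)) = y := fun x y h1 h2 h3 => by
    have : c ^ 2 * ((t - c) * (h ^ 2 * t - s - c * (t * s))) = 2 * y := by
      rw [← h1, h2, ← c2, ← ct, ← cs]; ring
    rw [c2] at this
    linarith
  have key' : ∀ x y : ℝ, (e' + f' - 2) * x = 2 * y →
      x = h ^ 2 * (e' + f') + (e' - f') + (e' + f') * (e' - f') → y = (h ^ 2 - f') ^ 2 →
      (t - c) * (h ^ 2 * t + s + c * (t * s)) = y := fun x y h1 h2 h3 => by
    have : c ^ 2 * ((t - c) * (h ^ 2 * t + s + c * (t * s))) = 2 * y := by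
      rw [← h1, h2, ← c2, ← ct, ← cs]; ring
    rw [c2] at this
    linarith
  have e0 : e' ≠ 0 := left_ne_zero_of_mul_eq_one ef
  obtain rfl : f' = e'⁻¹ := eq_inv_of_mul_eq_one_right ef
  rw [div_pow, div_pow, ← r.mul_ts, ← r.h_sq, eq_div_iff (mul_ne_zero t0 s0),
    eq_div_iff (mul_ne_zero t0 s0)]
  constructor
  · rw [← key _ _ ?_ rfl rfl]
    · field_simp
    · rw [hs]; field_simp; ring
  · rw [← key' _ _ ?_ rfl rfl]
    · field_simp
    · rw [hs]; field_simp; ring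

theorem sqrt_eq {x y : ℝ} (hy : 0 < y) (h : y ^ 2 = x) : √x = y := by
  rw [← h, Real.sqrt_sq hy.le]

theorem sqrt_add_one (r : Radicals β n h t s e f) : √(β + 1) = t :=
  sqrt_eq r.t_pos (by rw [r.t_sq, r.h_sq])

theorem sqrt_sub_one (r : Radicals β n h t s e f) : √(β - 1) = s :=
  sqrt_eq r.s_pos (by rw [r.s_sq, r.h_sq])

theorem sqrt_one_add_inv (r : Radicals β n h t s e f) : √(1 + 1 / β) = t / h := by
  have h0 := r.h_pos
  refine sqrt_eq (div_pos r.t_pos h0) ?_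
  rw [div_pow, r.t_sq, ← r.h_sq]
  field_simp

theorem sqrt_one_sub_inv (r : Radicals β n h t s e f) : √(1 - 1 / β) = s / h := by
  have h0 := r.h_pos
  refine sqrt_eq (div_pos r.s_pos h0) ?_
  rw [div_pow, r.s_sq, ← r.h_sq]
  field_simp

theorem sqrt_half (r : Radicals β n h t s e f) : √((β + 1) / 2) = (e + f) / 2 := by
  refine sqrt_eq (div_pos (add_pos r.e_pos r.f_pos) two_pos) ?_
  rw [← r.h_sq]
  linear_combination -r.h_sq' / 2 + r.mul_ef / 2

theorem sqrt_one_sub_inv_sq (r : Radicals β n h t s e f) : √(1 - 1 / β ^ 2) = n ^ 2 / h ^ 2 := by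
  have h0 := r.h_pos
  refine sqrt_eq (div_pos (pow_pos r.n_pos 2) (pow_pos h0 2)) ?_
  rw [← r.h_sq]
  field_simp
  linear_combination r.n_pow_four

theorem δ_eq (r : Radicals β n h t s e f) : δ β = h ^ 2 / n ^ 2 := by
  have h0 := r.h_pos
  have n0 := r.n_pos
  have h4 : 0 < h ^ 4 - 1 := by rw [← r.n_pow_four]; positivity
  refine sqrt_eq (div_pos (pow_pos h0 2) (pow_pos n0 2)) ?_
  rw [d, ← r.h_sq, show h ^ 2 - 1 / h ^ 2 = n ^ 4 / h ^ 2 by rw [r.n_pow_four]; field_simp]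
  field_simp

theorem sqrt_δ_add_one (r : Radicals β n h t s e f) : √(δ β + 1) = e / n := by
  have n0 := r.n_pos
  refine sqrt_eq (div_pos r.e_pos n0) ?_
  rw [r.δ_eq, div_pow, r.e_sq]
  field_simp

theorem sqrt_δ_sub_one (r : Radicals β n h t s e f) : √(δ β - 1) = f / n := by
  have n0 := r.n_pos
  refine sqrt_eq (div_pos r.f_pos n0) ?_
  rw [r.δ_eq, div_pow, r.f_sq]
  field_simp

theorem sqrt_one_add_inv_δ (r : Radicals β n h t s e f) : √(1 + 1 / δ β) = e / h := by
  have n0 := r.n_pos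
  have h0 := r.h_pos
  refine sqrt_eq (div_pos r.e_pos h0) ?_
  rw [r.δ_eq, div_pow, r.e_sq]
  field_simp

theorem βSeq_eq (r : Radicals β n h t s e f) : βSeq β = ![1 - t, 1 - t / h, 1 + t / h, 1 + t] := by
  ext k
  rw [βSeq, quad, r.sqrt_add_one, r.sqrt_one_add_inv]

theorem δSeq_eq (r : Radicals β n h t s e f) : δSeq β = ![1 - e / n, 1 - e / h, 1 + e / h, 1 + e / n] := by
  ext k
  rw [δSeq, quad, r.sqrt_δ_add_one, r.sqrt_one_add_inv_δ]

theorem βSeq_two_mul_three (r : Radicals β n h t s e f) :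
    βSeq β 2 * βSeq β 3 = quarterValue h t := by
  have h0 := r.h_pos
  simp only [r.βSeq_eq, quarterValue, Matrix.cons_val]
  field_simp

theorem βSeq_zero_mul_one (r : Radicals β n h t s e f) :
    βSeq β 0 * βSeq β 1 = quarterValue h (-t) := by
  have h0 := r.h_pos
  simp only [r.βSeq_eq, quarterValue, Matrix.cons_val]
  field_simp
  ring

/-- The right-hand side is the translate by the imaginary half-period of the value at a/4, as given
by `value_imag_add`. -/
theorem βSeq_zero_mul_two (r : Radicals β n h t s e f) :
    βSeq β 0 * βSeq β 2 = -β + n ^ 4 / (quarterValue h t + β) := by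
  have h0 := r.h_pos
  have t0 := r.t_pos
  have : quarterValue h t + h ^ 2 ≠ 0 := by
    have := one_lt_quarterValue h0 t0
    positivity
  simp only [r.βSeq_eq, Matrix.cons_val]
  rw [← r.h_sq, ← sub_eq_iff_eq_add', eq_div_iff this, r.n_pow_four, quarterValue]
  field_simp
  linear_combination (-h * (1 + h) * (t ^ 2 + t) - h * (h - 1) * (t ^ 2 - t) +
    h ^ 2 * (t ^ 2 - h ^ 2 - 1) + (h ^ 2 - 1) * (t ^ 2 + h ^ 2)) * r.t_sq

theorem βSeq_one_mul_three (r : Radicals β n h t s e f) :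
    βSeq β 1 * βSeq β 3 = -β + n ^ 4 / (quarterValue h (-t) + β) := by
  have h0 := r.h_pos
  have t0 := r.t_pos
  have : quarterValue h (-t) + h ^ 2 ≠ 0 := by
    have := (quarterValue_neg_mem h0 t0 r.t_sq).1
    positivity
  simp only [r.βSeq_eq, Matrix.cons_val]
  rw [← r.h_sq, ← sub_eq_iff_eq_add', eq_div_iff this, r.n_pow_four, quarterValue]
  field_simp
  linear_combination (-h * (1 + h) * (t ^ 2 - t) - h * (h - 1) * (t ^ 2 + t) +
    h ^ 2 * (t ^ 2 - h ^ 2 - 1) + (h ^ 2 - 1) * (t ^ 2 + h ^ 2)) * r.t_sq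

theorem γPair_two_three (r : Radicals β n h t s e f) :
    -β * γPair β 2 3 = -h ^ 2 - n ^ 2 * quarterValue (h / n) (e / n) := by
  have h0 := r.h_pos
  have n0 := r.n_pos
  simp only [γPair, r.δSeq_eq, r.δ_eq, Matrix.cons_val, quarterValue_div n0.ne']
  rw [← r.h_sq]
  field_simp
  ring

theorem γPair_zero_one (r : Radicals β n h t s e f) :
    -β * γPair β 0 1 = -h ^ 2 - n ^ 2 * quarterValue (h / n) (-e / n) := by
  have h0 := r.h_pos
  have n0 := r.n_pos
  simp only [γPair, r.δSeq_eq, r.δ_eq, Matrix.cons_val, quarterValue_div n0.ne']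
  rw [← r.h_sq]
  field_simp
  ring

/-- The node lies at distance a from a node on the imaginary axis, so its value is the reciprocal of
the value there. -/
theorem γPair_zero_two (r : Radicals β n h t s e f) :
    -β * γPair β 0 2 = (-h ^ 2 - n ^ 2 * quarterValue (h / n) (e / n))⁻¹ := by
  have h0 := r.h_pos
  have n0 := r.n_pos
  refine eq_inv_of_mul_eq_one_left ?_
  simp only [γPair, r.δSeq_eq, r.δ_eq, Matrix.cons_val, quarterValue_div n0.ne']
  rw [← r.h_sq]
  field_simp
  linear_combination (e ^ 2 * (h ^ 2 - n ^ 2) - 2 * h * e * (e * h + n ^ 2) +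
    h ^ 2 * (e ^ 2 - h ^ 2 - n ^ 2)) * r.e_sq - h ^ 2 * e ^ 2 * r.f_sq +
    h ^ 2 * (e * f + 1) * r.mul_ef

theorem γPair_one_three (r : Radicals β n h t s e f) :
    -β * γPair β 1 3 = (-h ^ 2 - n ^ 2 * quarterValue (h / n) (-e / n))⁻¹ := by
  have h0 := r.h_pos
  have n0 := r.n_pos
  refine eq_inv_of_mul_eq_one_left ?_
  simp only [γPair, r.δSeq_eq, r.δ_eq, Matrix.cons_val, quarterValue_div n0.ne']
  rw [← r.h_sq]
  field_simp
  linear_combination (e ^ 2 * (h ^ 2 - n ^ 2) - 2 * h * -e * (-e * h + n ^ 2) +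
    h ^ 2 * (e ^ 2 - h ^ 2 - n ^ 2)) * r.e_sq - h ^ 2 * e ^ 2 * r.f_sq +
    h ^ 2 * (e * f + 1) * r.mul_ef

theorem γPlus_eq (r : Radicals β n h t s e f) : -β * γPlus β = -e ^ 2 := by
  have h0 := r.h_pos
  rw [γPlus, r.δ_eq, ← r.h_sq, r.e_sq]
  field_simp

theorem γMinus_eq (r : Radicals β n h t s e f) : -β * γMinus β = (-e ^ 2)⁻¹ := by
  have h0 := r.h_pos
  rw [γMinus, r.δ_eq, ← r.h_sq, inv_neg, ← inv_pow, inv_eq_of_mul_eq_one_right r.mul_ef, r.f_sq]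
  field_simp

theorem cj_γ (r : Radicals β n h t s e f) :
    -cj (γ β) / β = -((1 + Complex.I * n ^ 2) / h ^ 2) := by
  have h0 : (h : ℂ) ≠ 0 := by exact_mod_cast r.h_pos.ne'
  have n0 : (n : ℂ) ≠ 0 := by exact_mod_cast r.n_pos.ne'
  simp only [cj, γ, map_sub, map_one, map_div₀, map_mul, Complex.conj_I, Complex.conj_ofReal]
  rw [r.δ_eq, ← r.h_sq]
  push_cast
  field_simp
  ring

theorem βPlus_mul (r : Radicals β n h t s e f) :
    -βPlus β * cj (γZero β) = -((1 + s / h) * (1 + Complex.I * (1 * s))) := by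
  simp only [cj, γZero, βPlus, r.sqrt_one_sub_inv, r.sqrt_sub_one, map_sub, map_one, map_mul,
    Complex.conj_I, Complex.conj_ofReal]
  push_cast
  ring

theorem βMinus_mul (r : Radicals β n h t s e f) :
    -βMinus β * cj (γZero β) = -((1 + (-s : ℝ) / h) * (1 + Complex.I * (-1 * (-s : ℝ)))) := by
  simp only [cj, γZero, βMinus, r.sqrt_one_sub_inv, r.sqrt_sub_one, map_sub, map_one, map_mul,
    Complex.conj_I, Complex.conj_ofReal]
  push_cast
  ring

theorem f_div_h (r : Radicals β n h t s e f) : (√(1 + 1 / β) - √(1 - 1 / β)) / √2 = f / h := by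
  have h0 := r.h_pos
  have c0 : 0 < √2 := Real.sqrt_pos.2 (by norm_num)
  have c2 : √2 ^ 2 = 2 := Real.sq_sqrt (by norm_num)
  rw [r.sqrt_one_add_inv, r.sqrt_one_sub_inv, ← sub_div, div_right_comm]
  congr 1
  rw [div_eq_iff c0.ne']
  refine mul_left_cancel₀ c0.ne' ?_
  linear_combination r.sqrt_two_mul_t - r.sqrt_two_mul_s - f * c2

theorem γSubPlus_eq (r : Radicals β n h t s e f) :
    -β * cj (γSubPlus β) = -(h : ℂ) ^ 2 + (1 + f / h) * (n ^ 2 - Complex.I * 1 * n * f) := by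
  have h0 : (h : ℂ) ≠ 0 := by exact_mod_cast r.h_pos.ne'
  have n0 : (n : ℂ) ≠ 0 := by exact_mod_cast r.n_pos.ne'
  simp only [cj, γSubPlus, δPlus, r.f_div_h, r.sqrt_δ_sub_one, map_sub, map_add, map_one, map_mul,
    map_div₀, Complex.conj_I, Complex.conj_ofReal]
  rw [r.δ_eq, ← r.h_sq]
  push_cast
  field_simp
  ring

theorem γSubMinus_eq (r : Radicals β n h t s e f) :
    -β * cj (γSubMinus β) =
      -(h : ℂ) ^ 2 + (1 + (-f : ℝ) / h) * (n ^ 2 - Complex.I * (-1 : ℝ) * n * (-f : ℝ)) := by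
  have h0 : (h : ℂ) ≠ 0 := by exact_mod_cast r.h_pos.ne'
  have n0 : (n : ℂ) ≠ 0 := by exact_mod_cast r.n_pos.ne'
  simp only [cj, γSubMinus, δMinus, r.f_div_h, r.sqrt_δ_sub_one, map_sub, map_add, map_one, map_mul,
    map_div₀, Complex.conj_I, Complex.conj_ofReal]
  rw [r.δ_eq, ← r.h_sq]
  push_cast
  field_simp
  ring

/-- This fixes the sign of β - f, the only other difference among the nested radicals besides β - e.
-/
theorem f_lt (r : Radicals β n h t s e f) : f < β := by
  have h1 := r.f_pos
  have h2 := r.h_sq'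
  have h3 := r.mul_ef
  have h4 := pow_pos r.n_pos 2
  have h5 := r.n_sq
  rw [← r.h_sq]
  have h6 : f < e := lt_of_pow_lt_pow_left₀ 2 r.e_pos.le (by linarith)
  have h7 : f < 1 := by
    by_contra! h
    nlinarith
  nlinarith [sq_nonneg (e - f)]

theorem sqrt_mul_nested {x y z n : ℝ} (hx : 0 ≤ x) (hn : 0 < n) (h : x * y = (z / n) ^ 2) :
    √x * √y = |z| / n := by
  rw [← Real.sqrt_mul hx, h, Real.sqrt_sq_eq_abs, abs_div, abs_of_pos hn]

/-- By `mul_nested` each product of two square roots is an absolute value divided by n. Three of the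
quantities are positive; only β - e changes sign, and the sign factor compensates for that. -/
theorem nested_radicals (r : Radicals β n h t s e f) :
    Real.sign (β - bRoot) * √(β / s - 1 / t - √2) * √(t - √2) = (β - e) / n ∧
      √(β / s + 1 / t + √2) * √(t - √2) = (β - f) / n ∧
      √(β / s - 1 / t + √2) * √(t + √2) = (β + e) / n ∧
      √(β / s + 1 / t - √2) * √(t + √2) = (β + f) / n := by
  have n0 := r.n_pos
  have e0 := r.e_pos
  have f0 := r.f_pos
  have hf := r.f_lt
  have c0 : 0 < √2 := Real.sqrt_pos.2 (by norm_num)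
  have c2 : √2 ^ 2 = 2 := Real.sq_sqrt (by norm_num)
  have hc : 0 ≤ t - √2 := by
    rw [sub_nonneg]
    refine Real.sqrt_le_iff.2 ⟨r.t_pos.le, ?_⟩
    have := pow_pos r.s_pos 2
    rw [r.s_sq] at this
    rw [r.t_sq]
    linarith
  obtain ⟨h1, h2⟩ := r.mul_nested c2 r.sqrt_two_mul_t r.sqrt_two_mul_s r.mul_ef r.h_sq'
  obtain ⟨h3, h4⟩ := r.mul_nested (c := -√2) (e' := -e) (f' := -f) (by rw [neg_sq, c2])
    (by linear_combination -r.sqrt_two_mul_t) (by linear_combination -r.sqrt_two_mul_s)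
    (by rw [neg_mul_neg, r.mul_ef]) (by rw [neg_sq, neg_sq, r.h_sq'])
  simp only [sub_neg_eq_add, ← sub_eq_add_neg] at h3 h4
  have hc' : 0 ≤ t + √2 := by linarith [r.t_pos]
  refine ⟨?_, ?_, ?_, ?_⟩
  · rw [mul_assoc, mul_comm √(β / s - _ - _), sqrt_mul_nested hc n0 h1, ← mul_div_assoc,
      r.sign_mul_abs]
  · rw [mul_comm, sqrt_mul_nested hc n0 h2, abs_of_pos (by linarith)]
  · rw [mul_comm, sqrt_mul_nested hc' n0 h3, abs_of_pos (by linarith)]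
  · rw [mul_comm, sqrt_mul_nested hc' n0 h4, abs_of_pos (by linarith)]

/-- The identity e·f = 1 turns (e + 1)²f/2 into (e + f)/2 + 1, which is √((β+1)/2) + 1, or 1 -
√((β+1)/2) when both signs are reversed. -/
theorem cornerValue_eq {h n t e f ε A B C : ℂ} (h0 : h ≠ 0) (ef : e * f = 1)
    (h2 : h ^ 2 = (e ^ 2 + f ^ 2) / 2) (hA : A = (e + f) / 2 + 1) (hB : B = (h ^ 2 - e) / n)
    (hC : C = (h ^ 2 - f) / n) :
    A * (1 - 1 / h ^ 2 - Complex.I * ε * (n ^ 2 / h ^ 2)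
      + t / h ^ 2 * (B - Complex.I * ε * C)) - 1 = cornerValue h n t e f ε := by
  have hA' : (e + 1) ^ 2 * f / 2 = A := by rw [hA]; linear_combination (e / 2 + 1) * ef
  have hs : (e - f) ^ 2 / 2 = h ^ 2 - 1 := by linear_combination -h2 - ef
  rw [cornerValue, hA', hs, hB, hC]
  field_simp

theorem cj_γ44 (r : Radicals β n h t s e f) : cj (γ44 β) = cornerValue h n t e f 1 := by
  have h0 : (h : ℂ) ≠ 0 := by exact_mod_cast r.h_pos.ne'
  obtain ⟨h1, h2, -, -⟩ := r.nested_radicals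
  have h1' : (Real.sign (β - bRoot) : ℂ) * √(β / s - 1 / t - √2) * √(t - √2) = (h ^ 2 - e) / n := by
    have := r.h_sq; subst this; exact_mod_cast h1
  have h2' : (√(β / s + 1 / t + √2) : ℂ) * √(t - √2) = (h ^ 2 - f) / n := by
    have := r.h_sq; subst this; exact_mod_cast h2
  simp only [cj, γ44, r.sqrt_half, r.sqrt_one_sub_inv_sq, r.sqrt_add_one, r.sqrt_sub_one, map_sub,
    map_add, map_mul, map_one, map_div₀, Complex.conj_I, Complex.conj_ofReal]
  have hβ : (β : ℂ) = h ^ 2 := by exact_mod_cast r.h_sq.symm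
  rw [← cornerValue_eq (t := (t : ℂ)) (ε := 1) h0 (by exact_mod_cast r.mul_ef)
    (by exact_mod_cast r.h_sq') rfl rfl rfl, ← h1', ← h2', hβ]
  push_cast
  ring

theorem cj_γ43 (r : Radicals β n h t s e f) :
    cj (γ43 β) = cornerValue h n (-t : ℝ) e f (-1) := by
  have h0 : (h : ℂ) ≠ 0 := by exact_mod_cast r.h_pos.ne'
  obtain ⟨h1, h2, -, -⟩ := r.nested_radicals
  have h1' : (Real.sign (β - bRoot) : ℂ) * √(β / s - 1 / t - √2) * √(t - √2) = (h ^ 2 - e) / n := by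
    have := r.h_sq; subst this; exact_mod_cast h1
  have h2' : (√(β / s + 1 / t + √2) : ℂ) * √(t - √2) = (h ^ 2 - f) / n := by
    have := r.h_sq; subst this; exact_mod_cast h2
  simp only [cj, γ43, r.sqrt_half, r.sqrt_one_sub_inv_sq, r.sqrt_add_one, r.sqrt_sub_one, map_sub,
    map_add, map_mul, map_one, map_div₀, Complex.conj_I, Complex.conj_ofReal]
  have hβ : (β : ℂ) = h ^ 2 := by exact_mod_cast r.h_sq.symm
  rw [← cornerValue_eq (t := ((-t : ℝ) : ℂ)) (ε := -1) h0 (by exact_mod_cast r.mul_ef)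
    (by exact_mod_cast r.h_sq') rfl rfl rfl, ← h1', ← h2', hβ]
  push_cast
  ring

theorem cj_γ41 (r : Radicals β n h t s e f) :
    cj (γ41 β) = cornerValue h n t (-e : ℝ) (-f : ℝ) (-1) := by
  have h0 : (h : ℂ) ≠ 0 := by exact_mod_cast r.h_pos.ne'
  obtain ⟨-, -, h1, h2⟩ := r.nested_radicals
  have h1' : (√(β / s - 1 / t + √2) : ℂ) * √(t + √2) = (h ^ 2 - (-e : ℝ)) / n := by
    have := r.h_sq; subst this; push_cast; rw [sub_neg_eq_add]; exact_mod_cast h1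
  have h2' : (√(β / s + 1 / t - √2) : ℂ) * √(t + √2) = (h ^ 2 - (-f : ℝ)) / n := by
    have := r.h_sq; subst this; push_cast; rw [sub_neg_eq_add]; exact_mod_cast h2
  simp only [cj, γ41, r.sqrt_half, r.sqrt_one_sub_inv_sq, r.sqrt_add_one, r.sqrt_sub_one, map_sub,
    map_add, map_mul, map_one, map_div₀, Complex.conj_I, Complex.conj_ofReal]
  have hβ : (β : ℂ) = h ^ 2 := by exact_mod_cast r.h_sq.symm
  rw [← cornerValue_eq (t := (t : ℂ)) (ε := -1) h0
    (by have := r.mul_ef; rw [← neg_mul_neg] at this; exact_mod_cast this)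
    (by have := r.h_sq'; rw [← neg_sq e, ← neg_sq f] at this; exact_mod_cast this) rfl rfl rfl,
    ← h1', ← h2', hβ]
  push_cast
  ring

theorem cj_γ42 (r : Radicals β n h t s e f) :
    cj (γ42 β) = cornerValue h n (-t : ℝ) (-e : ℝ) (-f : ℝ) 1 := by
  have h0 : (h : ℂ) ≠ 0 := by exact_mod_cast r.h_pos.ne'
  obtain ⟨-, -, h1, h2⟩ := r.nested_radicals
  have h1' : (√(β / s - 1 / t + √2) : ℂ) * √(t + √2) = (h ^ 2 - (-e : ℝ)) / n := by
    have := r.h_sq; subst this; push_cast; rw [sub_neg_eq_add]; exact_mod_cast h1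
  have h2' : (√(β / s + 1 / t - √2) : ℂ) * √(t + √2) = (h ^ 2 - (-f : ℝ)) / n := by
    have := r.h_sq; subst this; push_cast; rw [sub_neg_eq_add]; exact_mod_cast h2
  simp only [cj, γ42, r.sqrt_half, r.sqrt_one_sub_inv_sq, r.sqrt_add_one, r.sqrt_sub_one, map_sub,
    map_add, map_mul, map_one, map_div₀, Complex.conj_I, Complex.conj_ofReal]
  have hβ : (β : ℂ) = h ^ 2 := by exact_mod_cast r.h_sq.symm
  rw [← cornerValue_eq (t := ((-t : ℝ) : ℂ)) (ε := 1) h0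
    (by have := r.mul_ef; rw [← neg_mul_neg] at this; exact_mod_cast this)
    (by have := r.h_sq'; rw [← neg_sq e, ← neg_sq f] at this; exact_mod_cast this) rfl rfl rfl,
    ← h1', ← h2', hβ]
  push_cast
  ring

end Radicals

/-! ### Assembling the table -/

namespace PeriodData

variable {β n a b : ℝ} {R : ℂ → ℂ} {h t s e f : ℝ}

theorem jet_imag_quarter (D : PeriodData β n a b R) (r : Radicals β n h t s e f) :
    HasJet (imagTransform β n R) (b / 4 : ℝ) (quarterValue (h / n) (e / n) : ℝ)
      (1 * (1 - quarterValue (h / n) (e / n) ^ 2) : ℝ) := by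
  have n0 := r.n_pos
  exact D.imag.jet_quarter (D.sol_imag' r) D.pole_imag (div_pos r.h_pos n0) (div_pos r.e_pos n0)
    (by rw [div_pow, r.e_sq]; field_simp)

theorem jet_imag_three_quarter (D : PeriodData β n a b R) (r : Radicals β n h t s e f) :
    HasJet (imagTransform β n R) (3 * b / 4 : ℝ) (quarterValue (h / n) (-e / n) : ℝ)
      (-1 * (1 - quarterValue (h / n) (-e / n) ^ 2) : ℝ) := by
  have n0 := r.n_pos
  rw [neg_div]
  exact D.imag.jet_three_quarter (D.sol_imag' r) D.pole_imag (div_pos r.h_pos n0) (div_pos r.e_pos n0)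
    (by rw [div_pow, r.e_sq]; field_simp)

/-- The values on the fundamental quarter of the table. -/
theorem takesValue_quadrant (D : PeriodData β n a b R) (j k : Fin 5) :
    TakesValue R (((j : ℕ) * (2 * a) + (k : ℕ) * (2 * (Complex.I / n * b))) / 8)
      (table β (Fin.castLE (by norm_num) k) (Fin.castLE (by norm_num) j)) := by
  obtain ⟨e, f, r⟩ := exists_radicals D.one_lt D.n_pos D.n_pow
  set h := √β
  set t := √(β + 1)
  set s := √(β - 1)
  have n0 := r.n_pos
  have hn := div_pos r.h_pos n0
  have en := div_pos r.e_pos n0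
  have eh : (e / n) ^ 2 = (h / n) ^ 2 + 1 := by rw [div_pow, r.e_sq]; field_simp
  have key : ∀ {z z' w w' : ℂ}, AnalyticAt ℂ R z' ∧ R z' = w' → z = z' → w = w' →
      TakesValue R z (fin w) := by
    rintro z _ w _ h rfl rfl
    exact h
  have x1 := one_lt_quarterValue r.h_pos r.t_pos
  have x3 := quarterValue_neg_mem r.h_pos r.t_pos r.t_sq
  have y1 := one_lt_quarterValue hn en
  have y3 := quarterValue_neg_mem hn en eh
  rw [← neg_div] at y3
  have j1 := D.real.jet_quarter (D.sol_real' r) D.pole r.h_pos r.t_pos r.t_sq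
  have j3 := D.real.jet_three_quarter (D.sol_real' r) D.pole r.h_pos r.t_pos r.t_sq
  have j2 := D.real.jet_half (D.sol_real' r) D.pole r.h_pos
  have k1 := D.jet_imag_quarter r
  have k3 := D.jet_imag_three_quarter r
  have l1 := D.jet_node r k1
  have l2 := D.jet_imag_half r
  have l3 := D.jet_node r k3
  have a4 : AnalyticAt ℂ R a ∧ R a = 0 := ⟨D.real.analyticAt, D.real.apply_eq⟩
  have b4 : AnalyticAt ℂ R (Complex.I / n * b) ∧ R (Complex.I / n * b) = -β :=
    ⟨D.analyticAt_imag, D.apply_imag⟩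
  have hβ := D.one_lt
  have yne : ∀ y : ℝ, 0 < y → -h ^ 2 - n ^ 2 * y ≠ 0 := fun y hy => by
    have := mul_pos (pow_pos n0 2) hy
    have := pow_pos r.h_pos 2
    linarith
  have one_sq' : (-1 : ℝ) ^ 2 = 1 := by norm_num
  -- Rows 0 to 3 come from the axes and the addition formula, with column 4 obtained by inversion;
  -- row 4 uses translation by a half-period.
  fin_cases k <;> fin_cases j
  -- row 0
  · exact D.sol.order_eq_neg_two (by simpa using D.pole)
  · exact key ⟨j1.1, j1.2⟩ (by push_cast; ring) (by exact_mod_cast r.βSeq_two_mul_three)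
  · exact key ⟨j2.1, j2.2⟩ (by push_cast; ring) rfl
  · exact key ⟨j3.1, j3.2⟩ (by push_cast; ring) (by exact_mod_cast r.βSeq_zero_mul_one)
  · exact key a4 (by push_cast; ring) rfl
  -- row 1
  · exact key ⟨l1.1, l1.2⟩ (by push_cast; ring) (by exact_mod_cast r.γPair_two_three)
  · exact key (D.quarter_add_quarter r rfl r.mul_ef rfl rfl (one_pow 2) (one_pow 2) j1 k1
      (by linarith) (by linarith) y1.ne') (by push_cast; ring) (by rw [r.cj_γ44]; simp)
  · exact key (D.half_add_quarter r r.mul_ef rfl rfl (one_pow 2) k1 (by linarith) y1.ne')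
      (by push_cast; ring) (by rw [r.γSubPlus_eq]; simp)
  · exact key (D.quarter_add_quarter r (neg_sq t) r.mul_ef rfl rfl one_sq' (one_pow 2) j3 k1
      x3.1 (by linarith) y1.ne') (by push_cast; ring) (by rw [r.cj_γ43]; simp)
  · exact key (D.value_real_add ⟨l1.1, l1.2⟩ (by
      exact_mod_cast yne _ (by linarith)))
      (by push_cast; ring) (by exact_mod_cast r.γPair_zero_two)
  -- row 2
  · exact key ⟨l2.1, l2.2⟩ (by push_cast; ring) (by exact_mod_cast r.γPlus_eq)
  · exact key (D.quarter_add_half r rfl rfl r.mul_ts (one_pow 2) j1 (by linarith))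
      (by push_cast; ring) (by rw [r.βPlus_mul]; simp)
  · exact key (D.half_add_half r) (by push_cast; ring) r.cj_γ
  · exact key (D.quarter_add_half r (neg_sq t) (neg_sq s) (by rw [neg_mul_neg, r.mul_ts]) one_sq'
      j3 x3.1) (by push_cast; ring) (by rw [r.βMinus_mul]; simp)
  · exact key (D.value_real_add ⟨l2.1, l2.2⟩ (by
      exact_mod_cast neg_ne_zero.2 (pow_ne_zero 2 r.e_pos.ne')))
      (by push_cast; ring) (by exact_mod_cast r.γMinus_eq)
  -- row 3
  · exact key ⟨l3.1, l3.2⟩ (by push_cast; ring) (by exact_mod_cast r.γPair_zero_one)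
  · exact key (D.quarter_add_quarter r rfl (by rw [neg_mul_neg, r.mul_ef]) (neg_sq e) (neg_sq f)
      (one_pow 2) one_sq' j1 k3 (by linarith) y3.1 y3.2.ne) (by push_cast; ring)
      (by rw [r.cj_γ41]; simp)
  · exact key (D.half_add_quarter r (by rw [neg_mul_neg, r.mul_ef]) (neg_sq e) (neg_sq f) one_sq' k3
      y3.1 y3.2.ne) (by push_cast; ring) (by rw [r.γSubMinus_eq])
  · exact key (D.quarter_add_quarter r (neg_sq t) (by rw [neg_mul_neg, r.mul_ef]) (neg_sq e)
      (neg_sq f) one_sq' one_sq' j3 k3 x3.1 y3.1 y3.2.ne) (by push_cast; ring)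
      (by rw [r.cj_γ42]; simp)
  · exact key (D.value_real_add ⟨l3.1, l3.2⟩ (by
      exact_mod_cast yne _ y3.1))
      (by push_cast; ring) (by exact_mod_cast r.γPair_one_three)
  -- row 4
  · exact key b4 (by push_cast; ring) rfl
  · exact key (D.value_imag_add ⟨j1.1, j1.2⟩ (by
      exact_mod_cast (by linarith : 0 < quarterValue h t + β).ne')) (by push_cast; ring)
      (by exact_mod_cast r.βSeq_zero_mul_two)
  · refine key (D.value_imag_add ⟨j2.1, j2.2⟩ (by
      exact_mod_cast (by linarith : 0 < 1 + β).ne')) (by push_cast; ring) ?_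
    have : (1 + β : ℂ) ≠ 0 := by exact_mod_cast (by linarith : 0 < 1 + β).ne'
    have h4 : (n : ℂ) ^ 4 = β ^ 2 - 1 := by exact_mod_cast D.n_pow
    rw [h4]
    field_simp
    ring
  · exact key (D.value_imag_add ⟨j3.1, j3.2⟩ (by
      exact_mod_cast (by linarith : 0 < quarterValue h (-t) + β).ne')) (by push_cast; ring)
      (by exact_mod_cast r.βSeq_one_mul_three)
  · refine key (D.value_real_add b4 (by
      exact_mod_cast (by linarith : -β ≠ 0))) (by push_cast; ring) ?_
    rw [inv_neg, neg_div, one_div]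

end PeriodData

/-- Conjugation of a value in the extended plane. -/
def conjValue (v : OnePoint ℂ) : OnePoint ℂ := Option.map cj v

theorem conjValue_fin (w : ℂ) : conjValue (fin w) = fin (cj w) := rfl

theorem conjValue_infty : conjValue OnePoint.infty = OnePoint.infty := rfl

theorem cj_mul (z w : ℂ) : cj (z * w) = cj z * cj w := map_mul _ z w

theorem cj_div (z w : ℂ) : cj (z / w) = cj z / cj w := map_div₀ _ z w

theorem cj_neg (z : ℂ) : cj (-z) = -cj z := map_neg _ z

theorem cj_one : cj 1 = 1 := map_one _

theorem cj_zero : cj 0 = 0 := map_zero _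

theorem cj_ofReal (x : ℝ) : cj x = x := Complex.conj_ofReal x

theorem cj_cj (z : ℂ) : cj (cj z) = z := Complex.conj_conj z

/-- Reversing the columns conjugates the entries because R is real and even: z ↦ ω₁ - z̄ fixes the
row. -/
theorem table_rev_col (β : ℝ) (j k : Fin 9) : table β k j.rev = conjValue (table β k j) := by
  fin_cases k <;> fin_cases j <;>
    simp [table, conjValue_fin, conjValue_infty, cj_mul, cj_div, cj_neg, cj_one, cj_zero, cj_ofReal,
      cj_cj]

theorem table_rev_row (β : ℝ) (j k : Fin 9) : table β k.rev j = conjValue (table β k j) := by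
  fin_cases k <;> fin_cases j <;>
    simp [table, conjValue_fin, conjValue_infty, cj_mul, cj_div, cj_neg, cj_one, cj_zero, cj_ofReal,
      cj_cj]

theorem Sol.takesValue_infty_iff {κ : ℂ} {R : ℂ → ℂ} (hR : Sol κ R) {z : ℂ} :
    TakesValue R z none ↔ ¬ AnalyticAt ℂ R z := by
  refine ⟨fun h ha => ?_, hR.order_eq_neg_two⟩
  have h1 : meromorphicOrderAt R z = -2 := h
  have := ha.meromorphicOrderAt_nonneg
  rw [h1] at this
  exact absurd this (by decide)

namespace PeriodData

variable {β n a b : ℝ} {R : ℂ → ℂ}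

theorem takesValue_add (D : PeriodData β n a b R) {z w : ℂ} {v : OnePoint ℂ}
    (hw : Function.Periodic R w) (h : TakesValue R z v) : TakesValue R (z + w) v := by
  match v with
  | none =>
    rw [D.sol.takesValue_infty_iff] at h ⊢
    rwa [Sol.analyticAt_add_iff hw]
  | some x => exact ⟨(Sol.analyticAt_add_iff hw z).2 h.1, (hw z).trans h.2⟩

theorem analyticAt_conj (D : PeriodData β n a b R) {z : ℂ} (h : AnalyticAt ℂ R z) :
    AnalyticAt ℂ R (cj z) := by
  rw [cj]
  have := AnalyticAt.conj_conj h
  simpa [D.sol.apply_conj D.pole (Complex.conj_ofReal _)] using this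

theorem takesValue_conj (D : PeriodData β n a b R) {z : ℂ} {v : OnePoint ℂ}
    (h : TakesValue R z v) : TakesValue R (cj z) (conjValue v) := by
  match v with
  | none =>
    refine D.sol.takesValue_infty_iff.2 fun h1 => D.sol.takesValue_infty_iff.1 h ?_
    have := D.analyticAt_conj h1
    rwa [cj_cj] at this
  | some x =>
    refine ⟨D.analyticAt_conj h.1, ?_⟩
    rw [← h.2]
    exact D.sol.apply_conj D.pole (Complex.conj_ofReal _) z

theorem takesValue_neg (D : PeriodData β n a b R) {z : ℂ} {v : OnePoint ℂ}
    (h : TakesValue R z v) : TakesValue R (-z) v := by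
  have key : ∀ {z : ℂ}, AnalyticAt ℂ R z → AnalyticAt ℂ R (-z) := fun {z} hz => by
    have := analyticAt_comp_affine (f := R) (b := 0) (z := -z) (neg_ne_zero.2 (one_ne_zero (α := ℂ)))
    simp only [zero_add, neg_one_mul, neg_neg] at this
    have := this.2 hz
    simpa only [D.sol.even D.pole] using this
  match v with
  | none =>
    refine D.sol.takesValue_infty_iff.2 fun h1 => D.sol.takesValue_infty_iff.1 h ?_
    simpa using key h1
  | some x => exact ⟨key h.1, (D.sol.even D.pole z).trans h.2⟩

/-- The node in column `j` and row `k`. -/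
theorem takesValue_table (D : PeriodData β n a b R) (j k : Fin 9) :
    TakesValue R (((j : ℕ) * (2 * a) + (k : ℕ) * (2 * (Complex.I / n * b))) / 8) (table β k j) := by
  have hcj : ∀ x y : ℂ, cj ((x * (2 * a) + y * (2 * (Complex.I / n * b))) / 8) =
      (cj x * (2 * a) - cj y * (2 * (Complex.I / n * b))) / 8 := fun x y => by
    simp only [cj, map_div₀, map_add, map_mul, Complex.conj_ofReal, Complex.conj_I, map_ofNat]
    ring
  have hcn : ∀ m : ℕ, cj m = m := fun m => Complex.conj_natCast m
  have hrev : ∀ j : Fin 9, ((j.rev : ℕ) : ℂ) = 8 - (j : ℕ) := fun j => by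
    rw [Fin.val_rev, Nat.cast_sub (by omega)]; push_cast; ring
  -- Conjugation followed by translation by the imaginary period exchanges rows k and 8 - k.
  have hrow : ∀ j k : Fin 9,
      TakesValue R (((j : ℕ) * (2 * a) + (k : ℕ) * (2 * (Complex.I / n * b))) / 8) (table β k j) →
      TakesValue R (((j : ℕ) * (2 * a) + (k.rev : ℕ) * (2 * (Complex.I / n * b))) / 8)
        (table β k.rev j) := fun j k h => by
    have := D.takesValue_add D.periodic_imag (D.takesValue_conj h)
    rw [hcj, hcn, hcn] at this
    rw [table_rev_row, hrev]
    convert! this using 1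
    ring
  -- The map z ↦ -z̄ followed by translation by the real period exchanges columns j and 8 - j.
  have hcol : ∀ j k : Fin 9,
      TakesValue R (((j : ℕ) * (2 * a) + (k : ℕ) * (2 * (Complex.I / n * b))) / 8) (table β k j) →
      TakesValue R (((j.rev : ℕ) * (2 * a) + (k : ℕ) * (2 * (Complex.I / n * b))) / 8)
        (table β k j.rev) := fun j k h => by
    have := D.takesValue_add D.periodic_real (D.takesValue_neg (D.takesValue_conj h))
    rw [hcj, hcn, hcn] at this
    rw [table_rev_col, hrev]
    convert! this using 1
    ring
  have hlow : ∀ j : Fin 9, ∃ i : Fin 5, j = Fin.castLE (by norm_num) i ∨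
      j = (Fin.castLE (by norm_num) i : Fin 9).rev := by decide
  obtain ⟨i, rfl | rfl⟩ := hlow j <;> obtain ⟨l, rfl | rfl⟩ := hlow k
  · exact D.takesValue_quadrant i l
  · exact hrow _ _ (D.takesValue_quadrant i l)
  · exact hcol _ _ (D.takesValue_quadrant i l)
  · exact hcol _ _ (hrow _ _ (D.takesValue_quadrant i l))

theorem periodPair_spec (D : PeriodData β n a b R) :
    D.periodPair.ω₁.im = 0 ∧ 0 < D.periodPair.ω₁.re ∧ D.periodPair.ω₂.re = 0 ∧
      0 < D.periodPair.ω₂.im := by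
  have e1 : D.periodPair.ω₁ = ((2 * a : ℝ) : ℂ) := by simp [periodPair]
  have e2 : D.periodPair.ω₂ = ((2 * b / n : ℝ) : ℂ) * Complex.I := by
    simp only [periodPair]; push_cast; ring
  have ha := D.real.pos
  have hb := D.imag.pos
  have hn := D.n_pos
  rw [e1, e2, Complex.re_ofReal_mul, Complex.im_ofReal_mul, Complex.ofReal_re, Complex.ofReal_im,
    Complex.I_re, Complex.I_im, mul_zero, mul_one]
  exact ⟨rfl, by positivity, rfl, by positivity⟩

end PeriodData

end EssentialElliptic

open EssentialElliptic in
theorem mainTheorem1 (β : ℝ) (hβ : 1 < β) :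
    (∃! R : ℂ → ℂ, EighthLattice.IsEssentialElliptic β R) ∧
    (∀ x : ℝ, x ^ 3 - x ^ 2 - x - 1 = 0 ↔ x = EighthLattice.bRoot) ∧
    ∀ R : ℂ → ℂ, EighthLattice.IsEssentialElliptic β R →
      ∃ L : PeriodPair,
        (L.ω₁.im = 0 ∧ 0 < L.ω₁.re ∧ L.ω₂.re = 0 ∧ 0 < L.ω₂.im) ∧
        (∀ w : ℂ, Function.Periodic R w ↔ w ∈ L.lattice) ∧
        (∀ z : ℂ, z ∉ L.lattice →
          R z = L.weierstrassP z - ((β : ℂ) + 1 / β) / 3) ∧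
        ∀ j k : Fin 9, ∀ l ∈ L.lattice,
          EighthLattice.TakesValue R
            (((j : ℕ) * L.ω₁ + (k : ℕ) * L.ω₂) / 8 + l)
            (EighthLattice.table β k j) := by
  refine ⟨existsUnique_isEssentialElliptic (by linarith), cubic_eq_zero_iff, fun R hR => ?_⟩
  obtain ⟨n, a, b, D⟩ := exists_periodData hβ hR
  exact ⟨D.periodPair, D.periodPair_spec, D.periodic_iff_mem, fun z hz => D.eq_weierstrassP hz,
    fun j k l hl => D.takesValue_add (D.periodic_of_mem hl) (D.takesValue_table j k)⟩
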